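/- Let $K$ be a complete discrete valuation field whose residue field $F$ has characteristic $p>0$, let $\Omega$ be an algebraically closed field containing $K$, and let $L\subset\Omega$ be a finite Galois extension of $K$. Every finite extension of $K$ is given the unique (up to equivalence) extension of the valuation of $K$. Then there exists a finite extension $K'\subset\Omega$ of $K$ satisfying the following two conditions. (i) $e(LK'/K')=1$, where $LK'\subset\Omega$ is the composite field of $L$ and $K'$, and $e$ denotes the ramification index. (ii) The residue field of $K'$ is a separable (algebraic) extension of the residue field $F$ of $K$. -/

import Mathlib

open scoped WithZero
open IsLocalRing

/-! Let `A` be the algebraic closure of `K` in `Ω`. Completeness gives `A` a multiplicative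
ultrametric norm invariant under `K`-automorphisms, and the question becomes one about subfields of
`A`. Here `SameValues M K₀` encodes e = 1, `ResSeparable` encodes condition (ii), and `Eliminable K₀
N` is the conclusion over the base `K₀`. By `Eliminable.trans` the base may be replaced by any
finite residually separable extension.

If all element degrees are prime to p, the residue extension is separable
(`ResSeparable.of_degOver`). So a primitive p-th root of unity and a λ with λ^(p-1) = -p (when p ≠ 0
in `A`), and then the fixed field of a Sylow p-subgroup, can be absorbed into the base. What remains
is a tower of steps that are Artin–Schreier in characteristic p and Kummer otherwise
(`exists_primeTower`). They are treated one at a time: e = 1 is already known for M over K₀, and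
M(t) has to be handled.

Both kinds of step lead to the relation t^p - t ≡ z modulo integral elements, where z matters only
modulo integral elements and elements s^p - s. Three facts drive the argument. If z is trivial in
this sense, M(t)/M is unramified (`ASType.sameValues_of_trivial`). If the pole of z is dominated by
u/g^p, where the residue class of u is not a p-th power, the residue degree is full and again e = 1
(`ASType.sameValues_of_not_pow`). Finally, totally ramified extensions of K₀ leave its residue field
unchanged, so they may be adjoined freely (`Eliminable.of_totallyRamified`).

`ASType.eliminable` is an induction on the pole order m of z. When p divides m, either the second
fact applies or the pole can be lowered. When p does not divide m, `PowSum.succ_or_eliminable`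
rewrites the coefficients of z as p^n-th powers for larger and larger n, unless a coefficient that
is not a p-th power turns up after adjoining a root of the uniformizer and finishes the proof. The
base having been enlarged inside M so that the residue field of M is purely inseparable of bounded
exponent over it, a large n makes z congruent to some κ in K₀ (`PowSum.exists_mem`). A root τ of τ^p
- τ = κ is then totally ramified over K₀, and over M(τ) the element z becomes trivial.

For a Kummer step, `eliminable_of_pow_mem` divides the generator y by elements of the field until
y^p - 1 is divisible by p, and then t = (y - 1)/λ has Artin–Schreier shape. The only obstruction on
the way is again a residue class that is not a p-th power, and then e = 1 directly. -/

section

open Polynomial IntermediateField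

/-! ### Ultrametric estimates, and additivity of p-th powers up to multiples of p. -/

section Norm

variable {A : Type*} [NormedField A] [IsUltrametricDist A]

theorem norm_add_le_of_le_of_le {x y : A} {B : ℝ} (hx : ‖x‖ ≤ B) (hy : ‖y‖ ≤ B) : ‖x + y‖ ≤ B :=
  (IsUltrametricDist.norm_add_le_max x y).trans (max_le hx hy)

theorem norm_sub_le_of_le_of_le {x y : A} {B : ℝ} (hx : ‖x‖ ≤ B) (hy : ‖y‖ ≤ B) : ‖x - y‖ ≤ B := by
  rw [sub_eq_add_neg]; exact norm_add_le_of_le_of_le hx (by rwa [norm_neg])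

theorem norm_add_lt_of_lt_of_lt {x y : A} {B : ℝ} (hx : ‖x‖ < B) (hy : ‖y‖ < B) : ‖x + y‖ < B :=
  (IsUltrametricDist.norm_add_le_max x y).trans_lt (max_lt hx hy)

theorem norm_sub_lt_of_lt_of_lt {x y : A} {B : ℝ} (hx : ‖x‖ < B) (hy : ‖y‖ < B) : ‖x - y‖ < B := by
  rw [sub_eq_add_neg]; exact norm_add_lt_of_lt_of_lt hx (by rwa [norm_neg])

theorem norm_eq_of_norm_sub_lt {x y : A} (h : ‖x - y‖ < ‖y‖) : ‖x‖ = ‖y‖ := by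
  have := IsUltrametricDist.norm_add_eq_max_of_norm_ne_norm h.ne
  rwa [sub_add_cancel, max_eq_right h.le] at this

theorem norm_eq_of_norm_sub_lt_left {x y : A} (h : ‖x - y‖ < ‖x‖) : ‖x‖ = ‖y‖ :=
  (norm_eq_of_norm_sub_lt (by rwa [norm_sub_rev])).symm

theorem norm_sum_lt {ι : Type*} {s : Finset ι} {f : ι → A} {B : ℝ} (hB : 0 < B)
    (h : ∀ i ∈ s, ‖f i‖ < B) : ‖∑ i ∈ s, f i‖ < B := by
  classical
  induction s using Finset.induction_on with
  | empty => simpa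
  | insert i s his ih =>
    rw [Finset.sum_insert his]
    exact norm_add_lt_of_lt_of_lt (h i (by simp)) (ih fun j hj => h j (by simp [hj]))

theorem norm_sum_le_of_forall_le {ι : Type*} {s : Finset ι} {f : ι → A} {B : ℝ} (hB : 0 ≤ B)
    (h : ∀ i ∈ s, ‖f i‖ ≤ B) : ‖∑ i ∈ s, f i‖ ≤ B :=
  IsUltrametricDist.norm_sum_le_of_forall_le_of_nonneg hB h

/-- A sum whose nonzero terms have pairwise distinct norms has the norm of one of its terms. -/
theorem exists_norm_sum_eq {ι : Type*} {s : Finset ι} {f : ι → A}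
    (hne : ∃ i ∈ s, f i ≠ 0)
    (h : ∀ i ∈ s, ∀ j ∈ s, f i ≠ 0 → f j ≠ 0 → ‖f i‖ = ‖f j‖ → i = j) :
    ∃ i ∈ s, f i ≠ 0 ∧ ‖∑ j ∈ s, f j‖ = ‖f i‖ ∧ ∀ j ∈ s, j ≠ i → ‖f j‖ < ‖f i‖ := by
  classical
  obtain ⟨i0, hi0, hi0'⟩ := hne
  obtain ⟨i, hi, hmax⟩ := s.exists_max_image (fun i => ‖f i‖) ⟨i0, hi0⟩
  have hi' : f i ≠ 0 := by
    intro h0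
    have := hmax i0 hi0
    simp only [h0, norm_zero] at this
    exact hi0' (norm_le_zero_iff.1 this)
  have hlt : ∀ j ∈ s, j ≠ i → ‖f j‖ < ‖f i‖ := by
    intro j hj hji
    refine lt_of_le_of_ne (hmax j hj) fun he => ?_
    by_cases h0 : f j = 0
    · rw [h0, norm_zero] at he; exact hi' (norm_eq_zero.1 he.symm)
    · exact hji (h j hj i hi h0 hi' he)
  refine ⟨i, hi, hi', ?_, hlt⟩
  apply norm_eq_of_norm_sub_lt
  rw [← Finset.add_sum_erase s f hi, add_sub_cancel_left]
  exact norm_sum_lt (norm_pos_iff.2 hi') fun j hj =>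
    hlt j (Finset.mem_of_mem_erase hj) (Finset.ne_of_mem_erase hj)

variable {p : ℕ}

/-- The mixed binomial terms carry a factor p, and each of their monomials is bounded by the larger
of the two p-th powers. It is mostly used with ‖p‖B ≤ 1, where it says that Frobenius is additive
modulo the unit ball even on elements with poles. -/
theorem norm_add_pow_prime_sub_le (hp : p.Prime) {x y : A} {B : ℝ} (hx : ‖x‖ ^ p ≤ B)
    (hy : ‖y‖ ^ p ≤ B) : ‖(x + y) ^ p - (x ^ p + y ^ p)‖ ≤ ‖(p : A)‖ * B := by
  have hB : 0 ≤ B := le_trans (by positivity) hx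
  rw [add_pow_prime_eq hp, add_sub_cancel_left, mul_assoc, mul_assoc, norm_mul, Finset.mul_sum,
    Finset.mul_sum]
  gcongr
  refine norm_sum_le_of_forall_le hB fun k hk => ?_
  obtain ⟨h1, h2⟩ := Finset.mem_Ioo.1 hk
  have hM : (max ‖x‖ ‖y‖) ^ p ≤ B := by
    rcases max_choice ‖x‖ ‖y‖ with h | h <;> rw [h] <;> assumption
  have e : x * (y * (x ^ (k - 1) * y ^ (p - k - 1) * ((p.choose k / p : ℕ) : A))) =
      x ^ k * y ^ (p - k) * ((p.choose k / p : ℕ) : A) := by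
    obtain ⟨k, rfl⟩ : ∃ l, k = l + 1 := ⟨k - 1, by omega⟩
    obtain ⟨l, hl⟩ : ∃ l, p - (k + 1) = l + 1 := ⟨p - (k + 1) - 1, by omega⟩
    rw [hl]; simp only [Nat.add_sub_cancel]; ring
  rw [e, norm_mul, norm_mul, norm_pow, norm_pow]
  calc ‖x‖ ^ k * ‖y‖ ^ (p - k) * ‖((p.choose k / p : ℕ) : A)‖
      ≤ (max ‖x‖ ‖y‖) ^ k * (max ‖x‖ ‖y‖) ^ (p - k) * 1 := by
        gcongr
        · exact le_max_left _ _
        · exact le_max_right _ _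
        · exact IsUltrametricDist.norm_natCast_le_one A _
    _ = (max ‖x‖ ‖y‖) ^ p := by rw [mul_one, ← pow_add]; congr 1; omega
    _ ≤ B := hM

theorem norm_neg_pow_add_pow_le (hp : p.Prime) {x : A} {B : ℝ} (hx : ‖x‖ ^ p ≤ B) :
    ‖(-x) ^ p + x ^ p‖ ≤ ‖(p : A)‖ * B := by
  have := norm_add_pow_prime_sub_le hp (x := -x) (y := x) (B := B) (by rwa [norm_neg]) hx
  rwa [neg_add_cancel, zero_pow hp.ne_zero, zero_sub, norm_neg] at this

theorem norm_sub_pow_prime_sub_le (hp : p.Prime) {x y : A} {B : ℝ} (hx : ‖x‖ ^ p ≤ B)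
    (hy : ‖y‖ ^ p ≤ B) : ‖(x - y) ^ p - (x ^ p - y ^ p)‖ ≤ ‖(p : A)‖ * B := by
  have h1 := norm_add_pow_prime_sub_le hp (x := x) (y := -y) (B := B) hx (by rwa [norm_neg])
  have h2 := norm_neg_pow_add_pow_le hp hy
  have := norm_add_le_of_le_of_le h1 h2
  convert this using 2
  ring

theorem norm_sum_pow_prime_sub_le (hp : p.Prime) {ι : Type*} (s : Finset ι) {f : ι → A} {B : ℝ}
    (hB : 0 ≤ B) (hf : ∀ i ∈ s, ‖f i‖ ^ p ≤ B) :
    ‖(∑ i ∈ s, f i) ^ p - ∑ i ∈ s, f i ^ p‖ ≤ ‖(p : A)‖ * B := by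
  classical
  induction s using Finset.induction_on with
  | empty => simp [hp.ne_zero]; positivity
  | insert i s his ih =>
    rw [Finset.sum_insert his, Finset.sum_insert his]
    have h2 : ‖∑ i ∈ s, f i‖ ^ p ≤ B := by
      rw [← norm_pow]
      by_cases hs : s.Nonempty
      · obtain ⟨j, hj, hmax⟩ := s.exists_max_image (fun i => ‖f i‖) hs
        rw [norm_pow]
        refine le_trans ?_ (hf j (by simp [hj]))
        gcongr
        exact norm_sum_le_of_forall_le (norm_nonneg _) hmax
      · rw [Finset.not_nonempty_iff_eq_empty.1 hs]; simpa [hp.ne_zero] using hB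
    have h1 := norm_add_pow_prime_sub_le hp (hf i (by simp)) h2
    have h3 := ih fun j hj => hf j (by simp [hj])
    convert norm_add_le_of_le_of_le h1 h3 using 2
    ring

end Norm

/-! ### The residue field of a nonarchimedean normed field. -/

section Residue

variable (A : Type*) [NormedField A] [IsUltrametricDist A]

/-- The closed unit ball of a nonarchimedean normed field, as a valuation ring. -/
noncomputable abbrev unitBall : ValuationSubring A := (NormedField.valuation (K := A)).valuationSubring

/-- The residue field of a nonarchimedean normed field. -/
noncomputable abbrev Resid : Type _ := ResidueField (unitBall A)

variable {A}

theorem mem_unitBall {x : A} : x ∈ unitBall A ↔ ‖x‖ ≤ 1 := by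
  rw [Valuation.mem_valuationSubring_iff, NormedField.valuation_apply, ← NNReal.coe_le_coe]
  simp

open Classical in
/-- The residue class of an element of norm at most one. -/
noncomputable def res (x : A) : Resid A :=
  if h : ‖x‖ ≤ 1 then residue (unitBall A) ⟨x, mem_unitBall.2 h⟩ else 0

theorem res_of_le {x : A} (h : ‖x‖ ≤ 1) : res x = residue (unitBall A) ⟨x, mem_unitBall.2 h⟩ :=
  dif_pos h

theorem res_coe (x : unitBall A) : res (x : A) = residue (unitBall A) x :=
  res_of_le (mem_unitBall.1 x.2)

theorem res_eq_zero_iff {x : A} (h : ‖x‖ ≤ 1) : res x = 0 ↔ ‖x‖ < 1 := by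
  rw [res_of_le h, residue_eq_zero_iff, ValuationSubring.valuation_lt_one_iff,
    ← (Valuation.isEquiv_valuation_valuationSubring (NormedField.valuation (K := A))).lt_one_iff_lt_one,
    NormedField.valuation_apply, ← NNReal.coe_lt_coe]
  simp

theorem res_add {x y : A} (hx : ‖x‖ ≤ 1) (hy : ‖y‖ ≤ 1) : res (x + y) = res x + res y := by
  rw [res_of_le hx, res_of_le hy, res_of_le (norm_add_le_of_le_of_le hx hy), ← map_add]; rfl

theorem res_sub {x y : A} (hx : ‖x‖ ≤ 1) (hy : ‖y‖ ≤ 1) : res (x - y) = res x - res y := by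
  rw [res_of_le hx, res_of_le hy, res_of_le (norm_sub_le_of_le_of_le hx hy), ← map_sub]; rfl

theorem res_mul {x y : A} (hx : ‖x‖ ≤ 1) (hy : ‖y‖ ≤ 1) : res (x * y) = res x * res y := by
  rw [res_of_le hx, res_of_le hy, res_of_le (by rw [norm_mul]; exact mul_le_one₀ hx (norm_nonneg _) hy),
    ← map_mul]; rfl

theorem res_zero : res (0 : A) = 0 := (res_eq_zero_iff (by simp)).2 (by simp)

theorem res_one : res (1 : A) = 1 := by
  rw [res_of_le (by simp), ← map_one (residue (unitBall A))]; rfl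

theorem res_neg {x : A} (hx : ‖x‖ ≤ 1) : res (-x) = -res x := by
  rw [← zero_sub, res_sub (by simp) hx, res_zero, zero_sub]

theorem res_eq_iff {x y : A} (hx : ‖x‖ ≤ 1) (hy : ‖y‖ ≤ 1) : res x = res y ↔ ‖x - y‖ < 1 := by
  rw [← sub_eq_zero, ← res_sub hx hy, res_eq_zero_iff (norm_sub_le_of_le_of_le hx hy)]

theorem res_inv {x : A} (hx : ‖x‖ = 1) : res x⁻¹ = (res x)⁻¹ := by
  have h0 : x ≠ 0 := by rintro rfl; simp at hx
  refine eq_inv_of_mul_eq_one_left ?_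
  rw [← res_mul (by simp [hx]) hx.le, inv_mul_cancel₀ h0, res_one]

theorem res_pow {x : A} (hx : ‖x‖ ≤ 1) (n : ℕ) : res (x ^ n) = res x ^ n := by
  induction n with
  | zero => simp [res_one]
  | succ n ih =>
    rw [pow_succ, pow_succ, res_mul (by rw [norm_pow]; exact pow_le_one₀ (norm_nonneg _) hx) hx, ih]

theorem exists_res_eq (y : Resid A) : ∃ x : A, ‖x‖ ≤ 1 ∧ res x = y := by
  obtain ⟨x, rfl⟩ := residue_surjective y
  exact ⟨x, mem_unitBall.1 x.2, res_coe x⟩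

theorem res_sum {ι : Type*} (s : Finset ι) {f : ι → A} (hf : ∀ i ∈ s, ‖f i‖ ≤ 1) :
    res (∑ i ∈ s, f i) = ∑ i ∈ s, res (f i) := by
  classical
  induction s using Finset.induction_on with
  | empty => simp [res_zero]
  | insert i s his ih =>
    rw [Finset.sum_insert his, Finset.sum_insert his, res_add (hf i (by simp))
      (norm_sum_le_of_forall_le zero_le_one fun j hj => hf j (by simp [hj])),
      ih fun j hj => hf j (by simp [hj])]

end Residue

/-! ### Residue fields of intermediate fields, all realised inside the one residue field of `A`. -/

section ResidueSubfield

variable {K A : Type*} [Field K] [NormedField A] [IsUltrametricDist A] [Algebra K A]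

/-- The image in the residue field of an intermediate field. -/
noncomputable def resid (M : IntermediateField K A) : Subfield (Resid A) where
  carrier := {y | ∃ x ∈ M, ‖x‖ ≤ 1 ∧ res x = y}
  mul_mem' := by
    rintro _ _ ⟨x, hx, hx1, rfl⟩ ⟨y, hy, hy1, rfl⟩
    exact ⟨x * y, mul_mem hx hy, by rw [norm_mul]; exact mul_le_one₀ hx1 (norm_nonneg _) hy1,
      res_mul hx1 hy1⟩
  one_mem' := ⟨1, one_mem _, by simp, res_one⟩
  add_mem' := by
    rintro _ _ ⟨x, hx, hx1, rfl⟩ ⟨y, hy, hy1, rfl⟩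
    exact ⟨x + y, add_mem hx hy, norm_add_le_of_le_of_le hx1 hy1, res_add hx1 hy1⟩
  zero_mem' := ⟨0, zero_mem _, by simp, res_zero⟩
  neg_mem' := by
    rintro _ ⟨x, hx, hx1, rfl⟩
    exact ⟨-x, neg_mem hx, by rwa [norm_neg], res_neg hx1⟩
  inv_mem' := by
    rintro _ ⟨x, hx, hx1, rfl⟩
    by_cases h : ‖x‖ = 1
    · exact ⟨x⁻¹, inv_mem hx, by simp [h], res_inv h⟩
    · rw [(res_eq_zero_iff hx1).2 (lt_of_le_of_ne hx1 h), inv_zero]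
      exact ⟨0, zero_mem _, by simp, res_zero⟩

theorem mem_resid {M : IntermediateField K A} {y : Resid A} :
    y ∈ resid M ↔ ∃ x ∈ M, ‖x‖ ≤ 1 ∧ res x = y := Iff.rfl

theorem res_mem_resid {M : IntermediateField K A} {x : A} (hx : x ∈ M) (h : ‖x‖ ≤ 1) :
    res x ∈ resid M := ⟨x, hx, h, rfl⟩

theorem resid_mono {M N : IntermediateField K A} (h : M ≤ N) : resid M ≤ resid N := by
  rintro _ ⟨x, hx, hx1, rfl⟩
  exact ⟨x, h hx, hx1, rfl⟩

/-- Every value of `M` is a value of `K₀`. -/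
def SameValues (M K₀ : IntermediateField K A) : Prop :=
  ∀ x ∈ M, ∃ y ∈ K₀, ‖x‖ = ‖y‖

end ResidueSubfield

/-! ### Degrees of elements over intermediate fields, and conjugates. -/

section Adjoin

set_option linter.unusedSectionVars false

variable {K A : Type*} [Field K] [Field A] [Algebra K A] [Algebra.IsAlgebraic K A]

theorem isIntegral_intermediateField (M : IntermediateField K A) (t : A) : IsIntegral M t :=
  ((Algebra.IsAlgebraic.isAlgebraic (R := K) t).isIntegral).tower_top

/-- The degree of `t` over an intermediate field. -/
noncomputable def degOver (M : IntermediateField K A) (t : A) : ℕ := (minpoly M t).natDegree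

theorem degOver_pos (M : IntermediateField K A) (t : A) : 0 < degOver M t :=
  minpoly.natDegree_pos (isIntegral_intermediateField M t)

theorem mem_sup_adjoin {M : IntermediateField K A} {t x : A} :
    x ∈ M ⊔ K⟮t⟯ ↔ x ∈ M⟮t⟯ := by
  rw [← restrictScalars_adjoin_eq_sup, mem_restrictScalars]

theorem exists_eq_sum_of_mem_adjoin {M : IntermediateField K A} {t x : A} (hx : x ∈ M ⊔ K⟮t⟯) :
    ∃ c : ℕ → A, (∀ i, c i ∈ M) ∧ x = ∑ i ∈ Finset.range (degOver M t), c i * t ^ i := by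
  have hint := isIntegral_intermediateField M t
  rw [mem_sup_adjoin, ← IntermediateField.mem_toSubalgebra,
    adjoin_simple_toSubalgebra_of_isAlgebraic hint.isAlgebraic,
    Algebra.adjoin_singleton_eq_range_aeval] at hx
  obtain ⟨f, rfl⟩ := hx
  refine ⟨fun i => ((f %ₘ minpoly M t).coeff i : A), fun i => SetLike.coe_mem _, ?_⟩
  have h1 : aeval t f = aeval t (f %ₘ minpoly M t) :=
    (aeval_modByMonic_eq_self_of_root (minpoly.aeval M t)).symm
  have h2 : (f %ₘ minpoly M t).natDegree < degOver M t :=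
    natDegree_modByMonic_lt f (minpoly.monic hint) fun h => (degOver_pos M t).ne' (by
      rw [degOver, h, natDegree_one])
  change aeval t f = _
  rw [h1, aeval_eq_sum_range' h2]
  simp [Algebra.smul_def]

theorem degOver_le_of_monic {M : IntermediateField K A} {t : A} {q : M[X]} (hq : q.Monic)
    (h : aeval t q = 0) : degOver M t ≤ q.natDegree :=
  natDegree_le_of_dvd (minpoly.dvd M t h) hq.ne_zero

/-- A monic relation over the smaller field remains one over the larger. Only upper bounds on
degrees survive a change of base, which is why degree hypotheses are stated as inequalities. -/
theorem degOver_anti {M N : IntermediateField K A} (h : M ≤ N) (t : A) :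
    degOver N t ≤ degOver M t := by
  have hm := minpoly.monic (isIntegral_intermediateField M t)
  have := degOver_le_of_monic (M := N) (t := t)
    (q := (minpoly M t).map (inclusion h).toRingHom) (hm.map _) (by
      rw [aeval_def, eval₂_map]
      exact minpoly.aeval M t)
  rwa [hm.natDegree_map] at this

theorem degOver_le_finrank {M N : IntermediateField K A} [FiniteDimensional K N] {x : A}
    (hx : x ∈ N) : degOver M x ≤ Module.finrank K N := by
  have hxK : IsIntegral K x := (Algebra.IsAlgebraic.isAlgebraic (R := K) x).isIntegral
  have h2 : degOver M x ≤ (minpoly K x).natDegree := by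
    have := degOver_le_of_monic (M := M) (t := x) (q := (minpoly K x).map (algebraMap K M))
      ((minpoly.monic hxK).map _) (by rw [aeval_map_algebraMap, minpoly.aeval])
    rwa [(minpoly.monic hxK).natDegree_map] at this
  refine h2.trans ?_
  rw [← IntermediateField.minpoly_eq (⟨x, hx⟩ : N)]
  exact minpoly.natDegree_le _

theorem degOver_eq_finrank (M : IntermediateField K A) (t : A) :
    degOver M t = Module.finrank M M⟮t⟯ :=
  (adjoin.finrank (isIntegral_intermediateField M t)).symm

theorem degOver_eq_of_adjoin_eq {M : IntermediateField K A} {s t : A}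
    (h : M ⊔ K⟮s⟯ = M ⊔ K⟮t⟯) : degOver M s = degOver M t := by
  have : M⟮s⟯ = M⟮t⟯ := by
    ext x; rw [← mem_sup_adjoin, ← mem_sup_adjoin, h]
  rw [degOver_eq_finrank, degOver_eq_finrank, this]

theorem subset_sup_adjoin (M : IntermediateField K A) (t : A) : t ∈ M ⊔ K⟮t⟯ :=
  (le_sup_right : K⟮t⟯ ≤ M ⊔ K⟮t⟯) (mem_adjoin_simple_self K t)

theorem sup_adjoin_le {M N : IntermediateField K A} {t : A} (h : M ≤ N) (ht : t ∈ N) :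
    M ⊔ K⟮t⟯ ≤ N := sup_le h (adjoin_simple_le_iff.2 ht)

theorem sup_adjoin_affine {M : IntermediateField K A} {c s : A} (t : A) (hc : c ∈ M) (hc0 : c ≠ 0)
    (hs : s ∈ M) : M ⊔ K⟮c * (t - s)⟯ = M ⊔ K⟮t⟯ := by
  apply le_antisymm
  · exact sup_adjoin_le le_sup_left (mul_mem ((le_sup_left : M ≤ M ⊔ K⟮t⟯) hc)
      (sub_mem (subset_sup_adjoin M t) ((le_sup_left : M ≤ M ⊔ K⟮t⟯) hs)))
  · refine sup_adjoin_le le_sup_left ?_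
    have h : t = c⁻¹ * (c * (t - s)) + s := by field_simp; ring
    rw [h]
    exact add_mem (mul_mem ((le_sup_left : M ≤ M ⊔ K⟮_⟯) (inv_mem hc)) (by
      rw [← h]; exact subset_sup_adjoin M _)) ((le_sup_left : M ≤ M ⊔ K⟮_⟯) hs)

theorem finiteDimensional_sup_adjoin (M : IntermediateField K A) [FiniteDimensional K M] (t : A) :
    FiniteDimensional K (M ⊔ K⟮t⟯ : IntermediateField K A) := by
  have := adjoin.finiteDimensional
    ((Algebra.IsAlgebraic.isAlgebraic (R := K) t).isIntegral)
  infer_instance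

/-- An element separable over `M` and fixed by all automorphisms over `M` lies in `M`. -/
theorem mem_of_fixed [IsAlgClosed A] {M : IntermediateField K A} {x : A} (hs : IsSeparable M x)
    (h : ∀ σ : A ≃ₐ[M] A, σ x = x) : x ∈ M := by
  have : Algebra.IsAlgebraic M A := Algebra.IsAlgebraic.tower_top (K := K) M
  by_contra hx
  have hx' : x ∉ (⊥ : Subalgebra M A) := by
    rintro ⟨y, rfl⟩
    exact hx y.2
  obtain ⟨y, hy, hc⟩ := (notMem_iff_exists_ne_and_isConjRoot hs (IsAlgClosed.splits _)).1 hx'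
  have : IsAlgClosure M A := ⟨inferInstance, inferInstance⟩
  have : Normal M A := IsAlgClosure.normal M A
  obtain ⟨σ, hσ⟩ := isConjRoot_iff_exists_algEquiv.1 hc
  exact hy ((h σ.symm).symm.trans (σ.symm_apply_eq.2 hσ.symm))

/-- The roots of the minimal polynomial are the conjugates. -/
theorem exists_algEquiv_of_root [IsAlgClosed A] {M : IntermediateField K A} {x y : A}
    (h : aeval y (minpoly M x) = 0) : ∃ σ : A ≃ₐ[M] A, σ x = y := by
  have : Algebra.IsAlgebraic M A := Algebra.IsAlgebraic.tower_top (K := K) M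
  have : IsAlgClosure M A := ⟨inferInstance, inferInstance⟩
  have : Normal M A := IsAlgClosure.normal M A
  refine isConjRoot_iff_exists_algEquiv.1 (IsConjRoot.symm ?_)
  rw [IsConjRoot]
  exact minpoly.eq_of_irreducible_of_monic (minpoly.irreducible (isIntegral_intermediateField M x)) h
    (minpoly.monic (isIntegral_intermediateField M x))

end Adjoin

/-! ### Simple extensions with full residue degree, and totally ramified ones. -/

section Extension

set_option linter.unusedSectionVars false

variable {K A : Type*} [Field K] [NormedField A] [IsUltrametricDist A] [Algebra K A]
  [Algebra.IsAlgebraic K A]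

theorem exists_lift_polynomial {M : IntermediateField K A} (g : (resid M)[X]) :
    ∃ c : ℕ → A, (∀ i, c i ∈ M) ∧ (∀ i, ‖c i‖ ≤ 1) ∧ (∀ i, res (c i) = g.coeff i) ∧
      ∀ n, g.natDegree < n → ∀ x : A, ‖x‖ ≤ 1 →
        aeval (res x) g = res (∑ i ∈ Finset.range n, c i * x ^ i) := by
  have h : ∀ i, ∃ a ∈ M, ‖a‖ ≤ 1 ∧ res a = g.coeff i := fun i => mem_resid.1 (g.coeff i).2
  choose c hc hc1 hcr using h
  refine ⟨c, hc, hc1, hcr, fun n hn x hx => ?_⟩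
  rw [res_sum]
  · rw [aeval_eq_sum_range' hn]
    refine Finset.sum_congr rfl fun i _ => ?_
    rw [res_mul (hc1 i) (by rw [norm_pow]; exact pow_le_one₀ (norm_nonneg _) hx), res_pow hx, hcr]
    rfl
  · intro i _
    rw [norm_mul, norm_pow]
    exact mul_le_one₀ (hc1 i) (by positivity) (pow_le_one₀ (norm_nonneg _) hx)

/-- Reduction of a polynomial with integral coefficients. -/
theorem exists_reduction {M : IntermediateField K A} {c : ℕ → A} (hc : ∀ i, c i ∈ M)
    (hc1 : ∀ i, ‖c i‖ ≤ 1) (n : ℕ) :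
    ∃ g : (resid M)[X], (∀ i, (g.coeff i : Resid A) = if i < n then res (c i) else 0) ∧
      g.degree < n ∧
      ∀ x : A, ‖x‖ ≤ 1 → aeval (res x) g = res (∑ i ∈ Finset.range n, c i * x ^ i) := by
  set g : (resid M)[X] :=
    ∑ i ∈ Finset.range n, C (⟨res (c i), res_mem_resid (hc i) (hc1 i)⟩ : resid M) * X ^ i with hg
  have hdeg : g.degree < n := by
    rw [hg]
    refine mem_degreeLT.1 (sum_mem fun i hi => mem_degreeLT.2 ?_)
    exact (degree_C_mul_X_pow_le _ _).trans_lt (by exact_mod_cast Finset.mem_range.1 hi)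
  refine ⟨g, fun i => ?_, hdeg, fun x hx => ?_⟩
  · rw [hg, finsetSum_coeff]
    simp only [coeff_C_mul, coeff_X_pow, mul_ite, mul_one, mul_zero]
    rw [Finset.sum_ite_eq (Finset.range n) i]
    simp only [Finset.mem_range]
    split_ifs <;> rfl
  · rw [res_sum, hg, map_sum]
    · refine Finset.sum_congr rfl fun i _ => ?_
      rw [res_mul (hc1 i) (by rw [norm_pow]; exact pow_le_one₀ (norm_nonneg _) hx), res_pow hx,
        map_mul, map_pow, aeval_X, aeval_C]
      rfl
    · intro i _
      rw [norm_mul, norm_pow]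
      exact mul_le_one₀ (hc1 i) (by positivity) (pow_le_one₀ (norm_nonneg _) hx)

/-- Dividing the minimal polynomial by a coefficient of largest norm makes it integral with a
coefficient equal to 1, so its reduction is nonzero. -/
theorem exists_aeval_res_eq_zero (M : IntermediateField K A) {x : A} (hx : ‖x‖ ≤ 1) :
    ∃ g : (resid M)[X], g ≠ 0 ∧ g.natDegree ≤ degOver M x ∧ aeval (res x) g = 0 := by
  have hint := isIntegral_intermediateField M x
  set f := minpoly M x
  have hne : f ≠ 0 := minpoly.ne_zero hint
  obtain ⟨j, hj, hmax⟩ := f.support.exists_max_image (fun i => ‖(f.coeff i : A)‖)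
    (nonempty_support_iff.2 hne)
  have hj0 : (f.coeff j : A) ≠ 0 := by
    simpa using mem_support_iff.1 hj
  have hmax' : ∀ i, ‖(f.coeff i : A)‖ ≤ ‖(f.coeff j : A)‖ := by
    intro i
    by_cases hi : i ∈ f.support
    · exact hmax i hi
    · simp [notMem_support_iff.1 hi]
  obtain ⟨g, hg, hgd, hgx⟩ := exists_reduction (M := M)
    (c := fun i => (f.coeff i : A) / (f.coeff j : A))
    (fun i => div_mem (SetLike.coe_mem _) (SetLike.coe_mem _))
    (fun i => by rw [norm_div]; exact div_le_one_of_le₀ (hmax' i) (norm_nonneg _)) (f.natDegree + 1)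
  have hg0 : g ≠ 0 := by
    intro h0
    have := hg j
    rw [if_pos (Nat.lt_succ_of_le (le_natDegree_of_mem_supp j hj)), div_self hj0, res_one, h0] at this
    simp at this
  refine ⟨g, hg0, ?_, ?_⟩
  · have := (natDegree_lt_iff_degree_lt hg0).2 hgd
    exact Nat.lt_succ_iff.1 this
  · rw [hgx x hx]
    have h1 : ∑ i ∈ Finset.range (f.natDegree + 1), (f.coeff i : A) / (f.coeff j : A) * x ^ i = 0 := by
      have h2 := minpoly.aeval M x
      rw [aeval_eq_sum_range] at h2
      rw [← zero_div (f.coeff j : A), ← h2, Finset.sum_div]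
      refine Finset.sum_congr rfl fun i _ => ?_
      rw [Algebra.smul_def]
      change _ = (f.coeff i : A) * x ^ i / _
      ring
    rw [h1, res_zero]

theorem isIntegral_resid (M : IntermediateField K A) (y : Resid A) : IsIntegral (resid M) y := by
  obtain ⟨x, hx, rfl⟩ := exists_res_eq y
  obtain ⟨g, hg0, -, hg⟩ := exists_aeval_res_eq_zero M hx
  exact IsAlgebraic.isIntegral ⟨g, hg0, hg⟩

theorem natDegree_minpoly_res_le (M : IntermediateField K A) {x : A} (hx : ‖x‖ ≤ 1) :
    (minpoly (resid M) (res x)).natDegree ≤ degOver M x := by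
  obtain ⟨g, hg0, hgd, hg⟩ := exists_aeval_res_eq_zero M hx
  exact (natDegree_le_of_dvd (minpoly.dvd _ _ hg) hg0).trans hgd

/-- If the residue class of `t` has at least the degree of `t`, then a combination of powers of `t`
with integral coefficients, one of them a unit, is a unit. -/
theorem norm_sum_eq_one_of_degOver_le {M : IntermediateField K A} {t : A} (ht : ‖t‖ ≤ 1)
    (hd : degOver M t ≤ (minpoly (resid M) (res t)).natDegree) {c : ℕ → A} (hc : ∀ i, c i ∈ M)
    (hc1 : ∀ i, ‖c i‖ ≤ 1) {j : ℕ} (hj : j < degOver M t) (hj1 : ‖c j‖ = 1) :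
    ‖∑ i ∈ Finset.range (degOver M t), c i * t ^ i‖ = 1 := by
  have hle : ‖∑ i ∈ Finset.range (degOver M t), c i * t ^ i‖ ≤ 1 := by
    refine norm_sum_le_of_forall_le zero_le_one fun i _ => ?_
    rw [norm_mul, norm_pow]
    exact mul_le_one₀ (hc1 i) (by positivity) (pow_le_one₀ (norm_nonneg _) ht)
  refine le_antisymm hle (not_lt.1 fun hlt => ?_)
  obtain ⟨g, hg, hgd, hgx⟩ := exists_reduction hc hc1 (degOver M t)
  have hg0 : g ≠ 0 := by
    intro h0
    have := hg j
    rw [if_pos hj, h0, coeff_zero] at this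
    exact ((res_eq_zero_iff hj1.le).1 this.symm).ne hj1
  have := minpoly.degree_le_of_ne_zero (resid M) (res t) hg0
    (by rw [hgx t ht, (res_eq_zero_iff hle).2 hlt])
  rw [degree_eq_natDegree (minpoly.ne_zero (isIntegral_resid M _))] at this
  have h2 := this.trans_lt hgd
  exact absurd hd (not_le.2 (by exact_mod_cast h2))

theorem exists_norm_eq_and_le {M : IntermediateField K A} {t : A} (ht : ‖t‖ ≤ 1)
    (hd : degOver M t ≤ (minpoly (resid M) (res t)).natDegree) {x : A} (hx : x ∈ M ⊔ K⟮t⟯) :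
    ∃ c : ℕ → A, (∀ i, c i ∈ M) ∧ x = ∑ i ∈ Finset.range (degOver M t), c i * t ^ i ∧
      (∃ j, ‖x‖ = ‖c j‖) ∧ ∀ i, ‖c i‖ ≤ ‖x‖ := by
  obtain ⟨c, hc, hxc⟩ := exists_eq_sum_of_mem_adjoin hx
  set d := degOver M t with hdd
  -- Coefficients past the degree are set to 0, so that the bound by the largest one holds for every
  -- index.
  set c' : ℕ → A := fun i => if i < d then c i else 0 with hc'
  have hc'M : ∀ i, c' i ∈ M := fun i => by
    rw [hc']; dsimp only; split_ifs
    exacts [hc i, zero_mem _]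
  have hx' : x = ∑ i ∈ Finset.range d, c' i * t ^ i := by
    rw [hxc]
    refine Finset.sum_congr rfl fun i hi => ?_
    simp only [hc', if_pos (Finset.mem_range.1 hi)]
  obtain ⟨j, hj, hmax⟩ := (Finset.range d).exists_max_image (fun i => ‖c' i‖)
    ⟨0, Finset.mem_range.2 (degOver_pos M t)⟩
  have hmax' : ∀ i, ‖c' i‖ ≤ ‖c' j‖ := by
    intro i
    by_cases hi : i < d
    · exact hmax i (Finset.mem_range.2 hi)
    · simp [hc', if_neg hi]
  have key : ‖x‖ = ‖c' j‖ := by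
    by_cases h0 : c' j = 0
    · have : ∀ i, c' i = 0 := fun i => by simpa [h0] using hmax' i
      simp [hx', this]
    · have := norm_sum_eq_one_of_degOver_le ht hd (c := fun i => c' i / c' j)
        (fun i => div_mem (hc'M i) (hc'M j))
        (fun i => by rw [norm_div]; exact div_le_one_of_le₀ (hmax' i) (norm_nonneg _))
        (Finset.mem_range.1 hj) (by simp [div_self h0])
      have h2 : ∑ i ∈ Finset.range (degOver M t), c' i / c' j * t ^ i = x / c' j := by
        rw [hx', Finset.sum_div]
        exact Finset.sum_congr rfl fun i _ => by ring
      rw [h2, norm_div, div_eq_one_iff_eq (norm_ne_zero_iff.2 h0)] at this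
      exact this
  exact ⟨c', hc'M, hx', ⟨j, key⟩, fun i => key ▸ hmax' i⟩

/-- Full residue degree forces e = 1, since the powers of `t` are then an orthogonal basis. The
residue extension may be inseparable, so this covers unramified and fiercely ramified steps alike.
-/
theorem sameValues_of_degOver_le {M : IntermediateField K A} {t : A} (ht : ‖t‖ ≤ 1)
    (hd : degOver M t ≤ (minpoly (resid M) (res t)).natDegree) : SameValues (M ⊔ K⟮t⟯) M := by
  intro x hx
  obtain ⟨c, hc, -, ⟨j, hj⟩, -⟩ := exists_norm_eq_and_le ht hd hx
  exact ⟨c j, hc j, hj⟩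

theorem resid_sup_adjoin_subset {M : IntermediateField K A} {t : A} (ht : ‖t‖ ≤ 1)
    (hd : degOver M t ≤ (minpoly (resid M) (res t)).natDegree) {y : Resid A}
    (hy : y ∈ resid (M ⊔ K⟮t⟯)) : y ∈ (resid M)⟮res t⟯ := by
  obtain ⟨x, hx, hx1, rfl⟩ := hy
  obtain ⟨c, hc, hxc, -, hle⟩ := exists_norm_eq_and_le ht hd hx
  have hpow : ∀ i, ‖t ^ i‖ ≤ 1 := fun i => by
    rw [norm_pow]; exact pow_le_one₀ (norm_nonneg _) ht
  rw [hxc, res_sum _ fun i _ => by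
    rw [norm_mul]; exact mul_le_one₀ ((hle i).trans hx1) (norm_nonneg _) (hpow i)]
  refine sum_mem fun i _ => ?_
  rw [res_mul ((hle i).trans hx1) (hpow i), res_pow ht]
  refine mul_mem ?_ (pow_mem (mem_adjoin_simple_self _ _) i)
  exact (resid M)⟮res t⟯.algebraMap_mem ⟨res (c i), res_mem_resid (hc i) ((hle i).trans hx1)⟩

/-- In a totally ramified simple extension every element is dominated by a monomial. -/
theorem exists_monomial_of_totallyRamified {M : IntermediateField K A} {w : A} {d : ℕ}
    (hd : degOver M w ≤ d) (hw : ∀ k, 0 < k → k < d → ∀ x ∈ M, ‖x‖ ≠ ‖w‖ ^ k) {x : A}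
    (hx : x ∈ M ⊔ K⟮w⟯) (hx0 : x ≠ 0) :
    ∃ i < d, ∃ c ∈ M, c ≠ 0 ∧ ‖x‖ = ‖c * w ^ i‖ ∧ ‖x - c * w ^ i‖ < ‖x‖ := by
  obtain ⟨c, hc, hxc⟩ := exists_eq_sum_of_mem_adjoin hx
  have hne : ∃ i ∈ Finset.range (degOver M w), c i * w ^ i ≠ 0 := by
    by_contra! h
    exact hx0 (hxc.trans (Finset.sum_eq_zero h))
  -- Two nonzero monomials of equal norm would make ‖w‖^(j - i) a norm of `M`.
  have aux : ∀ i j, i < j → j < d → c i * w ^ i ≠ 0 → c j * w ^ j ≠ 0 →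
      ‖c i * w ^ i‖ = ‖c j * w ^ j‖ → False := by
    intro i j hij hj hi0 hj0 he
    have hcj : c j ≠ 0 := left_ne_zero_of_mul hj0
    have hw0 : w ≠ 0 := by
      rintro rfl
      rw [zero_pow (by omega), mul_zero] at hj0
      exact hj0 rfl
    obtain ⟨l, rfl⟩ : ∃ l, j = l + i := ⟨j - i, by omega⟩
    refine hw l (by omega) (by omega) (c i / c (l + i)) (div_mem (hc i) (hc _)) ?_
    have hwi : ‖w‖ ^ i ≠ 0 := pow_ne_zero _ (norm_ne_zero_iff.2 hw0)
    have hcj' : ‖c (l + i)‖ ≠ 0 := norm_ne_zero_iff.2 hcj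
    rw [norm_mul, norm_mul, norm_pow, norm_pow, pow_add, ← mul_assoc] at he
    have := mul_right_cancel₀ hwi he
    rw [norm_div, this]
    field_simp
  obtain ⟨i, hi, hi0, he, hlt⟩ := exists_norm_sum_eq hne (by
    intro i hi j hj hi0 hj0 he
    rw [Finset.mem_range] at hi hj
    rcases lt_trichotomy i j with h | h | h
    · exact (aux i j h (by omega) hi0 hj0 he).elim
    · exact h
    · exact (aux j i h (by omega) hj0 hi0 he.symm).elim)
  rw [← hxc] at he
  refine ⟨i, (Finset.mem_range.1 hi).trans_le hd, c i, hc i, left_ne_zero_of_mul hi0, he, ?_⟩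
  have h2 : x - c i * w ^ i = ∑ j ∈ (Finset.range (degOver M w)).erase i, c j * w ^ j := by
    rw [hxc, ← Finset.add_sum_erase _ _ hi, add_sub_cancel_left]
  rw [h2, he]
  exact norm_sum_lt (norm_pos_iff.2 hi0) fun j hj =>
    hlt j (Finset.mem_of_mem_erase hj) (Finset.ne_of_mem_erase hj)

theorem exists_norm_sub_lt_one_of_totallyRamified {M : IntermediateField K A} {w : A} {d : ℕ}
    (hd : degOver M w ≤ d) (hw : ∀ k, 0 < k → k < d → ∀ x ∈ M, ‖x‖ ≠ ‖w‖ ^ k) {x : A}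
    (hx : x ∈ M ⊔ K⟮w⟯) (hx1 : ‖x‖ ≤ 1) : ∃ c ∈ M, ‖c‖ ≤ 1 ∧ ‖x - c‖ < 1 := by
  rcases hx1.lt_or_eq with hlt | heq
  · exact ⟨0, zero_mem _, by simp, by simpa⟩
  · have hx0 : x ≠ 0 := by rintro rfl; simp at heq
    obtain ⟨i, hi, c, hc, hc0, he, hs⟩ := exists_monomial_of_totallyRamified hd hw hx hx0
    rw [heq] at he hs
    rcases Nat.eq_zero_or_pos i with rfl | hi0
    · rw [pow_zero, mul_one] at he hs
      exact ⟨c, hc, he.ge, hs⟩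
    · refine (hw i hi0 hi c⁻¹ (inv_mem hc) ?_).elim
      rw [norm_inv]
      rw [norm_mul, norm_pow] at he
      exact inv_eq_of_mul_eq_one_right he.symm

theorem resid_eq_of_totallyRamified {M : IntermediateField K A} {w : A} {d : ℕ}
    (hd : degOver M w ≤ d) (hw : ∀ k, 0 < k → k < d → ∀ x ∈ M, ‖x‖ ≠ ‖w‖ ^ k) :
    resid (M ⊔ K⟮w⟯) = resid M := by
  refine le_antisymm ?_ (resid_mono le_sup_left)
  rintro _ ⟨x, hx, hx1, rfl⟩
  obtain ⟨c, hc, hc1, hlt⟩ := exists_norm_sub_lt_one_of_totallyRamified hd hw hx hx1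
  exact ⟨c, hc, hc1, ((res_eq_iff hx1 hc1).2 hlt).symm⟩

/-- As `M` has no values beyond those of `K₀`, the element `w` stays totally ramified over `M`.
Norms in M(w) are therefore norms of monomials c w^i, and c can be traded for an element of `K₀` of
the same norm. -/
theorem sameValues_of_totallyRamified {K₀ M : IntermediateField K A} (hle : K₀ ≤ M)
    (he : SameValues M K₀) {w : A} {d : ℕ} (hd : degOver K₀ w ≤ d)
    (hw : ∀ k, 0 < k → k < d → ∀ x ∈ K₀, ‖x‖ ≠ ‖w‖ ^ k) :
    SameValues (M ⊔ K⟮w⟯) (K₀ ⊔ K⟮w⟯) := by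
  intro x hx
  by_cases hx0 : x = 0
  · exact ⟨0, zero_mem _, by rw [hx0]⟩
  obtain ⟨i, -, c, hc, -, hxc, -⟩ := exists_monomial_of_totallyRamified
    ((degOver_anti hle w).trans hd) (fun k h0 hk x hx h => by
      obtain ⟨y, hy, hxy⟩ := he x hx
      exact hw k h0 hk y hy (hxy.symm.trans h)) hx hx0
  obtain ⟨y, hy, hcy⟩ := he c hc
  refine ⟨y * w ^ i, mul_mem ((le_sup_left : K₀ ≤ K₀ ⊔ K⟮w⟯) hy)
    (pow_mem (subset_sup_adjoin K₀ w) i), ?_⟩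
  rw [hxc, norm_mul, hcy, norm_mul]

end Extension

/-! ### Two criteria on polynomials: separability, and divisibility of degrees. -/

theorem isSeparable_of_aeval_derivative_ne_zero {F E : Type*} [Field F] [Field E] [Algebra F E]
    {x : E} {f : F[X]} (h : aeval x f = 0) (h' : aeval x (derivative f) ≠ 0) :
    IsSeparable F x := by
  have hint : IsIntegral F x := by
    refine IsAlgebraic.isIntegral ⟨f, ?_, h⟩
    rintro rfl
    simp at h'
  by_contra hs
  rw [IsSeparable, separable_iff_derivative_ne_zero (minpoly.irreducible hint), not_not] at hs
  obtain ⟨g, hg⟩ := minpoly.dvd F x h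
  apply h'
  rw [hg, derivative_mul, hs, zero_mul, zero_add, map_mul, minpoly.aeval, zero_mul]

/-- If all roots of a split monic polynomial are roots of a given irreducible polynomial, then the
degree of the latter divides the degree of the former. -/
theorem natDegree_dvd_of_roots {F E : Type*} [Field F] [Field E] [Algebra F E] {x : E} (n : ℕ)
    (g : F[X]) (hn : g.natDegree = n) (hg : g.Monic) (hs : (g.map (algebraMap F E)).Splits)
    (hr : ∀ y : E, aeval y g = 0 → minpoly F y = minpoly F x) :
    (minpoly F x).natDegree ∣ n := by
  induction n using Nat.strong_induction_on generalizing g with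
  | _ n ih =>
    rcases Nat.eq_zero_or_pos n with rfl | hpos
    · exact dvd_zero _
    · obtain ⟨y, hy⟩ := hs.exists_eval_eq_zero (by
        rw [degree_map, degree_eq_natDegree hg.ne_zero, hn]; exact_mod_cast hpos.ne')
      have hy' : aeval y g = 0 := by rwa [aeval_def, ← eval_map]
      have hint : IsIntegral F y := ⟨g, hg, hy'⟩
      have hmin := hr y hy'
      obtain ⟨q, hq⟩ := minpoly.dvd F y hy'
      have hqm : q.Monic := (minpoly.monic hint).of_mul_monic_left (hq ▸ hg)
      have hdeg : n = (minpoly F y).natDegree + q.natDegree := by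
        rw [← hn, hq, (minpoly.monic hint).natDegree_mul hqm]
      have hmap0 : g.map (algebraMap F E) ≠ 0 := (hg.map _).ne_zero
      have := ih q.natDegree (by
          have := minpoly.natDegree_pos hint
          omega) q rfl hqm
        (hs.of_dvd hmap0 (by rw [hq, Polynomial.map_mul]; exact dvd_mul_left _ _))
        (fun z hz => hr z (by rw [hq, map_mul, hz, mul_zero]))
      rw [hdeg, hmin]
      exact dvd_add dvd_rfl this

/-! ### Galois conjugates, residual separability and lifting of separable residue classes. -/

section Conjugates

set_option linter.unusedSectionVars false

variable {K A : Type*} [Field K] [NormedField A] [IsUltrametricDist A] [Algebra K A]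
  [Algebra.IsAlgebraic K A] [IsAlgClosed A]

theorem norm_algEquiv_apply (hinv : ∀ (σ : A ≃ₐ[K] A) (x : A), ‖σ x‖ = ‖x‖)
    {M : IntermediateField K A} (σ : A ≃ₐ[M] A) (x : A) : ‖σ x‖ = ‖x‖ :=
  hinv (σ.restrictScalars K) x

theorem algEquiv_apply_mem {M : IntermediateField K A} (σ : A ≃ₐ[M] A) {x : A} (hx : x ∈ M) :
    σ x = x := σ.commutes ⟨x, hx⟩

/-- Conjugate elements have conjugate residue classes. -/
theorem aeval_res_algEquiv (hinv : ∀ (σ : A ≃ₐ[K] A) (x : A), ‖σ x‖ = ‖x‖)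
    {M : IntermediateField K A} (σ : A ≃ₐ[M] A) {t : A} (ht : ‖t‖ ≤ 1) {g : (resid M)[X]}
    (hg : aeval (res t) g = 0) : aeval (res (σ t)) g = 0 := by
  obtain ⟨c, hc, hc1, -, hx⟩ := exists_lift_polynomial g
  have hsum : ∀ x : A, ‖x‖ ≤ 1 → ‖∑ i ∈ Finset.range (g.natDegree + 1), c i * x ^ i‖ ≤ 1 := by
    intro x hx
    refine norm_sum_le_of_forall_le zero_le_one fun i _ => ?_
    rw [norm_mul, norm_pow]
    exact mul_le_one₀ (hc1 i) (by positivity) (pow_le_one₀ (norm_nonneg _) hx)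
  have hσ : ‖σ t‖ ≤ 1 := by rwa [norm_algEquiv_apply hinv]
  rw [hx _ (Nat.lt_succ_self _) _ ht, res_eq_zero_iff (hsum t ht)] at hg
  rw [hx _ (Nat.lt_succ_self _) _ hσ, res_eq_zero_iff (hsum _ hσ)]
  have : ∑ i ∈ Finset.range (g.natDegree + 1), c i * σ t ^ i =
      σ (∑ i ∈ Finset.range (g.natDegree + 1), c i * t ^ i) := by
    rw [map_sum]
    refine Finset.sum_congr rfl fun i _ => ?_
    rw [map_mul, map_pow, algEquiv_apply_mem σ (hc i)]
  rwa [this, norm_algEquiv_apply hinv]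

/-- A separable integral element with pairwise incongruent conjugates generates an extension
whose residue degree is its degree. -/
theorem degOver_le_of_conj (hinv : ∀ (σ : A ≃ₐ[K] A) (x : A), ‖σ x‖ = ‖x‖)
    {M : IntermediateField K A} {t : A} (ht : ‖t‖ ≤ 1) (hs : IsSeparable M t)
    (hconj : ∀ σ : A ≃ₐ[M] A, σ t = t ∨ 1 ≤ ‖σ t - t‖) :
    degOver M t ≤ (minpoly (resid M) (res t)).natDegree := by
  classical
  set f := minpoly M t
  set h := minpoly (resid M) (res t)
  have hh0 : h ≠ 0 := minpoly.ne_zero (isIntegral_resid M _)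
  have hf0 : f ≠ 0 := minpoly.ne_zero (isIntegral_intermediateField M t)
  have hroot : ∀ y ∈ f.rootSet A, ∃ σ : A ≃ₐ[M] A, σ t = y := fun y hy =>
    exists_algEquiv_of_root (mem_rootSet.1 hy).2
  have hcard := card_rootSet_eq_natDegree (K := A) hs (IsAlgClosed.splits _)
  have hmaps : ∀ y ∈ f.rootSet A, res y ∈ h.rootSet (Resid A) := by
    intro y hy
    obtain ⟨σ, rfl⟩ := hroot y hy
    exact mem_rootSet.2 ⟨hh0, aeval_res_algEquiv hinv σ ht (minpoly.aeval _ _)⟩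
  have hinj : Set.InjOn (res : A → Resid A) (f.rootSet A) := by
    intro y hy z hz hyz
    obtain ⟨σ, rfl⟩ := hroot y hy
    obtain ⟨τ, rfl⟩ := hroot z hz
    rw [res_eq_iff (by rwa [norm_algEquiv_apply hinv]) (by rwa [norm_algEquiv_apply hinv])] at hyz
    have h1 : ‖(σ.trans τ.symm) t - t‖ < 1 := by
      rw [← norm_algEquiv_apply hinv τ]
      simpa using hyz
    rcases hconj (σ.trans τ.symm) with h2 | h2
    · simpa [AlgEquiv.symm_apply_eq] using h2
    · exact absurd h1 (not_lt.2 h2)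
  have hle : Fintype.card (f.rootSet A) ≤ Fintype.card (h.rootSet (Resid A)) :=
    Fintype.card_le_of_injective (fun y => ⟨res y.1, hmaps y.1 y.2⟩) fun y z hyz =>
      Subtype.ext (hinj y.2 z.2 (congrArg Subtype.val hyz))
  rw [hcard] at hle
  refine hle.trans ?_
  simp only [rootSet_def, Finset.coe_sort_coe, Fintype.card_coe]
  refine (Multiset.toFinset_card_le _).trans ((card_roots' _).trans ?_)
  rw [natDegree_map]

/-- An element whose `p`-th power is congruent to an element that is not a `p`-th power. -/
theorem degOver_le_of_not_pow {p : ℕ} (hp : p.Prime) {M : IntermediateField K A} {b u : A}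
    (hb : ‖b‖ ≤ 1) (hu : u ∈ M) (hu1 : ‖u‖ ≤ 1) (hbu : ‖b ^ p - u‖ < 1)
    (hpow : ∀ c ∈ M, ‖c‖ ≤ 1 → 1 ≤ ‖u - c ^ p‖) (hd : degOver M b ≤ p) :
    degOver M b ≤ (minpoly (resid M) (res b)).natDegree := by
  have hbp : ‖b ^ p‖ ≤ 1 := by rw [norm_pow]; exact pow_le_one₀ (norm_nonneg _) hb
  have hirr := X_pow_sub_C_irreducible_of_prime hp
    (a := (⟨res u, res_mem_resid hu hu1⟩ : resid M)) (by
      rintro ⟨y, hy⟩ hyu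
      obtain ⟨c, hc, hc1, rfl⟩ := mem_resid.1 hy
      have h2 : res c ^ p = res u := congrArg Subtype.val hyu
      have hcp : ‖c ^ p‖ ≤ 1 := by rw [norm_pow]; exact pow_le_one₀ (norm_nonneg _) hc1
      rw [← res_pow hc1, res_eq_iff hcp hu1, norm_sub_rev] at h2
      exact absurd h2 (not_lt.2 (hpow c hc hc1)))
  have hm := minpoly.eq_of_irreducible_of_monic hirr (x := res b) (by
      rw [map_sub, map_pow, aeval_X, aeval_C, ← res_pow hb, (res_eq_iff hbp hu1).2 hbu]
      exact sub_self _) (monic_X_pow_sub_C _ hp.ne_zero)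
  rw [← hm, natDegree_X_pow_sub_C]
  exact hd

/-- Reduction of a monic polynomial with integral roots. -/
theorem exists_monic_reduction {M : IntermediateField K A} {f : M[X]} (hf : f.Monic)
    (hr : ∀ r : A, aeval r f = 0 → ‖r‖ ≤ 1) :
    ∃ g : (resid M)[X], g.Monic ∧ g.natDegree = f.natDegree ∧
      (∀ i, ‖(f.coeff i : A)‖ ≤ 1) ∧ (∀ i, (g.coeff i : Resid A) = res (f.coeff i : A)) ∧
      (g.map (algebraMap (resid M) (Resid A))) =
        ((((f.map (algebraMap M A)).roots).map res).map fun a => X - C a).prod := by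
  have hS : ∀ r ∈ (f.map (algebraMap M A)).roots, r ∈ unitBall A := by
    intro r hr'
    rw [mem_unitBall]
    refine hr r ?_
    rw [aeval_def, ← eval_map]
    exact (mem_roots'.1 hr').2
  have hsplit := (IsAlgClosed.splits (f.map (algebraMap M A))).eq_prod_roots
  rw [(hf.map _).leadingCoeff, C_1, one_mul] at hsplit
  -- With the roots taken in the unit ball, reduction is a ring homomorphism applied to a product of
  -- linear factors, so the reduced polynomial splits.
  obtain ⟨T, hT⟩ : ∃ T : Multiset (unitBall A),
      T.map (Subtype.val : unitBall A → A) = (f.map (algebraMap M A)).roots :=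
    ⟨(f.map (algebraMap M A)).roots.pmap (fun x hx => ⟨x, hx⟩) hS, by
      rw [Multiset.map_pmap]; exact (Multiset.pmap_eq_map _ id _ _).trans (Multiset.map_id _)⟩
  set P : (unitBall A)[X] := (T.map fun a => X - C a).prod with hP
  have hP1 : P.map (unitBall A).subtype = f.map (algebraMap M A) := by
    rw [hsplit, ← hT, hP, Polynomial.map_multiset_prod, Multiset.map_map, Multiset.map_map]
    congr 1
    refine Multiset.map_congr rfl fun a _ => ?_
    simp
  have hP2 : P.map (residue (unitBall A)) =
      ((((f.map (algebraMap M A)).roots).map res).map fun a => X - C a).prod := by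
    rw [← hT, hP, Polynomial.map_multiset_prod, Multiset.map_map, Multiset.map_map,
      Multiset.map_map]
    congr 1
    refine Multiset.map_congr rfl fun a _ => ?_
    simp [res_coe]
  have hco : ∀ i, (f.coeff i : A) = (P.coeff i : A) := by
    intro i
    have := congrArg (fun q => q.coeff i) hP1
    simp only [coeff_map] at this
    exact this.symm
  have hle : ∀ i, ‖(f.coeff i : A)‖ ≤ 1 := fun i => by
    rw [hco]; exact mem_unitBall.1 (P.coeff i).2
  obtain ⟨g, hg, hgd, -⟩ := exists_reduction (M := M) (c := fun i => (f.coeff i : A))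
    (fun i => SetLike.coe_mem _) hle (f.natDegree + 1)
  have hg' : ∀ i, (g.coeff i : Resid A) = res (f.coeff i : A) := by
    intro i
    rw [hg]
    split_ifs with h
    · rfl
    · rw [coeff_eq_zero_of_natDegree_lt (by omega)]
      exact res_zero.symm
  have hgm : g.map (algebraMap (resid M) (Resid A)) = P.map (residue (unitBall A)) := by
    ext i
    rw [coeff_map, coeff_map, ← res_coe, ← hco]
    exact hg' i
  have hlead : g.coeff f.natDegree = 1 := Subtype.ext (by
    rw [hg', hf.coeff_natDegree]; exact res_one)
  have hdeg : g.natDegree = f.natDegree := by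
    refine le_antisymm ?_ (le_natDegree_of_ne_zero (by rw [hlead]; exact one_ne_zero))
    by_cases h0 : g = 0
    · rw [h0]; simp
    · have := (natDegree_lt_iff_degree_lt h0).2 hgd
      omega
  exact ⟨g, by rw [Monic, leadingCoeff, hdeg, hlead], hdeg, hle, hg', hgm.trans hP2⟩

/-- The residue field extension is separable. -/
def ResSeparable (K₀ M : IntermediateField K A) : Prop :=
  ∀ x ∈ resid M, IsSeparable (resid K₀) x

theorem ResSeparable.of_resid_eq {K₀ M : IntermediateField K A} (h : resid M = resid K₀) :
    ResSeparable K₀ M := by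
  intro x hx
  rw [h] at hx
  exact isSeparable_algebraMap (F := resid K₀) (K := Resid A) ⟨x, hx⟩

theorem ResSeparable.refl (K₀ : IntermediateField K A) : ResSeparable K₀ K₀ :=
  ResSeparable.of_resid_eq rfl

theorem ResSeparable.trans {K₀ K₁ K₂ : IntermediateField K A} (h01 : K₀ ≤ K₁)
    (h1 : ResSeparable K₀ K₁) (h2 : ResSeparable K₁ K₂) : ResSeparable K₀ K₂ := by
  intro x hx
  let _ : Algebra (resid K₀) (resid K₁) := (Subfield.inclusion (resid_mono h01)).toAlgebra
  have : IsScalarTower (resid K₀) (resid K₁) (Resid A) := IsScalarTower.of_algebraMap_eq fun _ => rfl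
  have : Algebra.IsSeparable (resid K₀) (resid K₁) := ⟨fun y => by
    have h3 := h1 y y.2
    rw [IsSeparable, ← minpoly.algebraMap_eq (algebraMap (resid K₁) (Resid A)).injective]
    exact h3⟩
  exact IsSeparable.of_algebra_isSeparable_of_isSeparable (resid K₀) (h2 x hx)

theorem charP_resid {p : ℕ} (hp : p.Prime) (hpA : ‖(p : A)‖ < 1) (M : IntermediateField K A) :
    CharP (resid M) p := by
  refine (CharP.charP_iff_prime_eq_zero hp).2 (Subtype.ext ?_)
  have h1 : ∀ n : ℕ, res (n : A) = n := by
    intro n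
    rw [res_of_le (IsUltrametricDist.norm_natCast_le_one A n), ← map_natCast (residue (unitBall A))]
    rfl
  have := (res_eq_zero_iff hpA.le).2 hpA
  rw [h1] at this
  simpa using this

/-- If the degrees of all elements are prime to the residue characteristic, then the residue
extension is separable. -/
theorem ResSeparable.of_degOver (hinv : ∀ (σ : A ≃ₐ[K] A) (x : A), ‖σ x‖ = ‖x‖) {p : ℕ}
    (hp : p.Prime) (hpA : ‖(p : A)‖ < 1) {K₀ M : IntermediateField K A}
    (h : ∀ x ∈ M, ¬ p ∣ degOver K₀ x) : ResSeparable K₀ M := by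
  rintro _ ⟨x, hx, hx1, rfl⟩
  have := charP_resid hp hpA K₀
  have hint := isIntegral_intermediateField K₀ x
  have hroots : ∀ r : A, aeval r (minpoly K₀ x) = 0 →
      ‖r‖ ≤ 1 ∧ aeval (res r) (minpoly (resid K₀) (res x)) = 0 := by
    intro r hr
    obtain ⟨σ, rfl⟩ := exists_algEquiv_of_root hr
    exact ⟨by rwa [norm_algEquiv_apply hinv], aeval_res_algEquiv hinv σ hx1 (minpoly.aeval _ _)⟩
  obtain ⟨g, hgm, hgd, -, -, hgr⟩ := exists_monic_reduction (minpoly.monic hint)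
    fun r hr => (hroots r hr).1
  have hintr := isIntegral_resid K₀ (res x)
  -- Every root of the reduction of the minimal polynomial of `x` is the residue of a conjugate of
  -- `x`, hence conjugate to `res x`.
  have hdvd : (minpoly (resid K₀) (res x)).natDegree ∣ degOver K₀ x := by
    refine natDegree_dvd_of_roots (E := Resid A) _ g hgd hgm ?_ fun y hy => ?_
    · rw [hgr]
      exact Splits.multisetProd fun q hq => by
        obtain ⟨a, -, rfl⟩ := Multiset.mem_map.1 hq
        exact Splits.X_sub_C a
    · rw [aeval_def, ← eval_map, hgr, eval_multiset_prod, Multiset.prod_eq_zero_iff] at hy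
      simp only [Multiset.mem_map, exists_exists_and_eq_and, eval_sub, eval_X, eval_C] at hy
      obtain ⟨r, hr, hry⟩ := hy
      rw [sub_eq_zero] at hry
      subst hry
      symm
      refine minpoly.eq_of_irreducible_of_monic (minpoly.irreducible hintr) ?_ (minpoly.monic hintr)
      refine (hroots r ?_).2
      rw [aeval_def, ← eval_map]
      exact (mem_roots'.1 hr).2
  -- An inseparable irreducible polynomial is a polynomial in X^p, so p divides its degree.
  rcases separable_or p (minpoly.irreducible hintr) with h1 | ⟨-, q, -, hq⟩
  · exact h1
  · refine (h x hx (dvd_trans ?_ hdvd)).elim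
    rw [← hq, natDegree_expand]
    exact dvd_mul_left _ _

/-- Hensel's lemma for simple roots in the residue field. -/
theorem exists_lift_of_isSeparable (hinv : ∀ (σ : A ≃ₐ[K] A) (x : A), ‖σ x‖ = ‖x‖)
    {K₁ M : IntermediateField K A} (hle : K₁ ≤ M) {x : A} (hx : x ∈ M) (hx1 : ‖x‖ ≤ 1)
    (hs : IsSeparable (resid K₁) (res x)) :
    ∃ r ∈ M, ‖r‖ ≤ 1 ∧ res r = res x ∧
      degOver K₁ r ≤ (minpoly (resid K₁) (res x)).natDegree := by
  have hint := isIntegral_resid K₁ (res x)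
  set g := minpoly (resid K₁) (res x) with hg
  have hgm : g.Monic := minpoly.monic hint
  obtain ⟨c, hc, hc1, hcr, -⟩ := exists_lift_polynomial g
  set q : K₁[X] := ∑ i ∈ Finset.range g.natDegree, C (⟨c i, hc i⟩ : K₁) * X ^ i with hq
  have hqd : q.degree < g.natDegree :=
    mem_degreeLT.1 (sum_mem fun i hi => mem_degreeLT.2 ((degree_C_mul_X_pow_le _ _).trans_lt
      (by exact_mod_cast Finset.mem_range.1 hi)))
  set f : K₁[X] := X ^ g.natDegree + q with hf
  have hfm : f.Monic := monic_X_pow_add hqd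
  have hfd : f.natDegree = g.natDegree := by
    refine natDegree_eq_of_degree_eq_some ?_
    rw [hf, degree_add_eq_left_of_degree_lt (by rwa [degree_X_pow]), degree_X_pow]
  have hev : ∀ y : A, aeval y f = y ^ g.natDegree + ∑ i ∈ Finset.range g.natDegree, c i * y ^ i := by
    intro y
    rw [hf, map_add, map_pow, aeval_X, hq, map_sum]
    congr 1
    refine Finset.sum_congr rfl fun i _ => ?_
    rw [map_mul, map_pow, aeval_X, aeval_C]
    rfl
  have hroot1 : ∀ r : A, aeval r f = 0 → ‖r‖ ≤ 1 := by
    intro r hr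
    by_contra! h1
    rw [hev] at hr
    have hn : 0 < g.natDegree := minpoly.natDegree_pos hint
    have h2 : ‖∑ i ∈ Finset.range g.natDegree, c i * r ^ i‖ < ‖r‖ ^ g.natDegree := by
      refine norm_sum_lt (by positivity) fun i hi => ?_
      rw [norm_mul, norm_pow]
      calc ‖c i‖ * ‖r‖ ^ i ≤ 1 * ‖r‖ ^ i := by gcongr; exact hc1 i
        _ < ‖r‖ ^ g.natDegree := by
          rw [one_mul]; exact pow_lt_pow_right₀ h1 (Finset.mem_range.1 hi)
    rw [← norm_pow, eq_neg_of_add_eq_zero_left hr, norm_neg] at h2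
    exact lt_irrefl _ h2
  obtain ⟨g', hg'm, hg'd, -, hg'c, hg'r⟩ := exists_monic_reduction hfm hroot1
  have hgg' : g' = g := by
    ext i
    rw [hg'c]
    rcases lt_trichotomy i g.natDegree with h | h | h
    · have : (f.coeff i : A) = c i := by
        rw [hf, coeff_add, coeff_X_pow, if_neg h.ne, zero_add, hq, finsetSum_coeff]
        simp only [coeff_C_mul, coeff_X_pow, mul_ite, mul_one, mul_zero]
        rw [Finset.sum_ite_eq, if_pos (Finset.mem_range.2 h)]
      rw [this, hcr]
    · rw [h, ← hfd, hfm.coeff_natDegree, hfd, hgm.coeff_natDegree]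
      exact res_one
    · rw [coeff_eq_zero_of_natDegree_lt (hfd ▸ h), coeff_eq_zero_of_natDegree_lt h]
      exact res_zero
  rw [hgg'] at hg'r
  set S := (f.map (algebraMap K₁ A)).roots with hS
  have hroots : (g.map (algebraMap (resid K₁) (Resid A))).roots = S.map res := by
    rw [hg'r, roots_multiset_prod_X_sub_C]
  have hnodup : (S.map res).Nodup := hroots ▸ nodup_roots (Separable.map hs)
  have hxS : res x ∈ S.map res := by
    rw [← hroots, mem_roots (hgm.map _).ne_zero, IsRoot, eval_map, ← aeval_def]
    exact minpoly.aeval _ _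
  obtain ⟨r, hrS, hrx⟩ := Multiset.mem_map.1 hxS
  have hmemS : ∀ y, y ∈ S ↔ aeval y f = 0 := by
    intro y
    rw [hS, mem_roots (hfm.map _).ne_zero, IsRoot, eval_map, ← aeval_def]
  have hr1 := hroot1 r ((hmemS r).1 hrS)
  refine ⟨r, ?_, hr1, hrx, hfd ▸ degOver_le_of_monic hfm ((hmemS r).1 hrS)⟩
  have hfsep : f.Separable := by
    rw [← separable_map (algebraMap K₁ A)]
    exact (nodup_roots_iff_of_splits (hfm.map _).ne_zero (IsAlgClosed.splits _)).1
      (Multiset.Nodup.of_map _ hnodup)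
  -- Galois descent replaces Newton iteration: an automorphism over `M` sends `r` to a root of `f`
  -- with the same residue class, and the roots of `f` have distinct residue classes.
  refine mem_of_fixed ?_ fun σ => ?_
  · have hroot : aeval r (f.map (inclusion hle).toRingHom) = 0 := by
      rw [aeval_def, eval₂_map]
      exact (hmemS r).1 hrS
    exact (hfsep.map (f := (inclusion hle).toRingHom)).of_dvd (minpoly.dvd M r hroot)
  · have hσS : σ r ∈ S := by
      rw [hmemS]
      have := congrArg σ ((hmemS r).1 hrS)
      rw [map_zero, hev, map_add, map_pow, map_sum] at this
      rw [hev, ← this]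
      congr 1
      refine Finset.sum_congr rfl fun i _ => ?_
      rw [map_mul, map_pow, algEquiv_apply_mem σ (hle (hc i))]
    refine Multiset.inj_on_of_nodup_map hnodup _ hσS _ hrS ?_
    rw [hrx, res_eq_iff (by rwa [norm_algEquiv_apply hinv]) hx1]
    nth_rewrite 1 [← algEquiv_apply_mem σ hx]
    rw [← map_sub, norm_algEquiv_apply hinv]
    exact (res_eq_iff hr1 hx1).1 hrx

/-- The maximal residually separable subextension. -/
theorem exists_maximal_resSeparable (hinv : ∀ (σ : A ≃ₐ[K] A) (x : A), ‖σ x‖ = ‖x‖)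
    {K₀ M : IntermediateField K A} [FiniteDimensional K M] (hle : K₀ ≤ M) :
    ∃ K₁ : IntermediateField K A, K₀ ≤ K₁ ∧ K₁ ≤ M ∧ ResSeparable K₀ K₁ ∧
      ∀ x ∈ resid M, IsSeparable (resid K₁) x → x ∈ resid K₁ := by
  let S : Set (IntermediateField K A) := {K₁ | K₀ ≤ K₁ ∧ K₁ ≤ M ∧ ResSeparable K₀ K₁}
  have hne : S.Nonempty := ⟨K₀, le_rfl, hle, ResSeparable.refl K₀⟩
  -- A candidate of largest degree: if a separable residue class were missing, its lift would
  -- generate a strictly larger candidate.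
  obtain ⟨K₁, ⟨h01, h1M, hsep⟩, hmin⟩ := WellFounded.has_min
    (measure fun E : IntermediateField K A => Module.finrank K M - Module.finrank K E).wf S hne
  refine ⟨K₁, h01, h1M, hsep, ?_⟩
  rintro _ ⟨x, hx, hx1, rfl⟩ hs
  by_contra hnot
  obtain ⟨r, hr, hr1, hrx, hd⟩ := exists_lift_of_isSeparable hinv h1M hx hx1 hs
  rw [← hrx] at hd hs hnot
  have h2M : K₁ ⊔ K⟮r⟯ ≤ M := sup_adjoin_le h1M hr
  have : FiniteDimensional K (K₁ ⊔ K⟮r⟯ : IntermediateField K A) :=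
    FiniteDimensional.of_injective (inclusion h2M).toLinearMap (inclusion h2M).injective
  have hsep2 : ResSeparable K₁ (K₁ ⊔ K⟮r⟯) := by
    intro y hy
    have hy' := resid_sup_adjoin_subset hr1 hd hy
    have := (isSeparable_adjoin_simple_iff_isSeparable (resid K₁) (Resid A)).2 hs
    have h3 := Algebra.IsSeparable.isSeparable (resid K₁) (⟨y, hy'⟩ : (resid K₁)⟮res r⟯)
    rw [IsSeparable, ← minpoly.algebraMap_eq (algebraMap (resid K₁)⟮res r⟯ (Resid A)).injective] at h3
    exact h3
  refine hmin (K₁ ⊔ K⟮r⟯) ⟨h01.trans le_sup_left, h2M, hsep.trans h01 hsep2⟩ ?_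
  have hlt : Module.finrank K K₁ < Module.finrank K (K₁ ⊔ K⟮r⟯ : IntermediateField K A) := by
    by_contra! hge
    have := eq_of_le_of_finrank_le (le_sup_left : K₁ ≤ K₁ ⊔ K⟮r⟯) hge
    exact hnot (res_mem_resid (this ▸ subset_sup_adjoin K₁ r) hr1)
  have hlt2 : Module.finrank K (K₁ ⊔ K⟮r⟯ : IntermediateField K A) ≤ Module.finrank K M :=
    LinearMap.finrank_le_finrank_of_injective (f := (inclusion h2M).toLinearMap)
      (inclusion h2M).injective
  change Module.finrank K M - _ < Module.finrank K M - _
  omega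

/-- In the absence of separable residue elements, large `p`-powers lie in the smaller field. -/
theorem exists_pow_mem_resid {p : ℕ} (hp : p.Prime) (hpA : ‖(p : A)‖ < 1)
    {K₁ M : IntermediateField K A} [FiniteDimensional K M]
    (h : ∀ x ∈ resid M, IsSeparable (resid K₁) x → x ∈ resid K₁) :
    ∃ n, ∀ x ∈ resid M, x ^ p ^ n ∈ resid K₁ := by
  refine ⟨Module.finrank K M, ?_⟩
  rintro _ ⟨x, hx, hx1, rfl⟩
  have := charP_resid hp hpA K₁
  have : ExpChar (resid K₁) p := ExpChar.prime hp
  have hint := isIntegral_resid K₁ (res x)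
  obtain ⟨g, hg, m, hm⟩ := (minpoly.irreducible hint).hasSeparableContraction p
  have hroot : aeval (res x ^ p ^ m) g = 0 := by
    rw [← expand_aeval, hm, minpoly.aeval]
  have hmem : res x ^ p ^ m ∈ resid K₁ :=
    h _ (pow_mem (res_mem_resid hx hx1) _) (hg.of_dvd (minpoly.dvd _ _ hroot))
  -- The inseparability exponent is bounded uniformly: p^m is at most the degree of the residue
  -- class, hence at most [M : K], and m < p^m.
  have hle : m ≤ Module.finrank K M := by
    have h1 := natDegree_minpoly_res_le K₁ hx1
    have h2 := degOver_le_finrank (M := K₁) hx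
    have h4 : p ^ m ≤ (minpoly (resid K₁) (res x)).natDegree := by
      rw [← hm, natDegree_expand]
      refine Nat.le_mul_of_pos_left _ (Nat.pos_of_ne_zero fun h0 => ?_)
      have := minpoly.natDegree_pos hint
      rw [← hm, natDegree_expand, h0, zero_mul] at this
      exact lt_irrefl _ this
    have h5 := Nat.lt_pow_self hp.one_lt (n := m)
    omega
  obtain ⟨l, hl⟩ := Nat.exists_eq_add_of_le hle
  rw [hl, pow_add, pow_mul]
  exact pow_mem hmem _

end Conjugates

/-! ### Uniformizers, their roots, and expansions in their powers. -/

section Discrete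

set_option linter.unusedSectionVars false

variable {K A : Type*} [Field K] [NormedField A] [IsUltrametricDist A] [Algebra K A]
  [Algebra.IsAlgebraic K A]

/-- `ϖ` lies in `M`, has norm in `(0, 1)`, and generates the value group of `M`. -/
structure IsUnif (M : IntermediateField K A) (ϖ : A) : Prop where
  mem : ϖ ∈ M
  pos : 0 < ‖ϖ‖
  lt_one : ‖ϖ‖ < 1
  exists_zpow : ∀ x ∈ M, x ≠ 0 → ∃ k : ℤ, ‖x‖ = ‖ϖ‖ ^ k

theorem IsUnif.ne_zero {M : IntermediateField K A} {ϖ : A} (h : IsUnif M ϖ) : ϖ ≠ 0 :=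
  norm_pos_iff.1 h.pos

theorem IsUnif.of_sameValues {K₀ M : IntermediateField K A} {ϖ : A} (h : IsUnif K₀ ϖ) (hle : K₀ ≤ M)
    (he : SameValues M K₀) : IsUnif M ϖ :=
  ⟨hle h.mem, h.pos, h.lt_one, fun x hx hx0 => by
    obtain ⟨y, hy, hxy⟩ := he x hx
    obtain ⟨k, hk⟩ := h.exists_zpow y hy (norm_ne_zero_iff.1 (hxy ▸ norm_ne_zero_iff.2 hx0))
    exact ⟨k, hxy.trans hk⟩⟩

theorem IsUnif.norm_le_of_lt {M : IntermediateField K A} {ϖ : A} (h : IsUnif M ϖ) {x : A}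
    (hx : x ∈ M) {a : ℤ} (hlt : ‖x‖ < ‖ϖ‖ ^ a) : ‖x‖ ≤ ‖ϖ‖ ^ (a + 1) := by
  by_cases hx0 : x = 0
  · rw [hx0, norm_zero]; exact (zpow_pos h.pos _).le
  obtain ⟨k, hk⟩ := h.exists_zpow x hx hx0
  rw [hk] at hlt ⊢
  have := (zpow_lt_zpow_iff_right_of_lt_one₀ h.pos h.lt_one).1 hlt
  exact (zpow_le_zpow_iff_right_of_lt_one₀ h.pos h.lt_one).2 (by omega)

theorem SameValues.trans {M₁ M₂ M₃ : IntermediateField K A} (h1 : SameValues M₁ M₂)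
    (h2 : SameValues M₂ M₃) : SameValues M₁ M₃ := by
  intro x hx
  obtain ⟨y, hy, hxy⟩ := h1 x hx
  obtain ⟨z, hz, hyz⟩ := h2 y hy
  exact ⟨z, hz, hxy.trans hyz⟩

/-- Adjoining a root of a uniformizer. -/
theorem IsUnif.root_norm_ne {M : IntermediateField K A} {ϖ w : A} (h : IsUnif M ϖ) {d : ℕ}
    (hw : w ^ d = ϖ) : ∀ k, 0 < k → k < d → ∀ x ∈ M, ‖x‖ ≠ ‖w‖ ^ k := by
  intro k h0 hk x hx he
  have hw0 : 0 < ‖w‖ := by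
    rw [norm_pos_iff]; rintro rfl
    rw [zero_pow (by omega)] at hw
    exact h.ne_zero hw.symm
  have hw1 : ‖w‖ < 1 := by
    by_contra! h1
    have := one_le_pow₀ h1 (n := d)
    rw [← norm_pow, hw] at this
    exact absurd h.lt_one (not_lt.2 this)
  obtain ⟨j, hj⟩ := h.exists_zpow x hx (norm_pos_iff.1 (by rw [he]; positivity))
  rw [he, ← hw, norm_pow, ← zpow_natCast, ← zpow_natCast, ← zpow_mul] at hj
  have := zpow_right_injective₀ hw0 hw1.ne hj
  have h1 : (d : ℤ) ∣ k := ⟨j, this⟩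
  exact absurd (Int.le_of_dvd (by exact_mod_cast h0) h1) (by push Not; exact_mod_cast hk)

theorem IsUnif.degOver_root_le {M : IntermediateField K A} {ϖ w : A} (h : IsUnif M ϖ) {d : ℕ}
    (hd : d ≠ 0) (hw : w ^ d = ϖ) : degOver M w ≤ d := by
  have := degOver_le_of_monic (M := M) (t := w) (q := X ^ d - C ⟨ϖ, h.mem⟩)
    (monic_X_pow_sub_C _ hd) (by
      rw [map_sub, map_pow, aeval_X, aeval_C, hw]; exact sub_self _)
  rwa [natDegree_X_pow_sub_C] at this

theorem IsUnif.root {M : IntermediateField K A} {ϖ w : A} (h : IsUnif M ϖ) {d : ℕ} (hd : d ≠ 0)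
    (hw : w ^ d = ϖ) : IsUnif (M ⊔ K⟮w⟯) w := by
  have hw0 : 0 < ‖w‖ := by
    rw [norm_pos_iff]; rintro rfl
    rw [zero_pow hd] at hw
    exact h.ne_zero hw.symm
  refine ⟨subset_sup_adjoin M w, hw0, ?_, fun x hx hx0 => ?_⟩
  · by_contra! h1
    have := one_le_pow₀ h1 (n := d)
    rw [← norm_pow, hw] at this
    exact absurd h.lt_one (not_lt.2 this)
  · obtain ⟨i, -, c, hc, hc0, hxc, -⟩ := exists_monomial_of_totallyRamified
      (h.degOver_root_le hd hw) (h.root_norm_ne hw) hx hx0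
    obtain ⟨j, hj⟩ := h.exists_zpow c hc hc0
    refine ⟨d * j + i, ?_⟩
    rw [hxc, norm_mul, hj, ← hw, norm_pow, norm_pow, zpow_add₀ hw0.ne', zpow_mul, zpow_natCast,
      zpow_natCast]

variable [IsAlgClosed A]

/-- The norm of an element of degree `n` is an `n`-th root of a norm of the ground field. -/
theorem exists_norm_pow_degOver (hinv : ∀ (σ : A ≃ₐ[K] A) (x : A), ‖σ x‖ = ‖x‖)
    (M : IntermediateField K A) (x : A) : ∃ y ∈ M, ‖x‖ ^ degOver M x = ‖y‖ := by
  have hm := (minpoly.monic (isIntegral_intermediateField M x)).map (algebraMap M A)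
  refine ⟨((minpoly M x).coeff 0 : A), SetLike.coe_mem _, ?_⟩
  have h1 := (IsAlgClosed.splits ((minpoly M x).map (algebraMap M A))).coeff_zero_eq_prod_roots_of_monic hm
  have h2 : ∀ s : Multiset A, (∀ y ∈ s, ‖y‖ = ‖x‖) → ‖s.prod‖ = ‖x‖ ^ s.card := by
    intro s
    induction s using Multiset.induction_on with
    | empty => simp
    | cons a s ih =>
      intro h
      rw [Multiset.prod_cons, norm_mul, h a (by simp), ih fun y hy => h y (by simp [hy]),
        Multiset.card_cons, pow_succ']
  have h3 := h2 ((minpoly M x).map (algebraMap M A)).roots (by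
    intro y hy
    obtain ⟨σ, rfl⟩ := exists_algEquiv_of_root (M := M) (x := x) (y := y) (by
      rw [aeval_def, ← eval_map]; exact (mem_roots'.1 hy).2)
    exact norm_algEquiv_apply hinv σ x)
  have h4 : ((minpoly M x).map (algebraMap M A)).roots.card = degOver M x := by
    rw [← (IsAlgClosed.splits ((minpoly M x).map (algebraMap M A))).natDegree_eq_card_roots,
      natDegree_map]
    rfl
  rw [coeff_map] at h1
  change ((minpoly M x).coeff 0 : A) = _ at h1
  rw [h1, norm_mul, h3, h4]
  simp

/-- A finite extension of a discretely valued field is discretely valued. -/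
theorem exists_isUnif (hinv : ∀ (σ : A ≃ₐ[K] A) (x : A), ‖σ x‖ = ‖x‖) {K₀ : IntermediateField K A}
    {ϖ : A} (h : IsUnif K₀ ϖ) (M : IntermediateField K A) [FiniteDimensional K M] (hle : K₀ ≤ M) :
    ∃ ϖ', IsUnif M ϖ' := by
  -- The factorial is a common multiple of the degrees of all elements of `M`, so the N-th power of
  -- every norm on `M` is a norm from `K₀`. The new uniformizer is an element realising the least
  -- positive exponent.
  set N := (Module.finrank K M).factorial with hN
  have hN0 : N ≠ 0 := Nat.factorial_ne_zero _
  have hval : ∀ x ∈ M, x ≠ 0 → ∃ j : ℤ, ‖x‖ ^ N = ‖ϖ‖ ^ j := by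
    intro x hx hx0
    obtain ⟨y, hy, hxy⟩ := exists_norm_pow_degOver hinv K₀ x
    obtain ⟨l, hl⟩ : degOver K₀ x ∣ N :=
      Nat.dvd_factorial (degOver_pos K₀ x) (degOver_le_finrank hx)
    have hx0' : 0 < ‖x‖ := norm_pos_iff.2 hx0
    obtain ⟨j, hj⟩ := h.exists_zpow y hy (norm_pos_iff.1 (by rw [← hxy]; positivity))
    exact ⟨j * l, by rw [hl, pow_mul, hxy, hj, zpow_mul, zpow_natCast]⟩
  have hex : ∃ j : ℕ, 0 < j ∧ ∃ x ∈ M, ‖x‖ ^ N = ‖ϖ‖ ^ j :=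
    ⟨N, Nat.pos_of_ne_zero hN0, ϖ, hle h.mem, rfl⟩
  classical
  obtain ⟨hj0, x₀, hx₀, hx₀j⟩ := Nat.find_spec hex
  set j₀ := Nat.find hex
  have hpos : 0 < ‖x₀‖ := by
    refine lt_of_le_of_ne (norm_nonneg _) fun h0 => ?_
    rw [← h0, zero_pow hN0] at hx₀j
    exact (pow_pos h.pos _).ne hx₀j
  have hx₀0 : x₀ ≠ 0 := norm_pos_iff.1 hpos
  refine ⟨x₀, hx₀, hpos, ?_, fun x hx hx0 => ?_⟩
  · by_contra! h1
    have := one_le_pow₀ h1 (n := N)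
    rw [hx₀j] at this
    exact absurd (pow_lt_one₀ h.pos.le h.lt_one hj0.ne') (not_lt.2 this)
  · obtain ⟨j, hj⟩ := hval x hx hx0
    refine ⟨j / j₀, ?_⟩
    have hr0 : 0 ≤ j % j₀ := Int.emod_nonneg _ (by exact_mod_cast hj0.ne')
    have hrlt : j % j₀ < j₀ := Int.emod_lt_of_pos _ (by exact_mod_cast hj0)
    have hy : ‖x / x₀ ^ (j / j₀)‖ ^ N = ‖ϖ‖ ^ (j % j₀) := by
      rw [norm_div, div_pow, hj, norm_zpow, ← zpow_natCast, ← zpow_mul, mul_comm (j / _), zpow_mul,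
        zpow_natCast, hx₀j, ← zpow_natCast, ← zpow_mul, ← zpow_sub₀ h.pos.ne', Int.emod_def]
    have hy1 : j % j₀ = 0 := by
      by_contra hne
      have := Nat.find_min hex (m := (j % j₀).toNat) (by omega)
      refine this ⟨by omega, x / x₀ ^ (j / j₀), div_mem hx (zpow_mem hx₀ _), ?_⟩
      rw [hy, ← zpow_natCast, Int.toNat_of_nonneg hr0]
    rw [hy1, zpow_zero, pow_eq_one_iff_of_nonneg (norm_nonneg _) hN0, norm_div,
      div_eq_one_iff_eq (norm_ne_zero_iff.2 (zpow_ne_zero _ hx₀0)), norm_zpow] at hy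
    exact hy

omit [IsAlgClosed A] in
/-- Expansion in powers of a uniformizer, with coefficients from a set of lifts. -/
theorem exists_expansion {M D : IntermediateField K A} {w : A} (hw : IsUnif M w) (hDM : D ≤ M)
    (hD : ∀ x ∈ M, ‖x‖ ≤ 1 → ∃ c ∈ D, ‖c‖ ≤ 1 ∧ ‖x - c‖ < 1) (j : ℤ) {x : A} (hx : x ∈ M)
    (hxj : ‖x‖ ≤ ‖w‖ ^ j) (n : ℕ) :
    ∃ c : ℕ → A, (∀ i, c i ∈ D) ∧ (∀ i, ‖c i‖ ≤ 1) ∧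
      ‖x - ∑ i ∈ Finset.range n, c i * w ^ (j + i)‖ ≤ ‖w‖ ^ (j + n) := by
  induction n with
  | zero => exact ⟨0, fun _ => zero_mem _, fun _ => by simp, by simpa using hxj⟩
  | succ n ih =>
    obtain ⟨c, hc, hc1, hle⟩ := ih
    set r := x - ∑ i ∈ Finset.range n, c i * w ^ (j + i) with hr
    have hwn : w ^ (j + n) ≠ 0 := zpow_ne_zero _ hw.ne_zero
    have hrM : r ∈ M := sub_mem hx (sum_mem fun i _ => mul_mem (hDM (hc i)) (zpow_mem hw.mem _))
    obtain ⟨e, he, he1, hlt⟩ := hD (r / w ^ (j + n)) (div_mem hrM (zpow_mem hw.mem _)) (by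
      rw [norm_div, norm_zpow]; exact div_le_one_of_le₀ hle (zpow_pos hw.pos _).le)
    refine ⟨Function.update c n e, fun i => ?_, fun i => ?_, ?_⟩
    · rcases eq_or_ne i n with rfl | h
      · simpa using he
      · simpa [h] using hc i
    · rcases eq_or_ne i n with rfl | h
      · simpa using he1
      · simpa [h] using hc1 i
    · have h1 : x - ∑ i ∈ Finset.range (n + 1), Function.update c n e i * w ^ (j + i) =
          (r / w ^ (j + n) - e) * w ^ (j + n) := by
        rw [Finset.sum_range_succ, Function.update_self, Finset.sum_congr rfl fun i hi => by
          rw [Function.update_of_ne (Finset.mem_range.1 hi).ne], sub_mul, div_mul_cancel₀ _ hwn, hr]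
        ring
      rw [h1]
      have h2 : (r / w ^ (j + n) - e) * w ^ (j + n) ∈ M :=
        mul_mem (sub_mem (div_mem hrM (zpow_mem hw.mem _)) (hDM he)) (zpow_mem hw.mem _)
      have := hw.norm_le_of_lt h2 (a := j + n) (by
        rw [norm_mul, norm_zpow]
        exact mul_lt_of_lt_one_left (zpow_pos hw.pos _) hlt)
      rwa [add_assoc] at this

omit [IsAlgClosed A] in
/-- Greedy expansion with `p`-th powers as coefficients. -/
theorem exists_pow_expansion {p : ℕ} (hp : p.Prime) (hpA : ‖(p : A)‖ < 1)
    {M D : IntermediateField K A} {w : A} (hw : IsUnif M w) (hDM : D ≤ M)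
    (hD : ∀ x ∈ M, ‖x‖ ≤ 1 → ∃ c ∈ D, ‖c‖ ≤ 1 ∧ ‖x - c‖ < 1) (j : ℤ) {x : A} (hx : x ∈ M)
    (hxj : ‖x‖ ≤ ‖w‖ ^ j) (n : ℕ) :
    ∃ c : ℕ → A, (∀ i, c i ∈ D) ∧ (∀ i, ‖c i‖ ≤ 1) ∧
      (‖x - ∑ i ∈ Finset.range n, c i ^ p * w ^ (j + i)‖ ≤ ‖w‖ ^ (j + n) ∨
        ∃ k < n, ∃ u ∈ M, ‖u‖ ≤ 1 ∧ (∀ c ∈ M, ‖c‖ ≤ 1 → 1 ≤ ‖u - c ^ p‖) ∧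
          x - ∑ i ∈ Finset.range k, c i ^ p * w ^ (j + i) = u * w ^ (j + k)) := by
  induction n with
  | zero => exact ⟨0, fun _ => zero_mem _, fun _ => by simp, Or.inl (by simpa using hxj)⟩
  | succ n ih =>
    obtain ⟨c, hc, hc1, hle | ⟨k, hk, hstuck⟩⟩ := ih
    swap
    · exact ⟨c, hc, hc1, Or.inr ⟨k, hk.trans (Nat.lt_succ_self n), hstuck⟩⟩
    set r := x - ∑ i ∈ Finset.range n, c i ^ p * w ^ (j + i) with hr
    have hwn : w ^ (j + n) ≠ 0 := zpow_ne_zero _ hw.ne_zero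
    have hrM : r ∈ M :=
      sub_mem hx (sum_mem fun i _ => mul_mem (pow_mem (hDM (hc i)) p) (zpow_mem hw.mem _))
    have huM : r / w ^ (j + n) ∈ M := div_mem hrM (zpow_mem hw.mem _)
    have hu1 : ‖r / w ^ (j + n)‖ ≤ 1 := by
      rw [norm_div, norm_zpow]; exact div_le_one_of_le₀ hle (zpow_pos hw.pos _).le
    -- The expansion continues as long as the residue class of the current leading coefficient is a
    -- p-th power in the residue field of `M`.
    by_cases hpow : ∀ c ∈ M, ‖c‖ ≤ 1 → 1 ≤ ‖r / w ^ (j + n) - c ^ p‖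
    · exact ⟨c, hc, hc1, Or.inr ⟨n, Nat.lt_succ_self n, _, huM, hu1, hpow,
        (div_mul_cancel₀ _ hwn).symm⟩⟩
    push Not at hpow
    obtain ⟨e', he'M, he'1, hlt'⟩ := hpow
    -- The approximate p-th root is replaced by a lift in `D`; congruent elements have congruent
    -- p-th powers because ‖p‖ < 1.
    obtain ⟨e, he, he1, hee⟩ := hD e' he'M he'1
    have hlt : ‖r / w ^ (j + n) - e ^ p‖ < 1 := by
      have h1 : ‖e' ^ p - e ^ p‖ < 1 := by
        have h2 := norm_sub_pow_prime_sub_le hp (x := e') (y := e) (B := 1)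
          (pow_le_one₀ (norm_nonneg _) he'1) (pow_le_one₀ (norm_nonneg _) he1)
        have h3 : ‖(e' - e) ^ p‖ < 1 := by
          rw [norm_pow]; exact pow_lt_one₀ (norm_nonneg _) hee hp.ne_zero
        have h4 := norm_sub_lt_of_lt_of_lt h3 (h2.trans_lt (by rwa [mul_one]))
        rwa [sub_sub_cancel] at h4
      have := norm_add_lt_of_lt_of_lt hlt' h1
      rwa [sub_add_sub_cancel] at this
    refine ⟨Function.update c n e, fun i => ?_, fun i => ?_, Or.inl ?_⟩
    · rcases eq_or_ne i n with rfl | h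
      · simpa using he
      · simpa [h] using hc i
    · rcases eq_or_ne i n with rfl | h
      · simpa using he1
      · simpa [h] using hc1 i
    · have h1 : x - ∑ i ∈ Finset.range (n + 1), Function.update c n e i ^ p * w ^ (j + i) =
          (r / w ^ (j + n) - e ^ p) * w ^ (j + n) := by
        rw [Finset.sum_range_succ, Function.update_self, Finset.sum_congr rfl fun i hi => by
          rw [Function.update_of_ne (Finset.mem_range.1 hi).ne], sub_mul, div_mul_cancel₀ _ hwn, hr]
        ring
      rw [h1]
      have h2 : (r / w ^ (j + n) - e ^ p) * w ^ (j + n) ∈ M :=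
        mul_mem (sub_mem huM (pow_mem (hDM he) p)) (zpow_mem hw.mem _)
      have := hw.norm_le_of_lt h2 (a := j + n) (by
        rw [norm_mul, norm_zpow]
        exact mul_lt_of_lt_one_left (zpow_pos hw.pos _) hlt)
      rwa [add_assoc] at this

end Discrete

/-! ### Iterated p-th powers on the unit ball. -/

section Frobenius

variable {A : Type*} [NormedField A] [IsUltrametricDist A] {p : ℕ}

theorem norm_add_pow_prime_pow_sub_le (hp : p.Prime) {x y : A} (hx : ‖x‖ ≤ 1) (hy : ‖y‖ ≤ 1)
    (n : ℕ) : ‖(x + y) ^ p ^ n - (x ^ p ^ n + y ^ p ^ n)‖ ≤ ‖(p : A)‖ := by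
  obtain ⟨r, hr⟩ := exists_add_pow_prime_pow_eq hp (⟨x, mem_unitBall.2 hx⟩ : unitBall A)
    ⟨y, mem_unitBall.2 hy⟩ n
  have hr' : (x + y) ^ p ^ n = x ^ p ^ n + y ^ p ^ n + p * x * y * r := by
    simpa using congrArg Subtype.val hr
  rw [hr', add_sub_cancel_left, norm_mul, norm_mul, norm_mul, mul_assoc, mul_assoc]
  exact mul_le_of_le_one_right (norm_nonneg _) (mul_le_one₀ hx (by positivity)
    (mul_le_one₀ hy (norm_nonneg _) (mem_unitBall.1 r.2)))

end Frobenius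

/-! ### Artin–Schreier classes modulo integral elements, and extensions of Artin–Schreier type. -/

section ArtinSchreier

set_option linter.unusedSectionVars false

variable {K A : Type*} [Field K] [NormedField A] [IsUltrametricDist A] [Algebra K A]
  [Algebra.IsAlgebraic K A] {p : ℕ} {Q : ℝ}

/-- Elements of the form `s ^ p - s` modulo the unit ball, with `s ∈ M` bounded. -/
def ASTrivial (p : ℕ) (Q : ℝ) (M : IntermediateField K A) (x : A) : Prop :=
  ∃ s ∈ M, ‖s‖ ^ p ≤ Q ∧ ‖x - (s ^ p - s)‖ ≤ 1

theorem ASTrivial.mono {M N : IntermediateField K A} (h : M ≤ N) {x : A}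
    (hx : ASTrivial p Q M x) : ASTrivial p Q N x := by
  obtain ⟨s, hs, h1⟩ := hx
  exact ⟨s, h hs, h1⟩

theorem ASTrivial.of_norm_le_one (hp : p.Prime) (hQ : 1 ≤ Q) (M : IntermediateField K A) {x : A}
    (hx : ‖x‖ ≤ 1) : ASTrivial p Q M x :=
  ⟨0, zero_mem _, by simp [hp.ne_zero]; linarith, by simpa [hp.ne_zero] using hx⟩

theorem pow_le_of_max {x y : A} (hx : ‖x‖ ^ p ≤ Q) (hy : ‖y‖ ^ p ≤ Q) (z : A)
    (hz : ‖z‖ ≤ max ‖x‖ ‖y‖) : ‖z‖ ^ p ≤ Q := by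
  refine (pow_le_pow_left₀ (norm_nonneg _) hz p).trans ?_
  rcases max_choice ‖x‖ ‖y‖ with h | h <;> rw [h] <;> assumption

/-- The bound `Q` on ‖s‖^p together with ‖p‖Q ≤ 1 keeps the error of Frobenius inside the unit ball.
In mixed characteristic the trivial classes form a group only because of this bound. -/
theorem ASTrivial.add (hp : p.Prime) (hpQ : ‖(p : A)‖ * Q ≤ 1) {M : IntermediateField K A}
    {x y : A} (hx : ASTrivial p Q M x) (hy : ASTrivial p Q M y) : ASTrivial p Q M (x + y) := by
  obtain ⟨s, hs, hs1, hs2⟩ := hx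
  obtain ⟨t, ht, ht1, ht2⟩ := hy
  refine ⟨s + t, add_mem hs ht, pow_le_of_max hs1 ht1 _ (IsUltrametricDist.norm_add_le_max _ _), ?_⟩
  have h3 := (norm_add_pow_prime_sub_le hp hs1 ht1).trans hpQ
  have := norm_sub_le_of_le_of_le (norm_add_le_of_le_of_le hs2 ht2) h3
  convert this using 2
  ring

theorem ASTrivial.neg (hp : p.Prime) (hpQ : ‖(p : A)‖ * Q ≤ 1) {M : IntermediateField K A}
    {x : A} (hx : ASTrivial p Q M x) : ASTrivial p Q M (-x) := by
  obtain ⟨s, hs, hs1, hs2⟩ := hx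
  refine ⟨-s, neg_mem hs, by rwa [norm_neg], ?_⟩
  have h3 := (norm_neg_pow_add_pow_le hp hs1).trans hpQ
  have e : -x - ((-s) ^ p - -s) = -((x - (s ^ p - s)) + ((-s) ^ p + s ^ p)) := by ring
  rw [e, norm_neg]
  exact norm_add_le_of_le_of_le hs2 h3

theorem ASTrivial.sub (hp : p.Prime) (hpQ : ‖(p : A)‖ * Q ≤ 1) {M : IntermediateField K A}
    {x y : A} (hx : ASTrivial p Q M x) (hy : ASTrivial p Q M y) : ASTrivial p Q M (x - y) := by
  rw [sub_eq_add_neg]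
  exact hx.add hp hpQ (hy.neg hp hpQ)

theorem ASTrivial.pow_sub_self {M : IntermediateField K A} {y : A} (hy : y ∈ M)
    (hyQ : ‖y‖ ^ p ≤ Q) : ASTrivial p Q M (y ^ p - y) :=
  ⟨y, hy, hyQ, by simp⟩

/-- The difference telescopes into the terms Y^p - Y with Y = y^(p^i). The bound on the top power
controls all the lower ones. -/
theorem ASTrivial.pow_pow_sub_self (hp : p.Prime) (hQ : 1 ≤ Q) (hpQ : ‖(p : A)‖ * Q ≤ 1)
    {M : IntermediateField K A} {y : A} (hy : y ∈ M) (n : ℕ) (hyQ : ‖y‖ ^ p ^ n ≤ Q) :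
    ASTrivial p Q M (y ^ p ^ n - y) := by
  induction n with
  | zero => simpa using ASTrivial.of_norm_le_one hp hQ M (x := (0 : A)) (by simp)
  | succ n ih =>
    have h1 : ‖y‖ ^ p ^ n ≤ Q := by
      rcases le_total ‖y‖ 1 with h | h
      · exact (pow_le_one₀ (norm_nonneg _) h).trans hQ
      · exact (pow_le_pow_right₀ h (Nat.pow_le_pow_right hp.pos (Nat.le_succ n))).trans hyQ
    have h2 := (ASTrivial.pow_sub_self (p := p) (Q := Q) (pow_mem hy (p ^ n)) (by
      rwa [norm_pow, ← pow_mul, ← pow_succ])).add hp hpQ (ih h1)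
    rwa [sub_add_sub_cancel, ← pow_mul, ← pow_succ] at h2

/-- `t` generates an extension of degree at most `p` of `M` which looks like the Artin–Schreier
extension attached to `z`. -/
structure ASType (p : ℕ) (Q : ℝ) (M : IntermediateField K A) (t z : A) : Prop where
  mem : z ∈ M
  deg : degOver M t ≤ p
  sep : IsSeparable M t
  conj : ∀ σ : A ≃ₐ[K] A, (∀ x ∈ M, σ x = x) → σ t = t ∨ 1 ≤ ‖σ t - t‖
  eqn : ‖t ^ p - t - z‖ ≤ 1
  le : ‖z‖ ≤ Q

theorem isSeparable_mono {M N : IntermediateField K A} (h : M ≤ N) {t : A} (ht : IsSeparable M t) :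
    IsSeparable N t := by
  have h1 : (minpoly N t) ∣ (minpoly M t).map (inclusion h).toRingHom := by
    refine minpoly.dvd _ _ ?_
    rw [aeval_def, eval₂_map]
    exact minpoly.aeval M t
  exact (Separable.map (f := (inclusion h).toRingHom) ht).of_dvd h1

/-- Every clause is stable under enlarging the base: the degree is only bounded above, and the
condition on conjugates has fewer automorphisms to satisfy. -/
theorem ASType.mono {M N : IntermediateField K A} (h : M ≤ N) {t z : A} (ht : ASType p Q M t z) :
    ASType p Q N t z :=
  ⟨h ht.mem, (degOver_anti h t).trans ht.deg, isSeparable_mono h ht.sep,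
    fun σ hσ => ht.conj σ fun x hx => hσ x (h hx), ht.eqn, ht.le⟩

/-- If ‖t‖ > 1, then t^p dominates t and has the norm of t^p - t, which differs from z by an
integral element. -/
theorem norm_pow_le_of_eqn (hp : p.Prime) (hQ : 1 ≤ Q) {t z : A} (h : ‖t ^ p - t - z‖ ≤ 1)
    (hz : ‖z‖ ≤ Q) : ‖t‖ ^ p ≤ Q := by
  rcases le_or_gt ‖t‖ 1 with h1 | h1
  · exact (pow_le_one₀ (norm_nonneg _) h1).trans hQ
  · have h2 : ‖t‖ < ‖t ^ p‖ := by
      rw [norm_pow]; exact lt_self_pow₀ h1 hp.one_lt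
    have h3 : ‖t ^ p - t‖ ≤ Q := by
      have := norm_add_le_of_le_of_le (h.trans hQ) hz
      rwa [sub_add_cancel] at this
    rwa [← norm_pow, norm_eq_of_norm_sub_lt_left (x := t ^ p) (y := t ^ p - t) (by
      rwa [sub_sub_cancel])]

variable [IsAlgClosed A]

theorem isSeparable_sub {M : IntermediateField K A} {t s : A} (ht : IsSeparable M t) (hs : s ∈ M) :
    IsSeparable M (t - s) := by
  have h := isSeparable_algebraMap (F := M) (K := A) ⟨s, hs⟩
  exact Field.isSeparable_sub ht h

/-- Passing from t to t - s subtracts s^p - s from z, up to the Frobenius error, which is integral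
by the bound on `Q`. -/
theorem ASType.translate (hp : p.Prime) (hQ : 1 ≤ Q) (hpQ : ‖(p : A)‖ * Q ≤ 1)
    {M : IntermediateField K A} {t z s z' : A} (ht : ASType p Q M t z) (hs : s ∈ M)
    (hsQ : ‖s‖ ^ p ≤ Q) (hz' : z' ∈ M) (hz'Q : ‖z'‖ ≤ Q) (hzz' : ‖z - (s ^ p - s) - z'‖ ≤ 1) :
    ASType p Q M (t - s) z' := by
  have hadj := sup_adjoin_affine (M := M) t (one_mem M) one_ne_zero hs
  rw [one_mul] at hadj
  refine ⟨hz', ?_, isSeparable_sub ht.sep hs, fun σ hσ => ?_, ?_, hz'Q⟩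
  · rw [degOver_eq_of_adjoin_eq hadj]; exact ht.deg
  · rw [map_sub, hσ s hs, sub_left_inj, sub_sub_sub_cancel_right]
    exact ht.conj σ hσ
  · have h1 := (norm_sub_pow_prime_sub_le hp (norm_pow_le_of_eqn hp hQ ht.eqn ht.le) hsQ).trans hpQ
    have := norm_add_le_of_le_of_le (norm_add_le_of_le_of_le h1 ht.eqn) hzz'
    convert this using 2
    ring

/-- For integral t, distinct conjugates are incongruent, so they reduce to distinct residue classes
and the residue degree is full. -/
theorem ASType.sameValues_of_norm_le_one (hinv : ∀ (σ : A ≃ₐ[K] A) (x : A), ‖σ x‖ = ‖x‖)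
    {M : IntermediateField K A} {t z : A} (ht : ASType p Q M t z) (ht1 : ‖t‖ ≤ 1) :
    SameValues (M ⊔ K⟮t⟯) M := by
  refine sameValues_of_degOver_le ht1 (degOver_le_of_conj hinv ht1 ht.sep fun σ => ?_)
  exact ht.conj (σ.restrictScalars K) fun x hx => algEquiv_apply_mem σ hx

/-- Translating by the witness s replaces z by 0, which makes the generator integral. -/
theorem ASType.sameValues_of_trivial (hinv : ∀ (σ : A ≃ₐ[K] A) (x : A), ‖σ x‖ = ‖x‖)
    (hp : p.Prime) (hQ : 1 ≤ Q) (hpQ : ‖(p : A)‖ * Q ≤ 1) {M : IntermediateField K A} {t z : A}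
    (ht : ASType p Q M t z) (hz : ASTrivial p Q M z) : SameValues (M ⊔ K⟮t⟯) M := by
  obtain ⟨s, hs, hsQ, hs1⟩ := hz
  have h := ht.translate hp hQ hpQ hs hsQ (zero_mem M) (by simp; linarith) (by rwa [sub_zero])
  have hadj := sup_adjoin_affine (M := M) t (one_mem M) one_ne_zero hs
  rw [one_mul] at hadj
  rw [← hadj]
  refine h.sameValues_of_norm_le_one hinv ?_
  have h1 := norm_pow_le_of_eqn hp le_rfl h.eqn (by simp)
  exact (pow_le_one_iff_of_nonneg (norm_nonneg _) hp.ne_zero).1 h1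

/-- The fiercely ramified case. -/
theorem ASType.sameValues_of_not_pow (hp : p.Prime) (hQ : 1 ≤ Q) (hpQ : ‖(p : A)‖ * Q ≤ 1)
    {M : IntermediateField K A} {t z g u r : A} (ht : ASType p Q M t z) (hg : g ∈ M) (hg0 : g ≠ 0)
    (hg1 : ‖g‖ < 1) (hu : u ∈ M) (hu1 : ‖u‖ ≤ 1) (hpow : ∀ c ∈ M, ‖c‖ ≤ 1 → 1 ≤ ‖u - c ^ p‖)
    (hr : ‖r‖ * ‖g‖ ^ p < 1) (hz : ASTrivial p Q M (z - (u / g ^ p + r))) :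
    SameValues (M ⊔ K⟮t⟯) M := by
  obtain ⟨s, hs, hsQ, hs1⟩ := hz
  set T := t - s with hT
  have hgp : 0 < ‖g‖ ^ p := pow_pos (norm_pos_iff.2 hg0) p
  have hgp1 : ‖g‖ ^ p < 1 := pow_lt_one₀ (norm_nonneg _) hg1 hp.ne_zero
  have h1 := (norm_sub_pow_prime_sub_le hp (norm_pow_le_of_eqn hp hQ ht.eqn ht.le) hsQ).trans hpQ
  have h2 : ‖T ^ p - T - (u / g ^ p + r)‖ ≤ 1 := by
    have := norm_add_le_of_le_of_le (norm_add_le_of_le_of_le h1 ht.eqn) hs1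
    convert this using 2
    ring
  -- If ‖T‖ were at least ‖g‖^(-p), it would exceed 1 and bound both u/g^p and r, so the equation
  -- would give ‖T^p‖ ≤ ‖T‖.
  have hTlt : ‖T‖ * ‖g‖ ^ p < 1 := by
    by_contra! h3
    have h4 : 1 < ‖T‖ := by
      by_contra! h5
      have : ‖T‖ * ‖g‖ ^ p ≤ 1 * ‖g‖ ^ p := by gcongr
      linarith
    have h5 : ‖u / g ^ p + r‖ ≤ ‖T‖ := by
      refine norm_add_le_of_le_of_le ?_ ?_
      · rw [norm_div, norm_pow, div_le_iff₀ hgp]; exact hu1.trans h3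
      · exact le_of_mul_le_mul_right (hr.le.trans h3) hgp
    have h6 : ‖T ^ p‖ ≤ ‖T‖ := by
      have := norm_add_le_of_le_of_le (norm_add_le_of_le_of_le (h2.trans h4.le) h5) le_rfl
      convert this using 2
      ring
    rw [norm_pow] at h6
    exact absurd (lt_self_pow₀ h4 hp.one_lt) (not_lt.2 h6)
  -- Clearing the pole by g makes T and r negligible after multiplication by g^p, so only b^p ≡ u
  -- remains.
  set b := g * T with hb
  have hbu : ‖b ^ p - u‖ < 1 := by
    have e : b ^ p - u = (T ^ p - T - (u / g ^ p + r)) * g ^ p + T * g ^ p + r * g ^ p := by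
      rw [hb, mul_pow]
      field_simp
      ring
    rw [e]
    refine norm_add_lt_of_lt_of_lt (norm_add_lt_of_lt_of_lt ?_ ?_) ?_
    · rw [norm_mul, norm_pow]
      exact (mul_le_of_le_one_left hgp.le h2).trans_lt hgp1
    · rwa [norm_mul, norm_pow]
    · rwa [norm_mul, norm_pow]
  have hb1 : ‖b‖ ≤ 1 := by
    have := norm_add_le_of_le_of_le hbu.le hu1
    rw [sub_add_cancel, norm_pow] at this
    exact (pow_le_one_iff_of_nonneg (norm_nonneg _) hp.ne_zero).1 this
  have hadj : M ⊔ K⟮b⟯ = M ⊔ K⟮t⟯ := sup_adjoin_affine t hg hg0 hs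
  rw [← hadj]
  refine sameValues_of_degOver_le hb1 (degOver_le_of_not_pow hp hb1 hu hu1 hbu hpow ?_)
  rw [degOver_eq_of_adjoin_eq hadj]
  exact ht.deg

end ArtinSchreier

/-! ### Eliminable extensions, and p^n-th powers of elements with bounded poles. -/

section Elimination

set_option linter.unusedSectionVars false

variable {K A : Type*} [Field K] [NormedField A] [IsUltrametricDist A] [Algebra K A]
  [Algebra.IsAlgebraic K A] [IsAlgClosed A] {p : ℕ}

/-- There is a finite residually separable extension `K'` of `K₀` with `e(N K' / K') = 1`. -/
def Eliminable (K₀ N : IntermediateField K A) : Prop :=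
  ∃ K' : IntermediateField K A, FiniteDimensional K K' ∧ K₀ ≤ K' ∧ ResSeparable K₀ K' ∧
    SameValues (N ⊔ K') K'

/-- The composite of N and K₁ with an extension K' of K₁ is just N K', and residual separability is
transitive. -/
theorem Eliminable.trans {K₀ K₁ N : IntermediateField K A} (hle : K₀ ≤ K₁)
    (hs : ResSeparable K₀ K₁) (h : Eliminable K₁ (N ⊔ K₁)) : Eliminable K₀ N := by
  obtain ⟨K', hfin, hle', hs', he⟩ := h
  refine ⟨K', hfin, hle.trans hle', hs.trans hle hs', ?_⟩
  rwa [sup_assoc, sup_eq_right.2 hle'] at he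

theorem Eliminable.of_sameValues {K₀ N : IntermediateField K A} [hf : FiniteDimensional K K₀]
    (hle : K₀ ≤ N) (h : SameValues N K₀) : Eliminable K₀ N :=
  ⟨K₀, hf, le_rfl, ResSeparable.refl K₀, by rwa [sup_eq_left.2 hle]⟩

/-- The field K₀(w) serves as K': it has the residue field of `K₀`, and M(w) has no values beyond
those of K₀(w). The ramification of t need only disappear over M(w). -/
theorem Eliminable.of_totallyRamified {K₀ M : IntermediateField K A} [FiniteDimensional K K₀]
    (hle : K₀ ≤ M) (he : SameValues M K₀) {w t : A} {d : ℕ} (hd : degOver K₀ w ≤ d)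
    (hw : ∀ k, 0 < k → k < d → ∀ x ∈ K₀, ‖x‖ ≠ ‖w‖ ^ k)
    (h : SameValues ((M ⊔ K⟮w⟯) ⊔ K⟮t⟯) (M ⊔ K⟮w⟯)) : Eliminable K₀ (M ⊔ K⟮t⟯) := by
  refine ⟨K₀ ⊔ K⟮w⟯, finiteDimensional_sup_adjoin K₀ w, le_sup_left,
    ResSeparable.of_resid_eq (resid_eq_of_totallyRamified hd hw), ?_⟩
  have h1 := h.trans (sameValues_of_totallyRamified hle he hd hw)
  have e : M ⊔ K⟮t⟯ ⊔ (K₀ ⊔ K⟮w⟯) = M ⊔ K⟮w⟯ ⊔ K⟮t⟯ := by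
    apply le_antisymm
    · exact sup_le (sup_le (le_sup_left.trans le_sup_left) le_sup_right)
        (sup_le (hle.trans (le_sup_left.trans le_sup_left)) (le_sup_right.trans le_sup_left))
    · exact sup_le (sup_le (le_sup_left.trans le_sup_left) (le_sup_right.trans le_sup_right))
        (le_sup_right.trans le_sup_left)
  rwa [e]

/-- Multiplying by w^m brings both elements into the unit ball, where the error is a multiple of p.
Undoing this costs the p^n-th power of w^(-m), which `hpQ` absorbs. -/
theorem norm_add_pow_sub_le_one (hp : p.Prime) {w x y : A} {m n : ℕ} (hw0 : w ≠ 0)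
    (hpQ : ‖(p : A)‖ * ‖w ^ p ^ n‖ ^ (-(m : ℤ)) ≤ 1) (hx : ‖x‖ ≤ ‖w‖ ^ (-(m : ℤ)))
    (hy : ‖y‖ ≤ ‖w‖ ^ (-(m : ℤ))) : ‖(x + y) ^ p ^ n - (x ^ p ^ n + y ^ p ^ n)‖ ≤ 1 := by
  have hw' : 0 < ‖w‖ := norm_pos_iff.2 hw0
  rw [zpow_neg, zpow_natCast, ← one_div, le_div_iff₀ (by positivity)] at hx hy
  have h := norm_add_pow_prime_pow_sub_le hp (x := x * w ^ m) (y := y * w ^ m)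
    (by rwa [norm_mul, norm_pow]) (by rwa [norm_mul, norm_pow]) n
  rw [← add_mul, mul_pow, mul_pow, mul_pow, ← add_mul, ← sub_mul, norm_mul] at h
  rw [zpow_neg, zpow_natCast, ← div_eq_mul_inv, div_le_one (by rw [norm_pow]; positivity)] at hpQ
  have e : ‖(w ^ m) ^ p ^ n‖ = ‖w ^ p ^ n‖ ^ m := by
    rw [norm_pow, norm_pow, norm_pow, ← pow_mul, ← pow_mul, mul_comm]
  rw [e] at h
  have h2 : 0 < ‖w ^ p ^ n‖ ^ m := by rw [norm_pow]; positivity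
  exact le_of_mul_le_mul_right ((h.trans hpQ).trans (one_mul _).ge) h2

theorem norm_sum_pow_sub_le_one (hp : p.Prime) {w : A} {m n : ℕ} (hw0 : w ≠ 0)
    (hpQ : ‖(p : A)‖ * ‖w ^ p ^ n‖ ^ (-(m : ℤ)) ≤ 1) {ι : Type*} (s : Finset ι) {f : ι → A}
    (hf : ∀ i ∈ s, ‖f i‖ ≤ ‖w‖ ^ (-(m : ℤ))) :
    ‖(∑ i ∈ s, f i) ^ p ^ n - ∑ i ∈ s, f i ^ p ^ n‖ ≤ 1 := by
  classical
  induction s using Finset.induction_on with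
  | empty => simp [hp.ne_zero]
  | insert i s his ih =>
    rw [Finset.sum_insert his, Finset.sum_insert his]
    have h0 : ‖∑ i ∈ s, f i‖ ≤ ‖w‖ ^ (-(m : ℤ)) :=
      norm_sum_le_of_forall_le (by positivity) fun j hj => hf j (by simp [hj])
    have h1 := norm_add_pow_sub_le_one hp hw0 hpQ (hf i (by simp)) h0
    have h3 := ih fun j hj => hf j (by simp [hj])
    convert norm_add_le_of_le_of_le h1 h3 using 2
    ring

theorem norm_mul_zpow_le {w b : A} (hw : 0 < ‖w‖) (hw1 : ‖w‖ < 1) (hb : ‖b‖ ≤ 1) {e m : ℤ}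
    (h : m ≤ e) : ‖b * w ^ e‖ ≤ ‖w‖ ^ m := by
  rw [norm_mul, norm_zpow]
  refine (mul_le_of_le_one_left (by positivity) hb).trans ?_
  exact (zpow_le_zpow_iff_right_of_lt_one₀ hw hw1).2 h

/-- Up to Artin–Schreier trivial elements, `x` is a polar part with `p ^ n`-th powers as
coefficients. -/
def PowSum (p : ℕ) (M : IntermediateField K A) (ϖ : A) (m n : ℕ) (x : A) : Prop :=
  ∃ d : ℕ → A, (∀ i, d i ∈ M) ∧ (∀ i, ‖d i‖ ≤ 1) ∧ ASTrivial p (‖ϖ‖ ^ (-(m : ℤ))) M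
    (x - ∑ i ∈ Finset.range m, d i ^ p ^ n * ϖ ^ (-(m : ℤ) + i))

/-! ### Polar parts with p^n-th powers as coefficients. -/

section PowSum

variable {M : IntermediateField K A} {ϖ : A} {m n : ℕ}

theorem one_le_zpow_neg (hϖ : IsUnif M ϖ) (m : ℕ) : 1 ≤ ‖ϖ‖ ^ (-(m : ℤ)) := by
  rw [zpow_neg, zpow_natCast]
  exact (one_le_inv₀ (pow_pos hϖ.pos m)).2 (pow_le_one₀ hϖ.pos.le hϖ.lt_one.le)

theorem PowSum.of_trivial_sub (hp : p.Prime) (hpQ : ‖(p : A)‖ * ‖ϖ‖ ^ (-(m : ℤ)) ≤ 1) {x y : A}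
    (hxy : ASTrivial p (‖ϖ‖ ^ (-(m : ℤ))) M (x - y)) (hy : PowSum p M ϖ m n y) :
    PowSum p M ϖ m n x := by
  obtain ⟨d, hd, hd1, h⟩ := hy
  refine ⟨d, hd, hd1, ?_⟩
  have := hxy.add hp hpQ h
  rwa [sub_add_sub_cancel] at this

theorem PowSum.of_trivial (hp : p.Prime) (hpQ : ‖(p : A)‖ * ‖ϖ‖ ^ (-(m : ℤ)) ≤ 1) {x y : A}
    (hy : ASTrivial p (‖ϖ‖ ^ (-(m : ℤ))) M y) (hxy : PowSum p M ϖ m n (x - y)) :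
    PowSum p M ϖ m n x :=
  PowSum.of_trivial_sub hp hpQ (by rwa [sub_sub_cancel]) hxy

theorem PowSum.zero (hp : p.Prime) (hϖ : IsUnif M ϖ) : PowSum p M ϖ m n 0 := by
  refine ⟨0, fun _ => zero_mem _, fun _ => by simp, ?_⟩
  refine ASTrivial.of_norm_le_one hp (one_le_zpow_neg hϖ m) M ?_
  simp [hp.ne_zero]

/-- Coefficients are added inside the p^n-th powers; the error is divisible by p, and p times a pole
of order at most m is integral. -/
theorem PowSum.add (hp : p.Prime) (hϖ : IsUnif M ϖ)
    (hpQ : ‖(p : A)‖ * ‖ϖ‖ ^ (-(m : ℤ)) ≤ 1) {x y : A}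
    (hx : PowSum p M ϖ m n x) (hy : PowSum p M ϖ m n y) : PowSum p M ϖ m n (x + y) := by
  obtain ⟨c, hc, hc1, h⟩ := hx
  obtain ⟨d, hd, hd1, h'⟩ := hy
  refine ⟨fun i => c i + d i, fun i => add_mem (hc i) (hd i),
    fun i => norm_add_le_of_le_of_le (hc1 i) (hd1 i), ?_⟩
  have h3 : ‖∑ i ∈ Finset.range m, ((c i + d i) ^ p ^ n - (c i ^ p ^ n + d i ^ p ^ n)) *
      ϖ ^ (-(m : ℤ) + i)‖ ≤ 1 := by
    refine norm_sum_le_of_forall_le zero_le_one fun i _ => ?_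
    rw [norm_mul, norm_zpow]
    refine le_trans (mul_le_mul (norm_add_pow_prime_pow_sub_le hp (hc1 i) (hd1 i) n)
      ((zpow_le_zpow_iff_right_of_lt_one₀ hϖ.pos hϖ.lt_one).2 ?_) (zpow_pos hϖ.pos _).le
      (norm_nonneg _)) hpQ
    omega
  have := (h.add hp hpQ h').sub hp hpQ
    (ASTrivial.of_norm_le_one hp (one_le_zpow_neg hϖ m) M h3)
  convert this using 1
  simp only [sub_mul, add_mul, Finset.sum_sub_distrib, Finset.sum_add_distrib]
  ring

theorem PowSum.sum (hp : p.Prime) (hϖ : IsUnif M ϖ)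
    (hpQ : ‖(p : A)‖ * ‖ϖ‖ ^ (-(m : ℤ)) ≤ 1) {ι : Type*} (s : Finset ι) {f : ι → A}
    (hf : ∀ i ∈ s, PowSum p M ϖ m n (f i)) : PowSum p M ϖ m n (∑ i ∈ s, f i) :=
  Finset.sum_induction f (PowSum p M ϖ m n) (fun _ _ hx hy => hx.add hp hϖ hpQ hy)
    (PowSum.zero hp hϖ) hf

theorem PowSum.monomial (hp : p.Prime) (hϖ : IsUnif M ϖ) {b : A} (hb : b ∈ M) (hb1 : ‖b‖ ≤ 1)
    {e : ℤ} (he : -(m : ℤ) ≤ e) (he0 : e < 0) : PowSum p M ϖ m n (b ^ p ^ n * ϖ ^ e) := by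
  obtain ⟨j, rfl⟩ : ∃ j : ℕ, e = -(m : ℤ) + j := ⟨(e + m).toNat, by omega⟩
  refine ⟨Pi.single j b, fun i => ?_, fun i => ?_, ?_⟩
  · rcases eq_or_ne i j with rfl | h
    · simpa using hb
    · rw [Pi.single_eq_of_ne h]; exact zero_mem _
  · rcases eq_or_ne i j with rfl | h
    · simpa using hb1
    · rw [Pi.single_eq_of_ne h]; simp
  · refine ASTrivial.of_norm_le_one hp (one_le_zpow_neg hϖ m) M ?_
    rw [Finset.sum_eq_single j, Pi.single_eq_same, sub_self, norm_zero]
    · exact zero_le_one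
    · intro i _ hij
      rw [Pi.single_eq_of_ne hij, zero_pow (pow_ne_zero _ hp.ne_zero), zero_mul]
    · intro hj
      exact absurd (Finset.mem_range.2 (by omega)) hj

theorem PowSum.of_norm_le (hp : p.Prime) (hϖ : IsUnif M ϖ) {x : A} (hx : x ∈ M)
    (hxm : ‖x‖ ≤ ‖ϖ‖ ^ (-(m : ℤ))) : PowSum p M ϖ m 0 x := by
  obtain ⟨c, hc, hc1, h⟩ := exists_expansion hϖ le_rfl
    (fun x hx hx1 => ⟨x, hx, hx1, by simp⟩) (-(m : ℤ)) hx hxm m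
  refine ⟨c, hc, hc1, ASTrivial.of_norm_le_one hp (one_le_zpow_neg hϖ m) M ?_⟩
  simpa using h

end PowSum

/-- Modulo trivial elements z is x^(p^n), with x expressed through w = ϖ^(1/p^n). Expanding x with
p-th power coefficients raises the exponent to n + 1. If the expansion stops at a coefficient u that
is not a p-th power, then over M(w'), with w'^p = w, z is equivalent to the sum of u/(w'^(m-k))^p
and an element of smaller pole, which is the fierce case. -/
theorem PowSum.succ_or_eliminable (hp : p.Prime) (hpA : ‖(p : A)‖ < 1)
    {K₀ M : IntermediateField K A} [FiniteDimensional K K₀] (hle : K₀ ≤ M) (he : SameValues M K₀)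
    {ϖ : A} (hϖ : IsUnif K₀ ϖ) {m n : ℕ}
    (hpQ : ‖(p : A)‖ * ‖ϖ‖ ^ (-(m : ℤ)) ≤ 1) {t z : A}
    (ht : ASType p (‖ϖ‖ ^ (-(m : ℤ))) M t z) (hz : PowSum p M ϖ m n z) :
    PowSum p M ϖ m (n + 1) z ∨ Eliminable K₀ (M ⊔ K⟮t⟯) := by
  set Q := ‖ϖ‖ ^ (-(m : ℤ)) with hQdef
  have hϖM : IsUnif M ϖ := hϖ.of_sameValues hle he
  have hQ : 1 ≤ Q := one_le_zpow_neg hϖM m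
  obtain ⟨d, hd, hd1, hzd⟩ := hz
  obtain ⟨w', hw'⟩ := IsAlgClosed.exists_pow_nat_eq ϖ (pow_pos hp.pos (n + 1))
  obtain ⟨w, hwdef⟩ : ∃ w, w = w' ^ p := ⟨_, rfl⟩
  have hw : w ^ p ^ n = ϖ := by rw [hwdef, ← pow_mul, ← pow_succ', hw']
  have hpn : p ^ n ≠ 0 := pow_ne_zero _ hp.ne_zero
  have hpn1 : p ^ (n + 1) ≠ 0 := pow_ne_zero _ hp.ne_zero
  have hU : IsUnif (M ⊔ K⟮w⟯) w := hϖM.root hpn hw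
  have hU' : IsUnif (M ⊔ K⟮w'⟯) w' := hϖM.root hpn1 hw'
  have hMM' : M ⊔ K⟮w⟯ ≤ M ⊔ K⟮w'⟯ :=
    sup_adjoin_le le_sup_left (hwdef ▸ pow_mem (subset_sup_adjoin M w') p)
  have hnorm : ‖w‖ ^ (-(m : ℤ)) ≤ Q := by
    rw [hQdef, ← hw, norm_pow, ← zpow_natCast, ← zpow_mul]
    refine (zpow_le_zpow_iff_right_of_lt_one₀ hU.pos hU.lt_one).2 ?_
    have : (1 : ℤ) ≤ (p ^ n : ℕ) := by exact_mod_cast Nat.one_le_iff_ne_zero.2 hpn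
    nlinarith
  have hpQ' : ‖(p : A)‖ * ‖w ^ p ^ n‖ ^ (-(m : ℤ)) ≤ 1 := by rw [hw]; exact hpQ
  have hlift : ∀ x ∈ M ⊔ K⟮w⟯, ‖x‖ ≤ 1 → ∃ c ∈ M, ‖c‖ ≤ 1 ∧ ‖x - c‖ < 1 := fun x hx hx1 =>
    exists_norm_sub_lt_one_of_totallyRamified (hϖM.degOver_root_le hpn hw)
      (hϖM.root_norm_ne hw) hx hx1
  have hzpow : ∀ e : ℤ, (w ^ e) ^ p ^ n = ϖ ^ e := fun e => by
    rw [← hw, ← zpow_natCast, ← zpow_natCast, zpow_comm]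
  set x := ∑ i ∈ Finset.range m, d i * w ^ (-(m : ℤ) + i) with hx
  have hterm : ∀ (b : A) (i : ℕ), ‖b‖ ≤ 1 → ‖b * w ^ (-(m : ℤ) + i)‖ ≤ ‖w‖ ^ (-(m : ℤ)) :=
    fun b i hb => norm_mul_zpow_le hU.pos hU.lt_one hb (by omega)
  have hxle : ‖x‖ ≤ ‖w‖ ^ (-(m : ℤ)) :=
    norm_sum_le_of_forall_le (zpow_pos hU.pos _).le fun i _ => hterm _ i (hd1 i)
  have hxM : x ∈ M ⊔ K⟮w⟯ := sum_mem fun i _ =>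
    mul_mem ((le_sup_left : M ≤ M ⊔ K⟮w⟯) (hd i)) (zpow_mem hU.mem _)
  have hzx : ASTrivial p Q M (z - x ^ p ^ n) := by
    have h1 := norm_sum_pow_sub_le_one hp hU.ne_zero hpQ' (Finset.range m)
      (f := fun i => d i * w ^ (-(m : ℤ) + i)) fun i _ => hterm _ i (hd1 i)
    have h2 := hzd.sub hp hpQ (ASTrivial.of_norm_le_one hp hQ M h1)
    convert h2 using 1
    rw [← hx]
    simp only [mul_pow, hzpow]
    ring
  -- The cutoff m - ⌊m/p⌋ serves both cases. Past it, poles have order at most ⌊m/p⌋ and their p-th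
  -- powers still have order at most m; before it, m < p(m - k).
  obtain ⟨c, hc, hc1, hgood | ⟨k, hk, u, hu, hu1, hupow, huk⟩⟩ := exists_pow_expansion hp hpA hU
    le_sup_left hlift (-(m : ℤ)) hxM hxle (m - m / p)
  · left
    set X := ∑ i ∈ Finset.range (m - m / p), c i ^ p * w ^ (-(m : ℤ) + i) with hX
    have hXM : X ∈ M ⊔ K⟮w⟯ := sum_mem fun i _ =>
      mul_mem (pow_mem ((le_sup_left : M ≤ M ⊔ K⟮w⟯) (hc i)) p) (zpow_mem hU.mem _)
    have hdiv : m / p ≤ m := Nat.div_le_self _ _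
    have hexp : -(m : ℤ) + (m - m / p : ℕ) = -((m / p : ℕ) : ℤ) := by
      push_cast [Nat.cast_sub hdiv]; ring
    rw [hexp] at hgood
    obtain ⟨b, hb, hb1, hbr⟩ := exists_expansion hU le_sup_left hlift _ (sub_mem hxM hXM) hgood
      (m / p)
    rw [neg_add_cancel, zpow_zero] at hbr
    set Y := ∑ i ∈ Finset.range (m / p), b i * w ^ (-((m / p : ℕ) : ℤ) + i) with hY
    have hcp : ∀ i, ‖c i ^ p‖ ≤ 1 := fun i => by
      rw [norm_pow]; exact pow_le_one₀ (norm_nonneg _) (hc1 i)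
    have htermY : ∀ i, ‖b i * w ^ (-((m / p : ℕ) : ℤ) + i)‖ ≤ ‖w‖ ^ (-(m : ℤ)) := fun i =>
      norm_mul_zpow_le hU.pos hU.lt_one (hb1 i) (by omega)
    have hXle : ‖X‖ ≤ ‖w‖ ^ (-(m : ℤ)) :=
      norm_sum_le_of_forall_le (zpow_pos hU.pos _).le fun i _ => hterm _ i (hcp i)
    have hYle : ‖Y‖ ≤ ‖w‖ ^ (-(m : ℤ)) :=
      norm_sum_le_of_forall_le (zpow_pos hU.pos _).le fun i _ => htermY i
    have h1 := norm_sum_pow_sub_le_one hp hU.ne_zero hpQ' (Finset.range (m - m / p))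
      (f := fun i => c i ^ p * w ^ (-(m : ℤ) + i)) fun i _ => hterm _ i (hcp i)
    have h2 := norm_sum_pow_sub_le_one hp hU.ne_zero hpQ' (Finset.range (m / p))
      (f := fun i => b i * w ^ (-((m / p : ℕ) : ℤ) + i)) fun i _ => htermY i
    rw [← hX] at h1
    rw [← hY] at h2
    have h3 := norm_add_pow_sub_le_one hp hU.ne_zero hpQ' hXle hYle
    have h4 := norm_add_pow_sub_le_one hp hU.ne_zero hpQ' (norm_add_le_of_le_of_le hXle hYle)
      (hbr.trans (one_le_zpow_neg hU m))
    have h5 : ‖(x - X - Y) ^ p ^ n‖ ≤ 1 := by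
      rw [norm_pow]; exact pow_le_one₀ (norm_nonneg _) hbr
    have h6 := norm_add_le_of_le_of_le (norm_add_le_of_le_of_le (norm_add_le_of_le_of_le
      (norm_add_le_of_le_of_le h1 h2) h3) h4) h5
    have h7 := hzx.add hp hpQ (ASTrivial.of_norm_le_one hp hQ M h6)
    have hS1 : PowSum p M ϖ m (n + 1)
        (∑ i ∈ Finset.range (m - m / p), (c i ^ p * w ^ (-(m : ℤ) + i)) ^ p ^ n) := by
      refine PowSum.sum hp hϖM hpQ _ fun i hi => ?_
      rw [mul_pow, hzpow, ← pow_mul, ← pow_succ']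
      have : i < m := (Finset.mem_range.1 hi).trans_le (Nat.sub_le _ _)
      exact PowSum.monomial hp hϖM (hc i) (hc1 i) (by omega) (by omega)
    have hS2 : PowSum p M ϖ m (n + 1)
        (∑ i ∈ Finset.range (m / p), (b i * w ^ (-((m / p : ℕ) : ℤ) + i)) ^ p ^ n) := by
      refine PowSum.sum hp hϖM hpQ _ fun i hi => ?_
      rw [mul_pow, hzpow]
      have hi' := Finset.mem_range.1 hi
      have hmp : ((m / p : ℕ) : ℤ) * p ≤ m := by exact_mod_cast Nat.div_mul_le_self m p
      have hbn : ‖b i ^ p ^ n‖ ≤ 1 := by rw [norm_pow]; exact pow_le_one₀ (norm_nonneg _) (hb1 i)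
      have hp0 : (0 : ℤ) < p := by exact_mod_cast hp.pos
      have hyQ : ‖b i ^ p ^ n * ϖ ^ (-((m / p : ℕ) : ℤ) + i)‖ ^ p ≤ Q := by
        have h8 := norm_mul_zpow_le hϖM.pos hϖM.lt_one hbn
          (show -((m / p : ℕ) : ℤ) ≤ -((m / p : ℕ) : ℤ) + i by omega)
        refine (pow_le_pow_left₀ (norm_nonneg _) h8 p).trans ?_
        rw [← zpow_natCast, ← zpow_mul]
        refine (zpow_le_zpow_iff_right_of_lt_one₀ hϖM.pos hϖM.lt_one).2 ?_
        linarith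
      -- A low order term y may be traded for y^p, since y - y^p is trivial. This raises the power
      -- on its coefficient by one without any expansion.
      have h9 := (ASTrivial.pow_sub_self (p := p) (Q := Q) (M := M)
        (mul_mem (pow_mem (hb i) _) (zpow_mem hϖM.mem _)) hyQ).neg hp hpQ
      rw [neg_sub] at h9
      refine PowSum.of_trivial_sub hp hpQ h9 ?_
      rw [mul_pow, ← pow_mul, ← pow_succ, ← zpow_natCast (ϖ ^ _) p, ← zpow_mul]
      refine PowSum.monomial hp hϖM (hb i) (hb1 i) ?_ ?_
      · nlinarith
      · exact mul_neg_of_neg_of_pos (by omega) hp0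
    refine PowSum.of_trivial hp hpQ h7 ((congrArg (PowSum p M ϖ m (n + 1)) ?_).mpr
      (hS1.add hp hϖM hpQ hS2))
    rw [show X + Y + (x - X - Y) = x by ring]
    ring
  · right
    have hmk : m < p * (m - k) := by
      have h1 : k + m / p < m := Nat.lt_sub_iff_add_lt.1 hk
      have h2 := Nat.lt_div_mul_add hp.pos (a := m)
      have h3 : m / p + 1 ≤ m - k := Nat.le_sub_of_add_le (by omega)
      calc m < m / p * p + p := h2
        _ = p * (m / p + 1) := by ring
        _ ≤ p * (m - k) := Nat.mul_le_mul_left p h3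
    have hkm : k < m := hk.trans_le (Nat.sub_le _ _)
    -- This is a p-th root, up to an integral error, of the part already expanded. As s^p - s is
    -- trivial, that part may be replaced by s, whose pole is too small to matter.
    set s := ∑ i ∈ Finset.range k, c i * w' ^ (-(m : ℤ) + i) with hs
    have hsle : ‖s‖ ≤ ‖w'‖ ^ (-(m : ℤ)) := norm_sum_le_of_forall_le (zpow_pos hU'.pos _).le
      fun i _ => norm_mul_zpow_le hU'.pos hU'.lt_one (hc1 i) (by omega)
    have hsM : s ∈ M ⊔ K⟮w'⟯ := sum_mem fun i _ =>
      mul_mem ((le_sup_left : M ≤ M ⊔ K⟮w'⟯) (hc i)) (zpow_mem hU'.mem _)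
    have hw'w : (‖w'‖ ^ (-(m : ℤ))) ^ p = ‖w‖ ^ (-(m : ℤ)) := by
      rw [hwdef, norm_pow, ← zpow_natCast, ← zpow_natCast, zpow_comm]
    have hsQ : ‖s‖ ^ p ≤ Q :=
      (pow_le_pow_left₀ (norm_nonneg _) hsle p).trans (hw'w.le.trans hnorm)
    have hs1 : ‖s ^ p - ∑ i ∈ Finset.range k, c i ^ p * w ^ (-(m : ℤ) + i)‖ ≤ 1 := by
      have := (norm_sum_pow_prime_sub_le hp (Finset.range k)
        (f := fun i => c i * w' ^ (-(m : ℤ) + i)) (B := Q) (by positivity) fun i _ =>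
          (pow_le_pow_left₀ (norm_nonneg _) (norm_mul_zpow_le hU'.pos hU'.lt_one (hc1 i)
            (by omega)) p).trans (hw'w.le.trans hnorm)).trans hpQ
      have e : ∀ i : ℕ, c i ^ p * w ^ (-(m : ℤ) + i) = (c i * w' ^ (-(m : ℤ) + i)) ^ p := by
        intro i
        rw [mul_pow, hwdef, ← zpow_natCast w', ← zpow_natCast (w' ^ _) p, zpow_comm]
      simpa only [e] using this
    -- Over M(w) the element x itself is available, so x^(p^n) may be lowered to x.
    have hxpow : ASTrivial p Q (M ⊔ K⟮w⟯) (x ^ p ^ n - x) := by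
      refine ASTrivial.pow_pow_sub_self hp hQ hpQ hxM n ?_
      refine (pow_le_pow_left₀ (norm_nonneg _) hxle _).trans ?_
      rw [hQdef, ← hw, norm_pow, ← zpow_natCast, ← zpow_natCast, zpow_comm]
    refine Eliminable.of_totallyRamified hle he (hϖ.degOver_root_le hpn1 hw')
      (hϖ.root_norm_ne hw') (ASType.sameValues_of_not_pow hp hQ hpQ (ht.mono le_sup_left)
        (g := w' ^ (m - k)) (u := u) (r := s) (pow_mem hU'.mem _) (pow_ne_zero _ hU'.ne_zero)
        (by rw [norm_pow]; exact pow_lt_one₀ hU'.pos.le hU'.lt_one (by omega))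
        (hMM' hu) hu1 ?_ ?_ ?_)
    -- Adjoining w' creates no new residue classes, so u does not become a p-th power.
    · intro e he' he1
      by_contra! hlt
      obtain ⟨e', he'M, he'1, hee⟩ := exists_norm_sub_lt_one_of_totallyRamified
        (hϖM.degOver_root_le hpn1 hw') (hϖM.root_norm_ne hw') he' he1
      refine absurd (hupow e' ((le_sup_left : M ≤ M ⊔ K⟮w⟯) he'M) he'1) (not_le.2 ?_)
      have h1 : ‖e ^ p - e' ^ p‖ < 1 := by
        have h2 := norm_sub_pow_prime_sub_le hp (x := e) (y := e') (B := 1)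
          (pow_le_one₀ (norm_nonneg _) he1) (pow_le_one₀ (norm_nonneg _) he'1)
        have h3 : ‖(e - e') ^ p‖ < 1 := by
          rw [norm_pow]; exact pow_lt_one₀ (norm_nonneg _) hee hp.ne_zero
        have h4 := norm_sub_lt_of_lt_of_lt h3 (h2.trans_lt (by rwa [mul_one]))
        rwa [sub_sub_cancel] at h4
      have := norm_add_lt_of_lt_of_lt hlt h1
      rwa [sub_add_sub_cancel] at this
    · rw [norm_pow, ← pow_mul]
      refine (mul_le_mul_of_nonneg_right hsle (by positivity)).trans_lt ?_
      rw [← zpow_natCast, ← zpow_add₀ hU'.pos.ne']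
      have h1 : (m : ℤ) < ((m - k) * p : ℕ) := by rw [mul_comm]; exact_mod_cast hmk
      obtain ⟨e, he⟩ : ∃ e : ℕ, -(m : ℤ) + ((m - k) * p : ℕ) = (e + 1 : ℕ) :=
        ⟨(-(m : ℤ) + ((m - k) * p : ℕ) - 1).toNat, by omega⟩
      rw [he, zpow_natCast]
      exact pow_lt_one₀ hU'.pos.le hU'.lt_one (Nat.succ_ne_zero e)
    · have h1 := (hzx.mono (le_sup_left : M ≤ M ⊔ K⟮w'⟯)).add hp hpQ (hxpow.mono hMM')
      have h2 := (h1.add hp hpQ (ASTrivial.pow_sub_self hsM hsQ)).sub hp hpQ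
        (ASTrivial.of_norm_le_one hp hQ _ hs1)
      convert h2 using 1
      have h3 : u / (w' ^ (m - k)) ^ p = u * w ^ (-(m : ℤ) + k) := by
        have : (-(m : ℤ) + k) = -((m - k : ℕ) : ℤ) := by push_cast [Nat.cast_sub hkm.le]; ring
        rw [this, zpow_neg, zpow_natCast, hwdef, ← pow_mul, ← pow_mul, mul_comm, div_eq_mul_inv]
      rw [h3, ← huk]
      ring

end Elimination

/-! ### The Artin–Schreier step, by induction on the order of the pole. -/

section Elimination

set_option linter.unusedSectionVars false

variable {K A : Type*} [Field K] [NormedField A] [IsUltrametricDist A] [Algebra K A]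
  [Algebra.IsAlgebraic K A] [IsAlgClosed A] {p : ℕ}

/-- If large `p`-powers of residues of `M` are residues of `K₀`, a polar part with large `p`-powers
as coefficients is congruent to an element of `K₀`. -/
theorem PowSum.exists_mem (hp : p.Prime) {K₀ M : IntermediateField K A} (hle : K₀ ≤ M)
    (he : SameValues M K₀) {ϖ : A} (hϖ : IsUnif K₀ ϖ) {m h : ℕ}
    (hpQ : ‖(p : A)‖ * ‖ϖ‖ ^ (-(m : ℤ)) ≤ 1) (hres : ∀ x ∈ resid M, x ^ p ^ h ∈ resid K₀) {z : A}
    (hz : PowSum p M ϖ m (h + m) z) :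
    ∃ κ ∈ K₀, ‖κ‖ ≤ ‖ϖ‖ ^ (-(m : ℤ)) ∧ ASTrivial p (‖ϖ‖ ^ (-(m : ℤ))) M (z - κ) := by
  have hϖM : IsUnif M ϖ := hϖ.of_sameValues hle he
  obtain ⟨d, hd, hd1, hzd⟩ := hz
  have hdh : ∀ i, ‖d i ^ p ^ h‖ ≤ 1 := fun i => by
    rw [norm_pow]; exact pow_le_one₀ (norm_nonneg _) (hd1 i)
  -- The exponent h brings the residue classes of the coefficients down to `K₀`; discreteness turns
  -- congruence into divisibility by ϖ.
  have hf : ∀ i, ∃ f ∈ K₀, ‖f‖ ≤ 1 ∧ ‖d i ^ p ^ h - f‖ ≤ ‖ϖ‖ := by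
    intro i
    have h1 := hres _ (res_mem_resid (hd i) (hd1 i))
    rw [← res_pow (hd1 i)] at h1
    obtain ⟨f, hf, hf1, hfr⟩ := mem_resid.1 h1
    refine ⟨f, hf, hf1, ?_⟩
    have h2 := (res_eq_iff (hdh i) hf1).1 hfr.symm
    have := hϖM.norm_le_of_lt (a := 0) (sub_mem (pow_mem (hd i) _) (hle hf)) (by simpa using h2)
    simpa using this
  choose f hfK hf1 hdf using hf
  refine ⟨∑ i ∈ Finset.range m, f i ^ p ^ m * ϖ ^ (-(m : ℤ) + i),
    sum_mem fun i _ => mul_mem (pow_mem (hfK i) _) (zpow_mem hϖ.mem _),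
    norm_sum_le_of_forall_le (zpow_pos hϖ.pos _).le fun i _ => norm_mul_zpow_le hϖ.pos hϖ.lt_one
      (by rw [norm_pow]; exact pow_le_one₀ (norm_nonneg _) (hf1 i)) (by omega), ?_⟩
  have hQpos : 0 < ‖ϖ‖ ^ (-(m : ℤ)) := zpow_pos hϖ.pos _
  -- A further p^m-th power improves divisibility by ϖ to divisibility by ϖ^m, because m < p^m, up
  -- to a multiple of p. Either suffices against a pole of order m.
  have key : ∀ i, ‖d i ^ p ^ (h + m) - f i ^ p ^ m‖ * ‖ϖ‖ ^ (-(m : ℤ)) ≤ 1 := by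
    intro i
    have h1 := norm_add_pow_prime_pow_sub_le hp (hf1 i) ((hdf i).trans hϖ.lt_one.le) m
    rw [add_sub_cancel, ← pow_mul, ← pow_add] at h1
    have h2 : ‖(d i ^ p ^ h - f i) ^ p ^ m‖ ≤ ‖ϖ‖ ^ m := by
      rw [norm_pow]
      refine (pow_le_pow_left₀ (norm_nonneg _) (hdf i) _).trans ?_
      exact pow_le_pow_of_le_one hϖ.pos.le hϖ.lt_one.le (Nat.lt_pow_self hp.one_lt).le
    have h3 : ‖ϖ‖ ^ m * ‖ϖ‖ ^ (-(m : ℤ)) = 1 := by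
      rw [← zpow_natCast, ← zpow_add₀ hϖ.pos.ne', add_neg_cancel, zpow_zero]
    have h4 : ‖d i ^ p ^ (h + m) - f i ^ p ^ m‖ ≤ max ‖(p : A)‖ (‖ϖ‖ ^ m) := by
      have := norm_add_le_of_le_of_le (h1.trans (le_max_left _ (‖ϖ‖ ^ m)))
        (h2.trans (le_max_right ‖(p : A)‖ _))
      convert this using 2
      ring
    refine (mul_le_mul_of_nonneg_right h4 hQpos.le).trans ?_
    rcases max_choice ‖(p : A)‖ (‖ϖ‖ ^ m) with h5 | h5 <;> rw [h5]
    · exact hpQ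
    · exact h3.le
  have hsum : ‖∑ i ∈ Finset.range m, (d i ^ p ^ (h + m) - f i ^ p ^ m) * ϖ ^ (-(m : ℤ) + i)‖ ≤ 1 := by
    refine norm_sum_le_of_forall_le zero_le_one fun i _ => ?_
    rw [norm_mul, norm_zpow]
    refine le_trans (mul_le_mul_of_nonneg_left ?_ (norm_nonneg _)) (key i)
    exact (zpow_le_zpow_iff_right_of_lt_one₀ hϖ.pos hϖ.lt_one).2 (by omega)
  have := hzd.add hp hpQ (ASTrivial.of_norm_le_one hp (one_le_zpow_neg hϖ m) M hsum)
  convert this using 1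
  simp only [sub_mul, Finset.sum_sub_distrib]
  ring

/-- The pole drops when z is not of exact order m, or when p divides m and the leading coefficient
is a p-th power modulo the maximal ideal. If p divides m and it is no p-th power, the step is
fierce. If p does not divide m, z is moved into `K₀`, which is where the hypothesis `hres` on purely
inseparable residues enters. -/
theorem ASType.eliminable (hinv : ∀ (σ : A ≃ₐ[K] A) (x : A), ‖σ x‖ = ‖x‖) (hp : p.Prime)
    (hpA : ‖(p : A)‖ < 1) {K₀ M : IntermediateField K A} [FiniteDimensional K K₀] (hle : K₀ ≤ M)
    (he : SameValues M K₀) {ϖ : A} (hϖ : IsUnif K₀ ϖ) {h : ℕ}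
    (hres : ∀ x ∈ resid M, x ^ p ^ h ∈ resid K₀) (m : ℕ)
    (hpQ : ‖(p : A)‖ * ‖ϖ‖ ^ (-(m : ℤ)) ≤ 1) {t z : A}
    (ht : ASType p (‖ϖ‖ ^ (-(m : ℤ))) M t z) : Eliminable K₀ (M ⊔ K⟮t⟯) := by
  induction m using Nat.strong_induction_on generalizing t z with
  | _ m ih =>
  have hϖM : IsUnif M ϖ := hϖ.of_sameValues hle he
  set Q := ‖ϖ‖ ^ (-(m : ℤ)) with hQdef
  have hQ : 1 ≤ Q := one_le_zpow_neg hϖM m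
  have hself : SameValues (M ⊔ K⟮t⟯) M → Eliminable K₀ (M ⊔ K⟮t⟯) := fun h =>
    Eliminable.of_sameValues (hle.trans le_sup_left) (h.trans he)
  have hlower : ∀ s ∈ M, ‖s‖ ^ p ≤ Q → ∀ m' < m, ‖z - (s ^ p - s)‖ ≤ ‖ϖ‖ ^ (-(m' : ℤ)) →
      Eliminable K₀ (M ⊔ K⟮t⟯) := by
    intro s hs hsQ m' hm' hz'
    have hQ' : ‖ϖ‖ ^ (-(m' : ℤ)) ≤ Q :=
      (zpow_le_zpow_iff_right_of_lt_one₀ hϖ.pos hϖ.lt_one).2 (by omega)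
    have hzM : z - (s ^ p - s) ∈ M := sub_mem ht.mem (sub_mem (pow_mem hs p) hs)
    have h1 := ht.translate hp hQ hpQ hs hsQ hzM (hz'.trans hQ') (by simp)
    have hadj := sup_adjoin_affine (M := M) t (one_mem M) one_ne_zero hs
    rw [one_mul] at hadj
    rw [← hadj]
    exact ih m' hm' ((mul_le_mul_of_nonneg_left hQ' (norm_nonneg _)).trans hpQ)
      ⟨h1.mem, h1.deg, h1.sep, h1.conj, h1.eqn, hz'⟩
  rcases Nat.eq_zero_or_pos m with rfl | hm
  · refine hself (ht.sameValues_of_trivial hinv hp hQ hpQ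
      (ASTrivial.of_norm_le_one hp hQ M (ht.le.trans ?_)))
    simp [hQdef]
  rcases ht.le.lt_or_eq with hlt | hzQ
  · refine hlower 0 (zero_mem M) (by simp [hp.ne_zero]; linarith) (m - 1) (by omega) ?_
    have := hϖM.norm_le_of_lt ht.mem hlt
    simp only [ne_eq, hp.ne_zero, not_false_eq_true, zero_pow, sub_zero]
    convert this using 2
    push_cast [Nat.cast_sub hm]
    ring
  by_cases hpm : p ∣ m
  · obtain ⟨l, rfl⟩ := hpm
    have hl : l ≠ 0 := by rintro rfl; simp at hm
    have hgp : (ϖ ^ l) ^ p = ϖ ^ (p * l) := by rw [← pow_mul, mul_comm]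
    have hϖm : ‖ϖ ^ (p * l)‖ * Q = 1 := by
      rw [norm_pow, hQdef, ← zpow_natCast, ← zpow_add₀ hϖ.pos.ne', add_neg_cancel, zpow_zero]
    have hu1 : ‖z * ϖ ^ (p * l)‖ = 1 := by rw [norm_mul, hzQ, mul_comm, hϖm]
    by_cases hpow : ∀ c ∈ M, ‖c‖ ≤ 1 → 1 ≤ ‖z * ϖ ^ (p * l) - c ^ p‖
    · refine hself (ht.sameValues_of_not_pow hp hQ hpQ (g := ϖ ^ l) (u := z * ϖ ^ (p * l)) (r := 0)
        (pow_mem hϖM.mem _) (pow_ne_zero _ hϖ.ne_zero)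
        (by rw [norm_pow]; exact pow_lt_one₀ hϖ.pos.le hϖ.lt_one hl)
        (mul_mem ht.mem (pow_mem hϖM.mem _)) hu1.le hpow (by simp) ?_)
      rw [hgp, mul_div_cancel_right₀ _ (pow_ne_zero _ hϖ.ne_zero), add_zero, sub_self]
      exact ASTrivial.of_norm_le_one hp hQ M (by simp)
    · push Not at hpow
      obtain ⟨c, hc, hc1, hlt⟩ := hpow
      have hpl : 0 < ‖ϖ‖ ^ l := pow_pos hϖ.pos l
      set s := c / ϖ ^ l with hs
      have hsM : s ∈ M := div_mem hc (pow_mem hϖM.mem _)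
      have hsQ : ‖s‖ ^ p ≤ Q := by
        rw [← norm_pow, hs, div_pow, hgp, norm_div, div_le_iff₀ (by rw [norm_pow]; exact pow_pos hϖ.pos _),
          mul_comm, hϖm, norm_pow]
        exact pow_le_one₀ (norm_nonneg _) hc1
      have hQ1 : 1 < Q := by
        rw [hQdef, zpow_neg, zpow_natCast]
        exact (one_lt_inv₀ (pow_pos hϖ.pos _)).2 (pow_lt_one₀ hϖ.pos.le hϖ.lt_one (by omega))
      have hs' : ‖s‖ < Q := by
        rcases le_or_gt ‖s‖ 1 with h1 | h1
        · exact h1.trans_lt hQ1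
        · exact (lt_self_pow₀ h1 hp.one_lt).trans_le hsQ
      -- Subtracting s^p cancels the leading term; the extra s contributes only a smaller pole.
      have hzs : ‖z - s ^ p‖ < Q := by
        have e : z - s ^ p = (z * ϖ ^ (p * l) - c ^ p) / ϖ ^ (p * l) := by
          rw [hs, div_pow, hgp, sub_div, mul_div_cancel_right₀ _ (pow_ne_zero _ hϖ.ne_zero)]
        rw [e, norm_div, div_lt_iff₀ (by rw [norm_pow]; exact pow_pos hϖ.pos _), mul_comm Q, hϖm]
        exact hlt
      have hz' : ‖z - (s ^ p - s)‖ < Q := by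
        rw [← sub_add]
        exact norm_add_lt_of_lt_of_lt hzs hs'
      refine hlower s hsM hsQ (p * l - 1) (by omega) ?_
      have := hϖM.norm_le_of_lt (sub_mem ht.mem (sub_mem (pow_mem hsM p) hsM)) hz'
      convert this using 2
      push_cast [Nat.cast_sub (show 1 ≤ p * l from hm)]
      ring
  · have hall : Eliminable K₀ (M ⊔ K⟮t⟯) ∨ ∀ n, PowSum p M ϖ m n z := by
      by_contra! hcon
      obtain ⟨hcon, n, hn⟩ := hcon
      have : ∀ n, PowSum p M ϖ m n z := by
        intro n
        induction n with
        | zero => exact PowSum.of_norm_le hp hϖM ht.mem ht.le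
        | succ n ihn =>
          exact (PowSum.succ_or_eliminable hp hpA hle he hϖ hpQ ht ihn).resolve_right hcon
      exact hn (this n)
    rcases hall with hall | hall
    · exact hall
    obtain ⟨κ, hκ, hκQ, hzκ⟩ := PowSum.exists_mem hp hle he hϖ hpQ hres (hall (h + m))
    have hQ1 : 1 < Q := by
      rw [hQdef, zpow_neg, zpow_natCast]
      exact (one_lt_inv₀ (pow_pos hϖ.pos _)).2 (pow_lt_one₀ hϖ.pos.le hϖ.lt_one hm.ne')
    -- As m is prime to p, no fraction mk/p with 0 < k < p is the valuation of an element of `M`.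
    have hnodvd : ∀ x ∈ M, ∀ k, 0 < k → k < p → ‖x‖ ^ p ≠ Q ^ k := by
      intro x hx k hk0 hkp hxk
      have hx0 : x ≠ 0 := by
        rintro rfl
        rw [norm_zero, zero_pow hp.ne_zero] at hxk
        exact (pow_pos (zero_lt_one.trans hQ1) k).ne hxk
      obtain ⟨j, hj⟩ := hϖM.exists_zpow x hx hx0
      rw [hj, hQdef, ← zpow_natCast, ← zpow_natCast, ← zpow_mul, ← zpow_mul] at hxk
      have h1 := zpow_right_injective₀ hϖ.pos hϖ.lt_one.ne hxk
      have h2 : (p : ℤ) ∣ (m * k : ℕ) := ⟨-j, by push_cast; linarith⟩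
      rcases (Nat.Prime.dvd_mul hp).1 (by exact_mod_cast h2) with h3 | h3
      · exact hpm h3
      · exact absurd (Nat.le_of_dvd hk0 h3) (not_le.2 hkp)
    -- Otherwise s^p - s would have the norm Q of z, so ‖s‖^p = Q, which `hnodvd` excludes with k =
    -- 1.
    have hκQ' : ‖κ‖ = Q := by
      refine le_antisymm hκQ (not_lt.1 fun hlt => ?_)
      obtain ⟨s, hs, hsQ, hs1⟩ := hzκ
      have hsp : ‖s ^ p - s‖ = Q := by
        have h1 : ‖z - (s ^ p - s)‖ < Q := by
          have := norm_add_lt_of_lt_of_lt (hs1.trans_lt hQ1) hlt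
          convert this using 2
          ring
        rw [← hzQ]
        exact (norm_eq_of_norm_sub_lt_left (by rwa [hzQ])).symm
      have hs2 : 1 < ‖s‖ := by
        by_contra! h1
        have : ‖s ^ p - s‖ ≤ 1 := norm_sub_le_of_le_of_le
          (by rw [norm_pow]; exact pow_le_one₀ (norm_nonneg _) h1) h1
        linarith
      have h3 : ‖s‖ ^ p = Q := by
        rw [← hsp, ← norm_pow]
        refine norm_eq_of_norm_sub_lt_left ?_
        rw [sub_sub_cancel, norm_pow]
        exact lt_self_pow₀ hs2 hp.one_lt
      exact hnodvd s hs 1 one_pos hp.one_lt (by rw [pow_one]; exact h3)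
    -- With ‖τ‖^p = Q, the element τ is totally ramified over `K₀`, and κ = τ^p - τ becomes trivial
    -- over M(τ).
    obtain ⟨τ, hτ⟩ : ∃ τ : A, τ ^ p - τ = κ := by
      obtain ⟨τ, hτ⟩ := IsAlgClosed.exists_root (X ^ p - X - C κ : A[X]) (by
        rw [degree_sub_C] <;> rw [degree_sub_eq_left_of_degree_lt] <;>
          simp only [degree_X_pow, degree_X] <;> exact_mod_cast (by have := hp.one_lt; omega))
      refine ⟨τ, ?_⟩
      simpa [sub_eq_zero] using hτ
    have hτQ : ‖τ‖ ^ p ≤ Q := norm_pow_le_of_eqn hp hQ (t := τ) (z := κ) (by simp [hτ]) hκQ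
    have hτ1 : 1 < ‖τ‖ := by
      by_contra! h1
      have : ‖τ ^ p - τ‖ ≤ 1 := norm_sub_le_of_le_of_le
        (by rw [norm_pow]; exact pow_le_one₀ (norm_nonneg _) h1) h1
      rw [hτ, hκQ'] at this
      linarith
    have hτp : ‖τ‖ ^ p = Q := by
      rw [← hκQ', ← hτ, ← norm_pow]
      refine norm_eq_of_norm_sub_lt_left ?_
      rw [sub_sub_cancel, norm_pow]
      exact lt_self_pow₀ hτ1 hp.one_lt
    have hτdeg : degOver K₀ τ ≤ p := by
      have hq : (X ^ p - (X + C ⟨κ, hκ⟩) : K₀[X]).Monic :=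
        monic_X_pow_sub ((degree_X_add_C _).trans_lt (by exact_mod_cast hp.one_lt))
      have := degOver_le_of_monic (M := K₀) (t := τ) hq (by
        rw [map_sub, map_pow, map_add, aeval_X, aeval_C]
        change τ ^ p - (τ + κ) = 0
        rw [← hτ]; ring)
      refine this.trans (le_of_eq ?_)
      rw [natDegree_sub_eq_left_of_natDegree_lt] <;> rw [natDegree_X_pow]
      rw [natDegree_X_add_C]
      exact hp.one_lt
    refine Eliminable.of_totallyRamified hle he hτdeg (fun k hk0 hkp x hx hxk => ?_)
      ((ht.mono le_sup_left).sameValues_of_trivial hinv hp hQ hpQ ?_)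
    · refine hnodvd x (hle hx) k hk0 hkp ?_
      rw [hxk, ← hτp, ← pow_mul, ← pow_mul, mul_comm]
    · have h1 := (hzκ.mono (le_sup_left : M ≤ M ⊔ K⟮τ⟯)).add hp hpQ
        (ASTrivial.pow_sub_self (subset_sup_adjoin M τ) hτQ)
      rwa [hτ, sub_add_cancel] at h1

end Elimination

/-! ### Reduction to purely inseparable residues, and the case of characteristic p. -/

section UnramifiedReduction

set_option linter.unusedSectionVars false

variable {K A : Type*} [Field K] [NormedField A] [IsUltrametricDist A] [Algebra K A]
  [Algebra.IsAlgebraic K A] [IsAlgClosed A] {p : ℕ}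

theorem finiteDimensional_of_le {M N : IntermediateField K A} [FiniteDimensional K N] (h : M ≤ N) :
    FiniteDimensional K M :=
  FiniteDimensional.of_injective (inclusion h).toLinearMap (inclusion h).injective

/-- Enlarging the base to the maximal residually separable subfield K₁ of `M` supplies the exponent
h. Discreteness turns the norm of z into a pole order m, so the original `Q` plays no role. -/
theorem ASType.eliminable_of_finiteDimensional
    (hinv : ∀ (σ : A ≃ₐ[K] A) (x : A), ‖σ x‖ = ‖x‖) (hp : p.Prime)
    (hpA : ‖(p : A)‖ < 1) {K₀ M : IntermediateField K A} [FiniteDimensional K M] (hle : K₀ ≤ M)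
    (he : SameValues M K₀) {ϖ : A} (hϖ : IsUnif K₀ ϖ) {Q : ℝ} {t z : A}
    (hpz : ‖(p : A)‖ * ‖z‖ ≤ 1) (ht : ASType p Q M t z) : Eliminable K₀ (M ⊔ K⟮t⟯) := by
  obtain ⟨K₁, h01, h1M, hsep, hmax⟩ := exists_maximal_resSeparable hinv hle
  obtain ⟨h, hres⟩ := exists_pow_mem_resid hp hpA hmax
  have : FiniteDimensional K K₁ := finiteDimensional_of_le h1M
  have he1 : SameValues M K₁ := fun x hx => by
    obtain ⟨y, hy, hxy⟩ := he x hx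
    exact ⟨y, h01 hy, hxy⟩
  have hϖ1 : IsUnif K₁ ϖ := hϖ.of_sameValues h01 fun x hx => he x (h1M hx)
  have hϖM : IsUnif M ϖ := hϖ.of_sameValues hle he
  have hm : ∃ m : ℕ, ‖z‖ ≤ ‖ϖ‖ ^ (-(m : ℤ)) ∧ ‖(p : A)‖ * ‖ϖ‖ ^ (-(m : ℤ)) ≤ 1 := by
    rcases le_or_gt ‖z‖ 1 with h1 | h1
    · exact ⟨0, by simpa using h1, by simpa using hpA.le⟩
    · obtain ⟨j, hj⟩ := hϖM.exists_zpow z ht.mem (norm_pos_iff.1 (zero_lt_one.trans h1))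
      have hj0 : j < 0 := by
        rw [hj] at h1
        exact (one_lt_zpow_iff_right_of_lt_one₀ hϖ.pos hϖ.lt_one).1 h1
      have e : -(j.natAbs : ℤ) = j := by omega
      exact ⟨j.natAbs, by rw [e, hj], by rwa [e, ← hj]⟩
  obtain ⟨m, hzm, hpm⟩ := hm
  refine Eliminable.trans h01 hsep ?_
  rw [sup_eq_left.2 (h1M.trans le_sup_left)]
  exact ASType.eliminable hinv hp hpA h1M he1 hϖ1 hres m hpm
    ⟨ht.mem, ht.deg, ht.sep, ht.conj, ht.eqn, hzm⟩

theorem monic_X_pow_sub_X_sub_C {R : Type*} [CommRing R] [Nontrivial R] (hp : p.Prime) (a : R) :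
    (X ^ p - X - C a : R[X]).Monic ∧ (X ^ p - X - C a : R[X]).natDegree = p := by
  have h1 : (X ^ p - X - C a : R[X]) = X ^ p - (X + C a) := by ring
  rw [h1]
  have h2 : (X + C a : R[X]).degree < p :=
    (degree_X_add_C _).trans_lt (by exact_mod_cast hp.one_lt)
  refine ⟨monic_X_pow_sub h2, ?_⟩
  rw [natDegree_sub_eq_left_of_natDegree_lt] <;> rw [natDegree_X_pow]
  rw [natDegree_X_add_C]
  exact hp.one_lt

/-- Frobenius is exactly additive, and a nonzero difference of conjugates satisfies d^p = d, hence
has norm 1. -/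
theorem eliminable_of_artinSchreier (hinv : ∀ (σ : A ≃ₐ[K] A) (x : A), ‖σ x‖ = ‖x‖) (hp : p.Prime)
    (hp0 : (p : A) = 0) {K₀ M : IntermediateField K A} [FiniteDimensional K M] (hle : K₀ ≤ M)
    (he : SameValues M K₀) {ϖ : A} (hϖ : IsUnif K₀ ϖ) {t : A}
    (ht : t ^ p - t ∈ M) : Eliminable K₀ (M ⊔ K⟮t⟯) := by
  have hchar : CharP A p := (CharP.charP_iff_prime_eq_zero hp).2 hp0
  have hroot : aeval t (X ^ p - X - C ⟨t ^ p - t, ht⟩ : M[X]) = 0 := by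
    simp only [map_sub, map_pow, aeval_X, aeval_C]
    exact sub_self _
  refine ASType.eliminable_of_finiteDimensional hinv hp (by simp) hle he hϖ
    (Q := ‖t ^ p - t‖) (t := t) (z := t ^ p - t) (by simp)
    ⟨ht, ?_, ?_, fun σ hσ => ?_, by simp, le_rfl⟩
  · exact (degOver_le_of_monic (monic_X_pow_sub_X_sub_C hp _).1 hroot).trans_eq
      (monic_X_pow_sub_X_sub_C hp _).2
  · refine isSeparable_of_aeval_derivative_ne_zero hroot ?_
    simp [derivative_X_pow]
  · have h1 : (σ t - t) ^ p = σ t - t := by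
      have := hσ _ ht
      have : Fact p.Prime := ⟨hp⟩
      rw [sub_pow_char]
      simp only [map_sub, map_pow] at *
      linear_combination this
    by_cases h2 : σ t - t = 0
    · exact Or.inl (sub_eq_zero.1 h2)
    · right
      have h3 : (σ t - t) ^ (p - 1) = 1 := by
        apply mul_right_cancel₀ h2
        rw [pow_sub_one_mul hp.ne_zero, h1, one_mul]
      have h4 : ‖σ t - t‖ ^ (p - 1) = 1 := by rw [← norm_pow, h3, norm_one]
      have := hp.one_lt
      exact ((pow_eq_one_iff_of_nonneg (norm_nonneg _) (by omega)).1 h4).ge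

end UnramifiedReduction

/-! ### Kummer steps, reduced to Artin–Schreier type. -/

section Kummer

set_option linter.unusedSectionVars false

variable {K A : Type*} [Field K] [NormedField A] [IsUltrametricDist A] [Algebra K A]
  [Algebra.IsAlgebraic K A] [IsAlgClosed A] {p : ℕ}

/-- The linear term has to be isolated: with e = λt it becomes the -t of the Artin–Schreier
equation, while the remaining terms are negligible. -/
theorem exists_one_add_pow_prime_eq {R : Type*} [CommRing R] (hp : p.Prime) (e : R) :
    ∃ r, (1 + e) ^ p = 1 + p * e + e ^ p + p * e ^ 2 * r := by
  have h1 : Finset.Ioo 0 p = insert 1 (Finset.Ioo 1 p) := by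
    ext k
    have := hp.one_lt
    simp only [Finset.mem_Ioo, Finset.mem_insert]
    omega
  have h2 : e ∣ ∑ k ∈ Finset.Ioo 1 p,
      e ^ (k - 1) * 1 ^ (p - k - 1) * ((p.choose k / p : ℕ) : R) := by
    refine Finset.dvd_sum fun k hk => ?_
    rw [mul_assoc]
    have := (Finset.mem_Ioo.1 hk).1
    exact Dvd.dvd.mul_right (dvd_pow_self e (by omega)) _
  obtain ⟨r, hr⟩ := h2
  refine ⟨r, ?_⟩
  rw [add_comm 1 e, add_pow_prime_eq hp, h1, Finset.sum_insert (by simp), hr]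
  simp only [one_pow, mul_one, Nat.choose_one_right, Nat.div_self hp.pos, Nat.cast_one,
    Nat.sub_self, pow_zero]
  ring

theorem exists_norm_le_one_one_add_pow_prime_eq (hp : p.Prime) {e : A} (he : ‖e‖ ≤ 1) :
    ∃ r : A, ‖r‖ ≤ 1 ∧ (1 + e) ^ p = 1 + p * e + e ^ p + p * e ^ 2 * r := by
  obtain ⟨r, hr⟩ := exists_one_add_pow_prime_eq hp (⟨e, mem_unitBall.2 he⟩ : unitBall A)
  exact ⟨r, mem_unitBall.1 r.2, by simpa using congrArg Subtype.val hr⟩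

/-- Distinct `p`-th roots of unity are not closer to each other than `λ`, `λ ^ (p - 1) = -p`. -/
theorem norm_le_norm_sub_one_of_pow_prime_eq_one (hp : p.Prime) (hpA : ‖(p : A)‖ < 1)
    {l v : A} (hl : l ^ (p - 1) = -p) (hv : v ^ p = 1) (hv1 : v ≠ 1) :
    ‖l‖ ≤ ‖v - 1‖ := by
  by_contra! hlt
  have hp1 : p - 1 ≠ 0 := by have := hp.one_lt; omega
  have hln : ‖l‖ ^ (p - 1) = ‖(p : A)‖ := by rw [← norm_pow, hl, norm_neg]
  have hl1 : ‖l‖ < 1 := by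
    rw [← pow_lt_one_iff_of_nonneg (norm_nonneg _) hp1, hln]; exact hpA
  set e := v - 1 with he
  have he0 : e ≠ 0 := sub_ne_zero.2 hv1
  obtain ⟨r, hr1, hr⟩ := exists_norm_le_one_one_add_pow_prime_eq hp (hlt.trans hl1).le
  have h1 : e ^ (p - 1) = -(p * (1 + e * r)) := by
    apply mul_right_cancel₀ he0
    rw [pow_sub_one_mul hp.ne_zero]
    rw [he, add_sub_cancel, hv, ← he] at hr
    linear_combination -hr
  have h2 : ‖1 + e * r‖ = 1 := by
    rw [← norm_one (α := A)]
    refine norm_eq_of_norm_sub_lt ?_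
    rw [add_sub_cancel_left, norm_mul, norm_one]
    exact (mul_le_of_le_one_right (norm_nonneg _) hr1).trans_lt (hlt.trans hl1)
  have h3 : ‖e‖ ^ (p - 1) = ‖l‖ ^ (p - 1) := by
    rw [← norm_pow, h1, norm_neg, norm_mul, h2, mul_one, hln]
  exact hlt.ne ((pow_left_inj₀ (norm_nonneg _) (norm_nonneg _) hp1).1 h3)

theorem degOver_le_of_pow_mem {M : IntermediateField K A} {y : A} (hp : p ≠ 0) (hy : y ^ p ∈ M) :
    degOver M y ≤ p := by
  refine (degOver_le_of_monic (monic_X_pow_sub_C (⟨y ^ p, hy⟩ : M) hp) ?_).trans_eq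
    (natDegree_X_pow_sub_C)
  simp only [map_sub, map_pow, aeval_X, aeval_C]
  exact sub_self _

theorem isSeparable_of_pow_mem {M : IntermediateField K A} {y : A} (hp : (p : A) ≠ 0)
    (hy0 : y ≠ 0) (hy : y ^ p ∈ M) : IsSeparable M y := by
  refine isSeparable_of_aeval_derivative_ne_zero (f := X ^ p - C (⟨y ^ p, hy⟩ : M)) ?_ ?_
  · simp only [map_sub, map_pow, aeval_X, aeval_C]
    exact sub_self _
  · simp [derivative_X_pow, hp, hy0]

/-- A Kummer generator close to `1` gives rise to a generator of Artin–Schreier type. -/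
theorem ASType.of_pow_mem (hp : p.Prime) (hpA : ‖(p : A)‖ < 1) (hp0 : (p : A) ≠ 0)
    {M : IntermediateField K A} {l y : A} (hlM : l ∈ M) (hl : l ^ (p - 1) = -p) (hy : y ^ p ∈ M)
    (hy1 : ‖y ^ p - 1‖ ≤ ‖(p : A)‖) :
    ASType p ‖(y ^ p - 1) / l ^ p‖ M (l⁻¹ * (y - 1)) ((y ^ p - 1) / l ^ p) := by
  have hp1 : p - 1 ≠ 0 := by have := hp.one_lt; omega
  have hln : ‖l‖ ^ (p - 1) = ‖(p : A)‖ := by rw [← norm_pow, hl, norm_neg]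
  have hl1 : ‖l‖ < 1 := by
    rw [← pow_lt_one_iff_of_nonneg (norm_nonneg _) hp1, hln]; exact hpA
  have hl0 : l ≠ 0 := by
    rintro rfl
    rw [zero_pow hp1] at hl
    exact hp0 (neg_eq_zero.1 hl.symm)
  have hlpos : 0 < ‖l‖ := norm_pos_iff.2 hl0
  have hlp : l ^ p = -(p * l) := by
    rw [← pow_sub_one_mul hp.ne_zero, hl, neg_mul]
  have hyp : ‖y‖ ^ p = 1 := by
    rw [← norm_pow, ← norm_one (α := A)]
    exact norm_eq_of_norm_sub_lt (by rw [norm_one]; exact hy1.trans_lt hpA)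
  have hyn : ‖y‖ = 1 := (pow_eq_one_iff_of_nonneg (norm_nonneg _) hp.ne_zero).1 hyp
  have hy0 : y ≠ 0 := norm_pos_iff.1 (by rw [hyn]; exact one_pos)
  have hadj : M ⊔ K⟮l⁻¹ * (y - 1)⟯ = M ⊔ K⟮y⟯ :=
    sup_adjoin_affine y (inv_mem hlM) (inv_ne_zero hl0) (one_mem M)
  refine ⟨div_mem (_root_.sub_mem hy (one_mem M)) (pow_mem hlM p), ?_, ?_, fun σ hσ => ?_, ?_, le_rfl⟩
  · rw [degOver_eq_of_adjoin_eq hadj]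
    exact degOver_le_of_pow_mem hp.ne_zero hy
  · refine Field.isSeparable_mul ?_
      (isSeparable_sub (isSeparable_of_pow_mem hp0 hy0 hy) (one_mem M))
    exact isSeparable_algebraMap (F := M) (K := A) ⟨l⁻¹, inv_mem hlM⟩
  · by_cases h1 : σ y = y
    · left
      rw [map_mul, hσ _ (inv_mem hlM), map_sub, map_one, h1]
    · right
      have h2 := norm_le_norm_sub_one_of_pow_prime_eq_one hp hpA hl (v := σ y / y) (by
        rw [div_pow, ← map_pow, hσ _ hy, div_self (pow_ne_zero _ hy0)])
        (by rwa [Ne, div_eq_one_iff_eq hy0])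
      rw [map_mul, hσ _ (inv_mem hlM), map_sub, map_one, ← mul_sub, sub_sub_sub_cancel_right,
        norm_mul, norm_inv, ← div_eq_inv_mul, one_le_div hlpos]
      rwa [div_sub_one hy0, norm_div, hyn, div_one] at h2
  · set t := l⁻¹ * (y - 1) with ht
    have hlt : l * t = y - 1 := by rw [ht, mul_inv_cancel_left₀ hl0]
    have he1 : ‖y - 1‖ ^ p ≤ ‖(p : A)‖ := by
      have h1 := norm_sub_pow_prime_sub_le hp (x := y) (y := 1) (B := 1) hyp.le (by simp)
      rw [mul_one, one_pow] at h1
      have := norm_add_le_of_le_of_le h1 hy1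
      rwa [sub_add_cancel, norm_pow] at this
    -- If ‖t‖ > 1, then ‖λ‖‖t‖^2 ≤ ‖λ‖‖t‖^p, and the bound on (λt)^p = (y - 1)^p by p makes the
    -- latter at most 1, because ‖λ‖^(p-1) = ‖p‖.
    have ht2 : ‖l‖ * ‖t‖ ^ 2 ≤ 1 := by
      rcases le_or_gt ‖t‖ 1 with h1 | h1
      · exact mul_le_one₀ hl1.le (by positivity) (pow_le_one₀ (norm_nonneg _) h1)
      · have h3 : ‖l‖ ^ (p - 1) * (‖l‖ * ‖t‖ ^ p) ≤ ‖l‖ ^ (p - 1) * 1 := by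
          rw [← mul_assoc, pow_sub_one_mul hp.ne_zero, ← mul_pow, ← norm_mul, hlt, mul_one, hln]
          exact he1
        refine le_trans ?_ (le_of_mul_le_mul_left h3 (pow_pos hlpos _))
        exact mul_le_mul_of_nonneg_left (pow_le_pow_right₀ h1.le hp.two_le) hlpos.le
    have hy1' : ‖y - 1‖ ≤ 1 := norm_sub_le_of_le_of_le hyn.le (by simp)
    obtain ⟨r, hr1, hr⟩ := exists_norm_le_one_one_add_pow_prime_eq hp hy1'
    rw [add_sub_cancel, ← hlt] at hr
    clear_value t
    -- As λ^p = -pλ, dividing the expansion of (1 + λt)^p - 1 by λ^p gives t^p - t up to λt²r.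
    have e : t ^ p - t - (y ^ p - 1) / l ^ p = l * t ^ 2 * r := by
      rw [hr, mul_pow, hlp]
      field_simp
      ring
    rw [e, norm_mul, norm_mul, norm_pow]
    exact mul_le_one₀ ht2 (norm_nonneg _) hr1

theorem eliminable_of_pow_sub_one_le (hinv : ∀ (σ : A ≃ₐ[K] A) (x : A), ‖σ x‖ = ‖x‖) (hp : p.Prime)
    (hpA : ‖(p : A)‖ < 1) (hp0 : (p : A) ≠ 0) {K₀ M : IntermediateField K A}
    [FiniteDimensional K M] (hle : K₀ ≤ M) (he : SameValues M K₀) {ϖ : A} (hϖ : IsUnif K₀ ϖ)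
    {l y : A} (hlM : l ∈ K₀) (hl : l ^ (p - 1) = -p) (hy : y ^ p ∈ M)
    (hy1 : ‖y ^ p - 1‖ ≤ ‖(p : A)‖) : Eliminable K₀ (M ⊔ K⟮y⟯) := by
  have hp1 : p - 1 ≠ 0 := by have := hp.one_lt; omega
  have hl0 : l ≠ 0 := by
    rintro rfl
    rw [zero_pow hp1] at hl
    exact hp0 (neg_eq_zero.1 hl.symm)
  have hln : ‖l‖ ^ (p - 1) = ‖(p : A)‖ := by rw [← norm_pow, hl, norm_neg]
  have hl1 : ‖l‖ < 1 := by
    rw [← pow_lt_one_iff_of_nonneg (norm_nonneg _) hp1, hln]; exact hpA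
  rw [← sup_adjoin_affine y (inv_mem (hle hlM)) (inv_ne_zero hl0) (one_mem M)]
  refine ASType.eliminable_of_finiteDimensional hinv hp hpA hle he hϖ ?_
    (ASType.of_pow_mem hp hpA hp0 (hle hlM) hl hy hy1)
  rw [norm_div, norm_pow, mul_div_assoc', div_le_one (pow_pos (norm_pos_iff.2 hl0) _)]
  refine (mul_le_mul_of_nonneg_left hy1 (norm_nonneg _)).trans ?_
  rw [← hln, ← pow_add]
  -- This is the exponent inequality 2(p - 1) ≥ p.
  exact pow_le_pow_of_le_one (norm_nonneg _) hl1.le (by have := hp.two_le; omega)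

/-- One may adjoin a root of a uniformizer before eliminating ramification. -/
theorem Eliminable.of_root {K₀ M : IntermediateField K A} (hle : K₀ ≤ M)
    {ϖ w t : A} (hϖ : IsUnif K₀ ϖ) {d : ℕ} (hd : d ≠ 0) (hw : w ^ d = ϖ)
    (h : Eliminable (K₀ ⊔ K⟮w⟯) ((M ⊔ K⟮w⟯) ⊔ K⟮t⟯)) : Eliminable K₀ (M ⊔ K⟮t⟯) := by
  refine Eliminable.trans le_sup_left (.of_resid_eq (resid_eq_of_totallyRamified
    (hϖ.degOver_root_le hd hw) (hϖ.root_norm_ne hw))) ?_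
  have e : M ⊔ K⟮t⟯ ⊔ (K₀ ⊔ K⟮w⟯) = (M ⊔ K⟮w⟯) ⊔ K⟮t⟯ := by
    apply le_antisymm
    · exact sup_le (sup_le (le_sup_left.trans le_sup_left) le_sup_right)
        (sup_le (hle.trans (le_sup_left.trans le_sup_left)) (le_sup_right.trans le_sup_left))
    · exact sup_le (sup_le (le_sup_left.trans le_sup_left) (le_sup_right.trans le_sup_right))
        (le_sup_right.trans le_sup_left)
  rwa [e]

theorem sup_adjoin_div {M : IntermediateField K A} {y c : A} (hc : c ∈ M) (hc0 : c ≠ 0) :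
    M ⊔ K⟮y / c⟯ = M ⊔ K⟮y⟯ := by
  have := sup_adjoin_affine (M := M) y (inv_mem hc) (inv_ne_zero hc0) (zero_mem M)
  rwa [sub_zero, ← div_eq_inv_mul] at this

/-- With w^p = ϖ, a greedy expansion of y^p - 1 with p-th power coefficients is, modulo p, s^p - 1
for some s in M(w). If it reaches precision p, dividing y by s gives the previous case. If it is
stuck earlier, y - s divided by a power of w reduces to a p-th root of a residue class that is not a
p-th power. -/
theorem eliminable_of_pow_sub_one_lt (hinv : ∀ (σ : A ≃ₐ[K] A) (x : A), ‖σ x‖ = ‖x‖) (hp : p.Prime)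
    (hpA : ‖(p : A)‖ < 1) (hp0 : (p : A) ≠ 0) {K₀ M : IntermediateField K A}
    [FiniteDimensional K M] (hle : K₀ ≤ M) (he : SameValues M K₀) {ϖ : A} (hϖ : IsUnif K₀ ϖ)
    {l y : A} (hlM : l ∈ K₀) (hl : l ^ (p - 1) = -p) (hy : y ^ p ∈ M)
    (hy1 : ‖y ^ p - 1‖ < 1) : Eliminable K₀ (M ⊔ K⟮y⟯) := by
  have hϖM : IsUnif M ϖ := hϖ.of_sameValues hle he
  obtain ⟨w, hw⟩ := IsAlgClosed.exists_pow_nat_eq ϖ hp.pos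
  have hwM := hϖM.root hp.ne_zero hw
  have heM := sameValues_of_totallyRamified hle he (hϖ.degOver_root_le hp.ne_zero hw)
    (hϖ.root_norm_ne hw)
  have hM₁ : FiniteDimensional K (M ⊔ K⟮w⟯ : IntermediateField K A) := finiteDimensional_sup_adjoin M w
  have hK₁ : FiniteDimensional K (K₀ ⊔ K⟮w⟯ : IntermediateField K A) := by
    have : FiniteDimensional K K₀ := finiteDimensional_of_le hle
    exact finiteDimensional_sup_adjoin K₀ w
  have hle₁ : K₀ ⊔ K⟮w⟯ ≤ M ⊔ K⟮w⟯ := sup_le_sup_right hle _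
  refine Eliminable.of_root hle hϖ hp.ne_zero hw ?_
  have hyp : ‖y‖ ^ p = 1 := by
    rw [← norm_pow, ← norm_one (α := A)]
    exact norm_eq_of_norm_sub_lt (by rwa [norm_one])
  have hyM : y ^ p ∈ M ⊔ K⟮w⟯ := (le_sup_left : M ≤ _) hy
  obtain ⟨n, hn⟩ : ∃ n : ℕ, ‖ϖ‖ ^ n < ‖(p : A)‖ :=
    exists_pow_lt_of_lt_one (norm_pos_iff.2 hp0) hϖ.lt_one
  obtain ⟨c, hc, hc1, hcase⟩ := exists_pow_expansion hp hpA hϖM le_rfl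
    (fun x hx hx1 => ⟨x, hx, hx1, by simp⟩) 1 (x := y ^ p - 1) (_root_.sub_mem hy (one_mem M))
    (by simpa using hϖM.norm_le_of_lt (a := 0) (_root_.sub_mem hy (one_mem M)) (by simpa using hy1)) n
  have hpos : ∀ i : ℕ, (1 : ℤ) + i = (i + 1 : ℕ) := fun i => by push_cast; ring
  simp only [hpos, zpow_natCast] at hcase
  set s : ℕ → A := fun k => 1 + ∑ i ∈ Finset.range k, c i * w ^ (i + 1) with hs
  have hterm : ∀ i, ‖c i * w ^ (i + 1)‖ < 1 := fun i => by
    rw [norm_mul, norm_pow]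
    exact (mul_le_of_le_one_left (by positivity) (hc1 i)).trans_lt
      (pow_lt_one₀ (norm_nonneg _) hwM.lt_one (by omega))
  have hsM : ∀ k, s k ∈ M ⊔ K⟮w⟯ := fun k => add_mem (one_mem _)
    (sum_mem fun i _ => mul_mem ((le_sup_left : M ≤ _) (hc i)) (pow_mem hwM.mem _))
  have hs1 : ∀ k, ‖s k‖ = 1 := fun k => by
    rw [← norm_one (α := A)]
    refine norm_eq_of_norm_sub_lt ?_
    rw [hs, add_sub_cancel_left, norm_one]
    exact norm_sum_lt zero_lt_one fun i _ => hterm i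
  have hs0 : ∀ k, s k ≠ 0 := fun k => norm_pos_iff.1 (by rw [hs1]; exact one_pos)
  have hsp : ∀ k, ‖s k ^ p - (1 + ∑ i ∈ Finset.range k, c i ^ p * ϖ ^ (i + 1))‖ ≤ ‖(p : A)‖ := by
    intro k
    have h1 := norm_sum_pow_prime_sub_le hp (Finset.range k) (f := fun i => c i * w ^ (i + 1))
      zero_le_one fun i _ => pow_le_one₀ (norm_nonneg _) (hterm i).le
    have h2 := norm_add_pow_prime_sub_le hp (x := 1)
      (y := ∑ i ∈ Finset.range k, c i * w ^ (i + 1)) (B := 1) (by simp)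
      (pow_le_one₀ (norm_nonneg _) (norm_sum_lt zero_lt_one fun i _ => hterm i).le)
    rw [mul_one] at h1 h2
    have h3 := norm_add_le_of_le_of_le h2 h1
    convert h3 using 2
    have : ∀ i, c i ^ p * ϖ ^ (i + 1) = (c i * w ^ (i + 1)) ^ p := fun i => by
      rw [mul_pow, ← hw, ← pow_mul, ← pow_mul, mul_comm p]
    simp only [this, hs]
    ring
  have hclose : ∀ k, ‖y ^ p - 1 - ∑ i ∈ Finset.range k, c i ^ p * ϖ ^ (i + 1)‖ ≤ ‖(p : A)‖ →
      Eliminable (K₀ ⊔ K⟮w⟯) ((M ⊔ K⟮w⟯) ⊔ K⟮y⟯) := by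
    intro k hk
    rw [← sup_adjoin_div (hsM k) (hs0 k)]
    refine eliminable_of_pow_sub_one_le hinv hp hpA hp0 hle₁ heM (hϖ.root hp.ne_zero hw)
      ((le_sup_left : K₀ ≤ _) hlM) hl ?_ ?_
    · rw [div_pow]; exact div_mem hyM (pow_mem (hsM k) p)
    · rw [div_pow, div_sub_one (pow_ne_zero _ (hs0 k)), norm_div, norm_pow, hs1, one_pow, div_one]
      rw [show y ^ p - s k ^ p = y ^ p - 1 - ∑ i ∈ Finset.range k, c i ^ p * ϖ ^ (i + 1) -
        (s k ^ p - (1 + ∑ i ∈ Finset.range k, c i ^ p * ϖ ^ (i + 1))) by ring]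
      exact norm_sub_le_of_le_of_le hk (hsp k)
  rcases hcase with h1 | ⟨k, hk, u, hu, hu1, hpow, heq⟩
  · refine hclose n (h1.trans ?_)
    rw [pow_succ]
    exact (mul_le_of_le_one_right (by positivity) hϖ.lt_one.le).trans hn.le
  rcases le_or_gt (‖ϖ‖ ^ (k + 1)) ‖(p : A)‖ with h1 | h1
  · refine hclose k ?_
    rw [heq, norm_mul, norm_pow]
    exact (mul_le_of_le_one_left (by positivity) hu1).trans h1
  set g := w ^ (k + 1) with hg
  have hgp : g ^ p = ϖ ^ (k + 1) := by rw [hg, ← pow_mul, ← hw, ← pow_mul, mul_comm]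
  have hg0 : g ≠ 0 := pow_ne_zero _ hwM.ne_zero
  set b := g⁻¹ * (y - s k) with hb
  have hbu : ‖b ^ p - u‖ < 1 := by
    have h2 := norm_sub_pow_prime_sub_le hp (x := y) (y := s k) (B := 1) hyp.le (by simp [hs1])
    rw [mul_one] at h2
    have h3 : ‖(y - s k) ^ p - u * ϖ ^ (k + 1)‖ ≤ ‖(p : A)‖ := by
      rw [← heq]
      have := norm_sub_le_of_le_of_le h2 (hsp k)
      convert this using 2
      ring
    have e : b ^ p - u = ((y - s k) ^ p - u * ϖ ^ (k + 1)) / ϖ ^ (k + 1) := by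
      rw [hb, mul_pow, inv_pow, hgp, sub_div, mul_div_cancel_right₀ _ (pow_ne_zero _ hϖ.ne_zero),
        div_eq_inv_mul]
    rw [e, norm_div, div_lt_one (norm_pos_iff.2 (pow_ne_zero _ hϖ.ne_zero)), norm_pow ϖ]
    exact h3.trans_lt h1
  have hb1 : ‖b‖ ≤ 1 := by
    have := norm_add_le_of_le_of_le hbu.le hu1
    rw [sub_add_cancel, norm_pow] at this
    exact (pow_le_one_iff_of_nonneg (norm_nonneg _) hp.ne_zero).1 this
  have hadj : (M ⊔ K⟮w⟯) ⊔ K⟮b⟯ = (M ⊔ K⟮w⟯) ⊔ K⟮y⟯ :=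
    sup_adjoin_affine y (inv_mem (pow_mem hwM.mem _)) (inv_ne_zero hg0) (hsM k)
  refine Eliminable.of_sameValues (hle₁.trans le_sup_left) (SameValues.trans ?_ heM)
  rw [← hadj]
  refine sameValues_of_degOver_le hb1 (degOver_le_of_not_pow hp hb1
    ((le_sup_left : M ≤ M ⊔ K⟮w⟯) hu) hu1 hbu (fun x hx hx1 => ?_) ?_)
  · obtain ⟨c', hc', hc'1, hxc⟩ := exists_norm_sub_lt_one_of_totallyRamified
      (hϖM.degOver_root_le hp.ne_zero hw) (hϖM.root_norm_ne hw) hx hx1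
    by_contra! hlt
    refine absurd (hpow c' hc' hc'1) (not_le.2 ?_)
    have h2 := norm_sub_pow_prime_sub_le hp (x := x) (y := c') (B := 1)
      (pow_le_one₀ (norm_nonneg _) hx1) (pow_le_one₀ (norm_nonneg _) hc'1)
    rw [mul_one] at h2
    have h3 : ‖(x - c') ^ p‖ < 1 := by
      rw [norm_pow]; exact pow_lt_one₀ (norm_nonneg _) hxc hp.ne_zero
    rw [show u - c' ^ p = (x - c') ^ p - ((x - c') ^ p - (x ^ p - c' ^ p)) + (u - x ^ p) by ring]
    exact norm_add_lt_of_lt_of_lt (norm_sub_lt_of_lt_of_lt h3 (h2.trans_lt hpA)) hlt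
  · rw [degOver_eq_of_adjoin_eq hadj]
    exact degOver_le_of_pow_mem hp.ne_zero hyM

/-- Adjoining w = ϖ^(1/p) makes the norm of y a power of ‖w‖, so y can be made a unit. Then either
y^p is no p-th power in the residue field and the residue degree is full, or y can be divided to
make y^p ≡ 1. -/
theorem eliminable_of_pow_mem (hinv : ∀ (σ : A ≃ₐ[K] A) (x : A), ‖σ x‖ = ‖x‖) (hp : p.Prime)
    (hpA : ‖(p : A)‖ < 1) (hp0 : (p : A) ≠ 0) {K₀ M : IntermediateField K A}
    [FiniteDimensional K M] (hle : K₀ ≤ M) (he : SameValues M K₀) {ϖ : A} (hϖ : IsUnif K₀ ϖ)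
    {l y : A} (hlM : l ∈ K₀) (hl : l ^ (p - 1) = -p) (hy : y ^ p ∈ M) (hy0 : y ≠ 0) :
    Eliminable K₀ (M ⊔ K⟮y⟯) := by
  have hϖM : IsUnif M ϖ := hϖ.of_sameValues hle he
  obtain ⟨w, hw⟩ := IsAlgClosed.exists_pow_nat_eq ϖ hp.pos
  have hwM := hϖM.root hp.ne_zero hw
  have heM := sameValues_of_totallyRamified hle he (hϖ.degOver_root_le hp.ne_zero hw)
    (hϖ.root_norm_ne hw)
  have hM₁ : FiniteDimensional K (M ⊔ K⟮w⟯ : IntermediateField K A) := finiteDimensional_sup_adjoin M w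
  have hle₁ : K₀ ⊔ K⟮w⟯ ≤ M ⊔ K⟮w⟯ := sup_le_sup_right hle _
  refine Eliminable.of_root hle hϖ hp.ne_zero hw ?_
  obtain ⟨j, hj⟩ := hϖM.exists_zpow _ hy (pow_ne_zero p hy0)
  have hyj : ‖y / w ^ j‖ = 1 := by
    rw [norm_div, norm_zpow, div_eq_one_iff_eq (zpow_pos hwM.pos j).ne']
    refine (pow_left_inj₀ (norm_nonneg _) (zpow_pos hwM.pos j).le hp.ne_zero).1 ?_
    rw [← norm_pow, hj, ← hw, norm_pow, ← zpow_natCast, ← zpow_natCast, ← zpow_mul, ← zpow_mul,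
      mul_comm]
  rw [← sup_adjoin_div (zpow_mem hwM.mem j) (zpow_ne_zero j hwM.ne_zero)]
  set y' := y / w ^ j with hy'
  have hy'M : y' ^ p ∈ M ⊔ K⟮w⟯ := by
    rw [hy', div_pow]
    exact div_mem ((le_sup_left : M ≤ _) hy) (pow_mem (zpow_mem hwM.mem j) p)
  have hu1 : ‖y' ^ p‖ ≤ 1 := by rw [norm_pow, hyj, one_pow]
  by_cases hpow : ∀ c ∈ M ⊔ K⟮w⟯, ‖c‖ ≤ 1 → 1 ≤ ‖y' ^ p - c ^ p‖
  · have hK₁ : FiniteDimensional K (K₀ ⊔ K⟮w⟯ : IntermediateField K A) := finiteDimensional_of_le hle₁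
    refine Eliminable.of_sameValues (hle₁.trans le_sup_left) (SameValues.trans ?_ heM)
    exact sameValues_of_degOver_le hyj.le (degOver_le_of_not_pow hp hyj.le hy'M hu1 (by simp) hpow
      (degOver_le_of_pow_mem hp.ne_zero hy'M))
  · push Not at hpow
    obtain ⟨c, hc, hc1, hlt⟩ := hpow
    have hcp : ‖c ^ p‖ = 1 := by
      have h1 : ‖y' ^ p‖ = 1 := by rw [norm_pow, hyj, one_pow]
      rw [← h1]
      exact (norm_eq_of_norm_sub_lt_left (by rwa [h1])).symm
    have hc0 : c ≠ 0 := by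
      rintro rfl
      simp [hp.ne_zero] at hcp
    rw [← sup_adjoin_div hc hc0]
    refine eliminable_of_pow_sub_one_lt hinv hp hpA hp0 hle₁ heM (hϖ.root hp.ne_zero hw)
      ((le_sup_left : K₀ ≤ _) hlM) hl ?_ ?_
    · rw [div_pow]; exact div_mem hy'M (pow_mem hc p)
    · rwa [div_pow, div_sub_one (pow_ne_zero _ hc0), norm_div, hcp, div_one]

end Kummer

/-! ### Artin–Schreier and Kummer generators for steps of degree p. -/

section CyclicStep

/-- Generators of cyclic extensions of prime degree: a root of `X ^ p - X - a` in characteristic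
`p`, a nonzero root of `X ^ p - a` otherwise. -/
def PrimeStep {F N : Type*} [Field F] [Field N] [Algebra F N] (p : ℕ) (M : IntermediateField F N)
    (t : N) : Prop :=
  (p : N) = 0 ∧ t ^ p - t ∈ M ∨ (p : N) ≠ 0 ∧ t ≠ 0 ∧ t ^ p ∈ M

theorem Subgroup.le_of_relIndex_prime {G : Type*} [Group G] {H H₁ S : Subgroup G}
    (hp : (H.relIndex H₁).Prime) (hH : H ≤ H₁) (hS : H ≤ S) {σ : G} (hσ : σ ∈ H₁) (hσH : σ ∉ H)
    (hσS : σ ∈ S) : H₁ ≤ S := by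
  have h1 := Subgroup.relIndex_mul_relIndex H (S ⊓ H₁) H₁ (le_inf hS hH) inf_le_right
  rcases (Nat.prime_mul_iff.1 (h1 ▸ hp)) with h2 | h2
  · exact (Subgroup.relIndex_eq_one.1 h2.2).trans inf_le_left
  · exact absurd (Subgroup.relIndex_eq_one.1 h2.2 ⟨hσS, hσ⟩) hσH

variable {N : Type*} [Field N] {p : ℕ}

/-- In characteristic p, D = σ - 1 satisfies D^p = σ^p - 1, which kills x. If D^(n+1) x is the last
nonzero iterate, it is fixed by σ and t = D^n x / D^(n+1) x. -/
theorem exists_map_eq_add_one {G : Type*} [Monoid G] [MulSemiringAction G N] (hp : p.Prime)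
    (hp0 : (p : N) = 0) (V : Subfield N) (σ : G) (hV : ∀ x ∈ V, σ • x ∈ V)
    (hσ : ∀ x ∈ V, σ ^ p • x = x) {x : N} (hx : x ∈ V) (hσx : σ • x ≠ x) :
    ∃ t ∈ V, σ • t = t + 1 := by
  have hchar : CharP N p := (CharP.charP_iff_prime_eq_zero hp).2 hp0
  have : Fact p.Prime := ⟨hp⟩
  let D : Module.End ℤ N := (MulSemiringAction.toRingHom G N σ).toAddMonoidHom.toIntLinearMap - 1
  have hD : ∀ y, D y = σ • y - y := fun y => rfl
  have hpow : ∀ n y, ((MulSemiringAction.toRingHom G N σ).toAddMonoidHom.toIntLinearMap ^ n) y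
      = σ ^ n • y := by
    intro n
    induction n with
    | zero => intro y; simp
    | succ n ih =>
      intro y
      rw [pow_succ, Module.End.mul_apply, ih, pow_succ, mul_smul]
      rfl
  have hDV : ∀ n, ∀ y ∈ V, (D ^ n) y ∈ V := by
    intro n
    induction n with
    | zero => intro y hy; simpa using hy
    | succ n ih =>
      intro y hy
      rw [pow_succ, Module.End.mul_apply, hD]
      exact ih _ (sub_mem (hV y hy) hy)
  have hDp : (D ^ p) x = 0 := by
    obtain ⟨r, hr⟩ := (Commute.one_right D).exists_add_pow_prime_eq hp
    have h1 := congrArg (fun f : Module.End ℤ N => f x) hr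
    simp only [D, sub_add_cancel] at h1
    rw [hpow, hσ x hx] at h1
    have h2 : ∀ f : Module.End ℤ N, ((p : Module.End ℤ N) * f) x = 0 := fun f => by
      rw [← nsmul_eq_mul, LinearMap.smul_apply, nsmul_eq_mul, hp0, zero_mul]
    simp only [LinearMap.add_apply, one_pow, mul_assoc, h2, add_zero, Module.End.one_apply] at h1
    exact right_eq_add.1 h1
  have hex : ∃ n, (D ^ n) x = 0 := ⟨p, hDp⟩
  classical
  have hn0 : Nat.find hex ≠ 0 := by
    intro h
    have := (Nat.find_eq_zero hex).1 h
    simp at this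
    exact hσx (by simp [this])
  have hn1 : Nat.find hex ≠ 1 := by
    intro h
    have := Nat.find_spec hex
    rw [h, pow_one, hD, sub_eq_zero] at this
    exact hσx this
  obtain ⟨n, hn⟩ : ∃ n, Nat.find hex = n + 2 := ⟨Nat.find hex - 2, by omega⟩
  have hu0 : (D ^ (n + 1)) x ≠ 0 := Nat.find_min hex (by omega)
  have hσu : σ • (D ^ (n + 1)) x = (D ^ (n + 1)) x := by
    have h1 := Nat.find_spec hex
    rw [hn, pow_succ', Module.End.mul_apply, hD, sub_eq_zero] at h1
    exact h1
  have hσv : σ • (D ^ n) x = (D ^ n) x + (D ^ (n + 1)) x := by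
    rw [pow_succ', Module.End.mul_apply, hD]; ring
  refine ⟨(D ^ n) x / (D ^ (n + 1)) x, div_mem (hDV _ _ hx) (hDV _ _ hx), ?_⟩
  have h1 := map_div₀ (MulSemiringAction.toRingHom G N σ) ((D ^ n) x) ((D ^ (n + 1)) x)
  simp only [MulSemiringAction.toRingHom_apply] at h1
  rw [h1, hσu, hσv, add_div, div_self hu0]

/-- Some Lagrange resolvent with nontrivial character is nonzero: otherwise p x, the sum of all
resolvents, would equal the σ-invariant one. -/
theorem exists_map_eq_root_mul {G : Type*} [Monoid G] [MulSemiringAction G N] (hp : p.Prime)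
    (hp0 : (p : N) ≠ 0) (V : Subfield N) (σ : G) (hV : ∀ x ∈ V, σ • x ∈ V)
    (hσ : ∀ x ∈ V, σ ^ p • x = x) {ζ : N} (hζ : IsPrimitiveRoot ζ p) (hζV : ζ ∈ V)
    (hζσ : σ • ζ = ζ) {x : N} (hx : x ∈ V) (hσx : σ • x ≠ x) :
    ∃ t ∈ V, t ≠ 0 ∧ σ • t ≠ t ∧ σ • t ^ p = t ^ p := by
  have hpow : ∀ n, σ ^ n • x ∈ V := by
    intro n
    induction n with
    | zero => simpa using hx
    | succ n ih => rw [pow_succ', mul_smul]; exact hV _ ih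
  have hζ0 : ζ ≠ 0 := hζ.ne_zero hp.ne_zero
  set R : ℕ → N := fun i => ∑ j ∈ Finset.range p, (ζ ^ i) ^ j * σ ^ j • x with hR
  have hRV : ∀ i, R i ∈ V := fun i =>
    sum_mem fun j _ => mul_mem (pow_mem (pow_mem hζV _) _) (hpow j)
  have hσR : ∀ i, ζ ^ i * σ • R i = R i := by
    intro i
    have h1 : ζ ^ i * σ • R i = ∑ j ∈ Finset.range p, (ζ ^ i) ^ (j + 1) * σ ^ (j + 1) • x := by
      rw [hR, Finset.smul_sum, Finset.mul_sum]
      refine Finset.sum_congr rfl fun j _ => ?_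
      rw [smul_mul', smul_pow', smul_pow', hζσ, pow_succ' σ, mul_smul]
      ring
    rw [h1, ← add_left_inj ((ζ ^ i) ^ 0 * σ ^ 0 • x), ← Finset.sum_range_succ' (fun j => (ζ ^ i) ^ j * σ ^ j • x),
      Finset.sum_range_succ, hσ x hx, ← pow_mul, mul_comm i, pow_mul, hζ.pow_eq_one]
    simp [hR]
  have hex : ∃ i, R i ≠ 0 ∧ ζ ^ i ≠ 1 := by
    by_contra! hcon
    have h1 : ∑ i ∈ Finset.range p, R i = p * x := by
      rw [hR]
      rw [Finset.sum_comm, Finset.sum_eq_single_of_mem 0 (Finset.mem_range.2 hp.pos)]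
      · simp
      · intro j hj hj0
        rw [← Finset.sum_mul]
        have h2 : IsPrimitiveRoot (ζ ^ j) p := hζ.pow_of_coprime _
          (Nat.coprime_of_lt_prime hj0 (Finset.mem_range.1 hj) hp).symm
        have h3 := h2.geom_sum_eq_zero hp.one_lt
        simp only [← pow_mul, mul_comm j] at h3 ⊢
        rw [h3, zero_mul]
    have h2 : ∑ i ∈ Finset.range p, R i = R 0 := by
      refine Finset.sum_eq_single_of_mem 0 (Finset.mem_range.2 hp.pos) fun i hi hi0 => ?_
      by_contra h
      exact hζ.pow_ne_one_of_pos_of_lt hi0 (Finset.mem_range.1 hi) (hcon i h)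
    have h3 := hσR 0
    have h4 := map_natCast (MulSemiringAction.toRingHom G N σ) p
    rw [MulSemiringAction.toRingHom_apply] at h4
    rw [pow_zero, one_mul, ← h2, h1, smul_mul', h4] at h3
    exact hσx (mul_left_cancel₀ hp0 h3)
  obtain ⟨i, hi, hζi⟩ := hex
  refine ⟨R i, hRV i, hi, fun h => hζi ?_, ?_⟩
  · have := hσR i
    rw [h] at this
    exact mul_right_cancel₀ hi (by rw [this, one_mul])
  · rw [smul_pow']
    nth_rewrite 2 [← hσR i]
    rw [mul_pow, ← pow_mul, mul_comm i, pow_mul, hζ.pow_eq_one, one_pow, one_mul]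

variable {F : Type*} [Field F] [Algebra F N] [FiniteDimensional F N] [IsGalois F N]

/-- A subgroup of prime index is maximal, so any t fixed by `H` and moved by σ generates the fixed
field of `H` over that of `H₁`. -/
theorem exists_primeStep (hp : p.Prime) (hζ : (p : N) ≠ 0 → ∃ ζ : F, IsPrimitiveRoot ζ p)
    {H H₁ : Subgroup (N ≃ₐ[F] N)} (hH : H ≤ H₁) (hidx : H.relIndex H₁ = p)
    (hn : (H.subgroupOf H₁).Normal) :
    ∃ t, PrimeStep p (fixedField H₁) t ∧ fixedField H = fixedField H₁ ⊔ F⟮t⟯ := by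
  obtain ⟨σ, hσ, hσH⟩ : ∃ σ ∈ H₁, σ ∉ H := by
    by_contra! hcon
    rw [Subgroup.relIndex_eq_one.2 hcon] at hidx
    exact hp.one_lt.ne hidx
  have hmax : ∀ {S : Subgroup (N ≃ₐ[F] N)}, H ≤ S → ∀ τ ∈ H₁, τ ∉ H → τ ∈ S → H₁ ≤ S :=
    fun hS τ h1 h2 h3 => Subgroup.le_of_relIndex_prime (hidx ▸ hp) hH hS h1 h2 h3
  have hstab : ∀ {x : N}, x ∈ fixedField H → H ≤ MulAction.stabilizer (N ≃ₐ[F] N) x :=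
    fun hx τ hτ => (mem_fixedField_iff H _).1 hx τ hτ
  have hfix : ∀ {x : N}, x ∈ fixedField H → σ x = x → x ∈ fixedField H₁ := fun {x} hx hσx =>
    (mem_fixedField_iff H₁ _).2 fun τ hτ => hmax (hstab hx) σ hσ hσH hσx hτ
  have hV : ∀ x ∈ fixedField H, σ x ∈ fixedField H := by
    intro x hx
    rw [mem_fixedField_iff] at hx ⊢
    intro τ hτ
    have h1 := hn.conj_mem ⟨τ, hH hτ⟩ (Subgroup.mem_subgroupOf.2 hτ) ⟨σ, hσ⟩⁻¹
    have h2 := hx _ (Subgroup.mem_subgroupOf.1 h1)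
    have h3 : σ ((σ⁻¹ * τ * σ⁻¹⁻¹) x) = σ x := congrArg σ h2
    rw [inv_inv] at h3
    simpa [AlgEquiv.mul_apply] using h3
  have hσp : ∀ x ∈ fixedField H, (σ ^ p) x = x := by
    intro x hx
    have h1 := Subgroup.pow_index_mem (H.subgroupOf H₁) ⟨σ, hσ⟩
    have h2 : (H.subgroupOf H₁).index = p := hidx
    rw [h2, Subgroup.mem_subgroupOf] at h1
    exact (mem_fixedField_iff H x).1 hx _ h1
  obtain ⟨x, hx, hσx⟩ : ∃ x ∈ fixedField H, σ x ≠ x := by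
    by_contra! hcon
    have : σ ∈ (fixedField H).fixingSubgroup := fun ⟨x, hx⟩ => hcon x hx
    rw [fixingSubgroup_fixedField] at this
    exact hσH this
  have hgen : ∀ t ∈ fixedField H, σ t ≠ t → fixedField H = fixedField H₁ ⊔ F⟮t⟯ := by
    intro t ht hσt
    apply le_antisymm
    · rw [← IsGalois.fixedField_fixingSubgroup (fixedField H₁ ⊔ F⟮t⟯)]
      refine fixedField_antitone fun τ hτ => ?_
      rw [fixingSubgroup_sup, fixingSubgroup_fixedField] at hτ
      have hτt : τ t = t := hτ.2 ⟨t, mem_adjoin_simple_self F t⟩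
      by_contra hτH
      exact hσt (hmax (hstab ht) τ hτ.1 hτH hτt hσ)
    · exact sup_le (fixedField_antitone hH) (adjoin_simple_le_iff.2 ht)
  by_cases hp0 : (p : N) = 0
  · obtain ⟨t, ht, hσt⟩ := exists_map_eq_add_one hp hp0 (fixedField H).toSubfield σ hV hσp hx hσx
    have hσt' : σ t = t + 1 := hσt
    have hchar : CharP N p := (CharP.charP_iff_prime_eq_zero hp).2 hp0
    have : Fact p.Prime := ⟨hp⟩
    refine ⟨t, Or.inl ⟨hp0, hfix (sub_mem (pow_mem ht p) ht) ?_⟩, hgen t ht (by simp [hσt'])⟩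
    rw [map_sub, map_pow, hσt', add_pow_char, one_pow]
    ring
  · obtain ⟨ζ, hζ⟩ := hζ hp0
    obtain ⟨t, ht, ht0, hσt, hσtp⟩ := exists_map_eq_root_mul hp hp0 (fixedField H).toSubfield σ hV
      hσp (hζ.map_of_injective (algebraMap F N).injective) (algebraMap_mem _ ζ) (σ.commutes ζ) hx hσx
    exact ⟨t, Or.inr ⟨hp0, ht0, hfix (pow_mem ht p) hσtp⟩, hgen t ht hσt⟩

end CyclicStep

/-! ### Sylow chains and towers of prime steps. -/

section Tower

/-- Towers of extensions generated by prime steps. -/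
inductive PrimeTower {F N : Type*} [Field F] [Field N] [Algebra F N] (p : ℕ)
    (M : IntermediateField F N) : IntermediateField F N → Prop
  | refl : PrimeTower p M M
  | step {M' : IntermediateField F N} {t : N} (h : PrimeTower p M M') (ht : PrimeStep p M' t) :
      PrimeTower p M (M' ⊔ F⟮t⟯)

variable {F N : Type*} [Field F] [Field N] [Algebra F N] [FiniteDimensional F N] [IsGalois F N]
  {p : ℕ}

/-- `M` is the fixed field of a Sylow p-subgroup. The trivial subgroup is joined to it by a chain of
p-subgroups with successive index p, each normal in the next because p is the least prime factor of
the order. -/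
theorem exists_primeTower (hp : p.Prime) (hζ : (p : N) ≠ 0 → ∃ ζ : F, IsPrimitiveRoot ζ p) :
    ∃ M : IntermediateField F N, ¬ p ∣ Module.finrank F M ∧ PrimeTower p M ⊤ := by
  have : Fact p.Prime := ⟨hp⟩
  obtain ⟨n, s, hs, hcard⟩ := Nat.exists_eq_pow_mul_and_not_dvd
    (Nat.card_pos (α := N ≃ₐ[F] N)).ne' p hp.ne_one
  have key : ∀ k ≤ n, ∀ H : Subgroup (N ≃ₐ[F] N), Nat.card H = p ^ (n - k) →
      ∃ P : Subgroup (N ≃ₐ[F] N), Nat.card P = p ^ n ∧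
        PrimeTower p (fixedField P) (fixedField H) := by
    intro k
    induction k with
    | zero => exact fun _ H hH => ⟨H, hH, .refl⟩
    | succ k ih =>
      intro hk H hH
      have e : n - (k + 1) + 1 = n - k := by omega
      obtain ⟨H₁, hH₁, hle⟩ := Sylow.exists_subgroup_card_pow_succ (p := p) (n := n - (k + 1))
        (by rw [e, hcard]; exact Dvd.dvd.mul_right (pow_dvd_pow p (Nat.sub_le _ _)) _) hH
      rw [e] at hH₁
      obtain ⟨P, hP, hT⟩ := ih (by omega) H₁ hH₁
      have hidx : H.relIndex H₁ = p := by
        have h1 := Subgroup.index_mul_card (H.subgroupOf H₁)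
        rw [Nat.card_congr (Subgroup.subgroupOfEquivOfLe hle).toEquiv, hH, hH₁, ← e, pow_succ',
          Nat.mul_left_inj (pow_ne_zero _ hp.ne_zero)] at h1
        exact h1
      have hnorm : (H.subgroupOf H₁).Normal := by
        refine Subgroup.normal_of_index_eq_minFac_card ?_
        rw [hH₁, hp.pow_minFac (by omega)]
        exact hidx
      obtain ⟨t, ht, heq⟩ := exists_primeStep hp hζ hle hidx hnorm
      exact ⟨P, hP, heq ▸ hT.step ht⟩
  obtain ⟨P, hP, hT⟩ := key n le_rfl ⊥ (by simp)
  refine ⟨fixedField P, ?_, by rwa [fixedField_bot] at hT⟩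
  have h1 := Module.finrank_mul_finrank F (fixedField P) N
  rw [finrank_fixedField_eq_card, hP, ← IsGalois.card_aut_eq_finrank F N, hcard, mul_comm,
    Nat.mul_right_inj (pow_ne_zero _ hp.ne_zero)] at h1
  rwa [h1]

end Tower

/-! ### Transport of towers from an extension of K₁ to subfields of `A`. -/

section Lift

variable {K A : Type*} [Field K] [Field A] [Algebra K A]

/-- The subfield of `A` corresponding to an intermediate field of `N / K₁`. -/
def liftRestrict {K₁ : IntermediateField K A} {N : IntermediateField K₁ A}
    (M : IntermediateField K₁ N) : IntermediateField K A :=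
  (IntermediateField.lift M).restrictScalars K

variable {K₁ : IntermediateField K A} {N : IntermediateField K₁ A}

theorem coe_mem_liftRestrict {M : IntermediateField K₁ N} {x : N} :
    (x : A) ∈ liftRestrict M ↔ x ∈ M := IntermediateField.mem_lift x

theorem mem_liftRestrict {M : IntermediateField K₁ N} {x : A} :
    x ∈ liftRestrict M ↔ ∃ y ∈ M, (y : A) = x := by
  constructor
  · rintro ⟨y, hy, rfl⟩
    exact ⟨y, hy, rfl⟩
  · rintro ⟨y, hy, rfl⟩
    exact coe_mem_liftRestrict.2 hy

theorem le_liftRestrict (M : IntermediateField K₁ N) : K₁ ≤ liftRestrict M := fun x hx =>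
  (IntermediateField.lift M).algebraMap_mem ⟨x, hx⟩

theorem liftRestrict_top : liftRestrict (⊤ : IntermediateField K₁ N) = N.restrictScalars K := by
  ext x
  rw [mem_liftRestrict, mem_restrictScalars]
  exact ⟨fun ⟨y, _, hy⟩ => hy ▸ y.2, fun hx => ⟨⟨x, hx⟩, mem_top, rfl⟩⟩

theorem liftRestrict_sup_adjoin (M : IntermediateField K₁ N) (t : N) :
    liftRestrict (M ⊔ K₁⟮t⟯) = liftRestrict M ⊔ K⟮(t : A)⟯ := by
  apply le_antisymm
  · have hle : K₁ ≤ liftRestrict M ⊔ K⟮(t : A)⟯ := (le_liftRestrict M).trans le_sup_left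
    have h1 : M ⊔ K₁⟮t⟯ ≤ (extendScalars hle).comap N.val := by
      refine sup_le (fun x hx => ?_) (adjoin_simple_le_iff.2 ?_)
      · exact (le_sup_left : liftRestrict M ≤ _) (coe_mem_liftRestrict.2 hx)
      · exact (le_sup_right : K⟮(t : A)⟯ ≤ _) (mem_adjoin_simple_self K _)
    intro x hx
    obtain ⟨y, hy, rfl⟩ := mem_liftRestrict.1 hx
    exact h1 hy
  · refine sup_le (fun x hx => ?_) (adjoin_simple_le_iff.2 ?_)
    · obtain ⟨y, hy, rfl⟩ := mem_liftRestrict.1 hx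
      exact coe_mem_liftRestrict.2 ((le_sup_left : M ≤ _) hy)
    · exact coe_mem_liftRestrict.2 ((le_sup_right : K₁⟮t⟯ ≤ _) (mem_adjoin_simple_self _ _))

theorem PrimeStep.liftRestrict {p : ℕ} {M : IntermediateField K₁ N} {t : N}
    (h : PrimeStep p M t) : PrimeStep p (liftRestrict M) (t : A) := by
  have hp : (p : A) = ((p : N) : A) := by simp
  refine h.imp (fun h1 => ⟨by rw [hp, h1.1]; rfl, ?_⟩) fun h1 => ⟨?_, ?_, ?_⟩
  · exact coe_mem_liftRestrict.2 h1.2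
  · rw [hp]; exact fun h => h1.1 (Subtype.ext h)
  · exact fun h => h1.2.1 (Subtype.ext h)
  · exact coe_mem_liftRestrict.2 h1.2.2

theorem PrimeTower.liftRestrict {p : ℕ} {M M' : IntermediateField K₁ N}
    (h : PrimeTower p M M') : PrimeTower p (liftRestrict M) (liftRestrict M') := by
  induction h with
  | refl => exact .refl
  | step h ht ih =>
    rw [liftRestrict_sup_adjoin]
    exact ih.step ht.liftRestrict

theorem isGalois_adjoin_of_isGalois [Algebra.IsAlgebraic K A] [IsAlgClosed A]
    (K₁ L : IntermediateField K A) [IsGalois K L] : IsGalois K₁ (adjoin K₁ (L : Set A)) := by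
  rw [isGalois_iff, isSeparable_adjoin_iff_isSeparable]
  constructor
  · intro x hx
    have h1 : IsSeparable K (⟨x, hx⟩ : L) := Algebra.IsSeparable.isSeparable K _
    have h2 : IsSeparable K x := by
      rw [IsSeparable, ← minpoly.algebraMap_eq (algebraMap L A).injective] at h1
      exact h1
    exact h2.tower_top K₁
  · have : Algebra.IsAlgebraic K₁ A := Algebra.IsAlgebraic.tower_top (K := K) K₁
    have hA : Normal K₁ A := normal_iff.2 fun x =>
      ⟨(Algebra.IsAlgebraic.isAlgebraic x).isIntegral, IsAlgClosed.splits _⟩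
    have hA' : Normal K A := normal_iff.2 fun x =>
      ⟨(Algebra.IsAlgebraic.isAlgebraic x).isIntegral, IsAlgClosed.splits _⟩
    rw [normal_iff_forall_map_le]
    intro σ
    rw [adjoin_map, adjoin_le_iff]
    rintro _ ⟨x, hx, rfl⟩
    refine subset_adjoin _ _ ?_
    exact (normal_iff_forall_map_le.1 (inferInstance : Normal K L)) (σ.restrictScalars K)
      ⟨x, hx, rfl⟩

theorem finiteDimensional_adjoin_of_finiteDimensional (K₁ L : IntermediateField K A)
    [FiniteDimensional K L] [FiniteDimensional K K₁] :
    FiniteDimensional K₁ (adjoin K₁ (L : Set A)) := by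
  have h1 : adjoin K₁ (L : Set A) ≤ extendScalars (le_sup_right : K₁ ≤ L ⊔ K₁) :=
    adjoin_le_iff.2 (le_sup_left : L ≤ L ⊔ K₁)
  have h2 : FiniteDimensional K (extendScalars (le_sup_right : K₁ ≤ L ⊔ K₁)) :=
    IntermediateField.finiteDimensional_sup L K₁
  have h3 : FiniteDimensional K₁ (extendScalars (le_sup_right : K₁ ≤ L ⊔ K₁)) :=
    FiniteDimensional.right K K₁ _
  exact FiniteDimensional.of_injective (inclusion h1).toLinearMap (inclusion h1).injective

theorem natDegree_minpoly_dvd_finrank {F E : Type*} [Field F] [Field E] [Algebra F E]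
    {M : IntermediateField F E} [FiniteDimensional F M] {x : E} (hx : x ∈ M) :
    (minpoly F x).natDegree ∣ Module.finrank F M := by
  have h1 := minpoly.algebraMap_eq (A := F) (algebraMap M E).injective ⟨x, hx⟩
  change minpoly F x = _ at h1
  rw [h1]
  exact minpoly.degree_dvd (Algebra.IsIntegral.isIntegral _)

theorem degOver_dvd_of_mem [Algebra.IsAlgebraic K A] {M : IntermediateField K A} {t x : A}
    (hx : x ∈ M ⊔ K⟮t⟯) : degOver M x ∣ degOver M t := by
  have := adjoin.finiteDimensional (isIntegral_intermediateField M t)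
  rw [degOver_eq_finrank M t]
  exact natDegree_minpoly_dvd_finrank (mem_sup_adjoin.1 hx)

end Lift

/-! ### Elimination along a tower, and for Galois extensions. -/

section Main

set_option linter.unusedSectionVars false

variable {K A : Type*} [Field K] [NormedField A] [IsUltrametricDist A] [Algebra K A]
  [Algebra.IsAlgebraic K A] [IsAlgClosed A] {p : ℕ}

theorem PrimeTower.finiteDimensional {M N : IntermediateField K A} [FiniteDimensional K M]
    (h : PrimeTower p M N) : FiniteDimensional K N := by
  induction h with
  | refl => assumption
  | step _ _ ih => exact finiteDimensional_sup_adjoin _ _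

theorem PrimeTower.le {M N : IntermediateField K A} (h : PrimeTower p M N) : M ≤ N := by
  induction h with
  | refl => exact le_rfl
  | step _ _ ih => exact ih.trans le_sup_left

/-- Each step starts from the base K' produced by the preceding ones, over which e = 1 already
holds. Steps survive the change of base, their conditions being memberships in the lower field. -/
theorem PrimeTower.eliminable (hinv : ∀ (σ : A ≃ₐ[K] A) (x : A), ‖σ x‖ = ‖x‖) (hp : p.Prime)
    (hpA : ‖(p : A)‖ < 1) {K₀ N : IntermediateField K A} [FiniteDimensional K K₀] {ϖ : A}
    (hϖ : IsUnif K₀ ϖ) (hl : (p : A) ≠ 0 → ∃ l ∈ K₀, l ^ (p - 1) = -(p : A))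
    (h : PrimeTower p K₀ N) : Eliminable K₀ N := by
  induction h with
  | refl => exact Eliminable.of_sameValues le_rfl fun x hx => ⟨x, hx, rfl⟩
  | @step M t h ht ih =>
    obtain ⟨K', hfin, hle, hsep, hval⟩ := ih
    have hM := h.finiteDimensional
    obtain ⟨ϖ', hϖ'⟩ := exists_isUnif hinv hϖ K' hle
    refine Eliminable.trans hle hsep ?_
    have e : M ⊔ K⟮t⟯ ⊔ K' = M ⊔ K' ⊔ K⟮t⟯ := sup_right_comm _ _ _
    rw [e]
    have := IntermediateField.finiteDimensional_sup M K'
    rcases ht with ⟨hp0, ht⟩ | ⟨hp0, ht0, ht⟩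
    · exact eliminable_of_artinSchreier hinv hp hp0 le_sup_right hval hϖ'
        ((le_sup_left : M ≤ _) ht)
    · obtain ⟨l, hlK, hl⟩ := hl hp0
      exact eliminable_of_pow_mem hinv hp hpA hp0 le_sup_right hval hϖ' (hle hlK) hl
        ((le_sup_left : M ≤ _) ht) ht0

theorem ResSeparable.sup_adjoin (hinv : ∀ (σ : A ≃ₐ[K] A) (x : A), ‖σ x‖ = ‖x‖) (hp : p.Prime)
    (hpA : ‖(p : A)‖ < 1) {M : IntermediateField K A} {t : A} (h : degOver M t < p) :
    ResSeparable M (M ⊔ K⟮t⟯) := by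
  refine ResSeparable.of_degOver hinv hp hpA fun x hx hdvd => ?_
  exact absurd (Nat.le_of_dvd (degOver_pos M t) (hdvd.trans (degOver_dvd_of_mem hx))) (not_le.2 h)

/-- Both the root of unity and λ have degree at most p - 1 over the field they are adjoined to, so p
divides no element degree. -/
theorem exists_resSeparable_roots (hinv : ∀ (σ : A ≃ₐ[K] A) (x : A), ‖σ x‖ = ‖x‖) (hp : p.Prime)
    (hpA : ‖(p : A)‖ < 1) (K₀ : IntermediateField K A) [FiniteDimensional K K₀] :
    ∃ K₁ : IntermediateField K A, FiniteDimensional K K₁ ∧ K₀ ≤ K₁ ∧ ResSeparable K₀ K₁ ∧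
      ((p : A) ≠ 0 → (∃ ζ ∈ K₁, IsPrimitiveRoot ζ p) ∧ ∃ l ∈ K₁, l ^ (p - 1) = -(p : A)) := by
  by_cases hp0 : (p : A) = 0
  · exact ⟨K₀, inferInstance, le_rfl, .refl _, fun h => absurd hp0 h⟩
  have : Fact p.Prime := ⟨hp⟩
  have hp1 : 0 < p - 1 := by have := hp.one_lt; omega
  obtain ⟨ζ, hζ⟩ := IsAlgClosed.exists_root (cyclotomic p A) (by
    rw [degree_cyclotomic, Nat.totient_prime hp]; exact_mod_cast hp1.ne')
  have : NeZero (p : A) := ⟨hp0⟩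
  have hζp := isRoot_cyclotomic_iff.1 hζ
  obtain ⟨l, hl⟩ := IsAlgClosed.exists_pow_nat_eq (-(p : A)) hp1
  have h1 : degOver K₀ ζ < p := by
    have := degOver_le_of_monic (M := K₀) (t := ζ) (cyclotomic.monic p K₀) (by
      rw [aeval_def, ← eval_map, map_cyclotomic]; exact hζ)
    rw [natDegree_cyclotomic, Nat.totient_prime hp] at this
    omega
  have h2 : degOver (K₀ ⊔ K⟮ζ⟯) l < p := by
    have := degOver_le_of_pow_mem (M := K₀ ⊔ K⟮ζ⟯) (y := l) hp1.ne'
      (by rw [hl]; exact neg_mem (_root_.natCast_mem _ p))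
    omega
  have := finiteDimensional_sup_adjoin K₀ ζ
  exact ⟨K₀ ⊔ K⟮ζ⟯ ⊔ K⟮l⟯, finiteDimensional_sup_adjoin _ _, le_sup_left.trans le_sup_left,
    (ResSeparable.sup_adjoin hinv hp hpA h1).trans le_sup_left (.sup_adjoin hinv hp hpA h2),
    fun _ => ⟨⟨ζ, (le_sup_left : K₀ ⊔ K⟮ζ⟯ ≤ _) (subset_sup_adjoin _ _), hζp⟩,
      l, subset_sup_adjoin _ _, hl⟩⟩

/-- Elimination of ramification for Galois extensions. -/
theorem eliminable_of_isGalois (hinv : ∀ (σ : A ≃ₐ[K] A) (x : A), ‖σ x‖ = ‖x‖) (hp : p.Prime)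
    (hpA : ‖(p : A)‖ < 1) {ϖ : A} (hϖ : IsUnif (⊥ : IntermediateField K A) ϖ)
    (L : IntermediateField K A) [FiniteDimensional K L] [IsGalois K L] : Eliminable ⊥ L := by
  obtain ⟨K₁, hfin, -, hsep, hroots⟩ := exists_resSeparable_roots hinv hp hpA ⊥
  set N := adjoin K₁ (L : Set A) with hN
  have hNfin : FiniteDimensional K₁ N := finiteDimensional_adjoin_of_finiteDimensional K₁ L
  have hNgal : IsGalois K₁ N := isGalois_adjoin_of_isGalois K₁ L
  have hpN : (p : N) ≠ 0 → (p : A) ≠ 0 := fun h h0 => h (Subtype.ext (by simpa using h0))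
  obtain ⟨M, hM, hT⟩ := exists_primeTower (F := K₁) (N := N) hp fun h => by
    obtain ⟨⟨ζ, hζ, hζp⟩, -⟩ := hroots (hpN h)
    exact ⟨⟨ζ, hζ⟩, IsPrimitiveRoot.of_map_of_injective (f := algebraMap K₁ A) hζp
      (algebraMap K₁ A).injective⟩
  have hT' := hT.liftRestrict
  rw [liftRestrict_top] at hT'
  have hsep1 : ResSeparable K₁ (liftRestrict M) := by
    refine ResSeparable.of_degOver hinv hp hpA fun x hx hdvd => hM (hdvd.trans ?_)
    obtain ⟨y, hy, rfl⟩ := mem_liftRestrict.1 hx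
    have h1 := minpoly.algebraMap_eq (A := K₁) (algebraMap N A).injective y
    change minpoly K₁ (y : A) = _ at h1
    rw [degOver, h1]
    exact natDegree_minpoly_dvd_finrank hy
  have hfinM : FiniteDimensional K (liftRestrict M) := by
    have : FiniteDimensional K (N.restrictScalars K) := FiniteDimensional.trans K K₁ N
    exact finiteDimensional_of_le hT'.le
  obtain ⟨ϖ', hϖ'⟩ := exists_isUnif hinv hϖ (liftRestrict M) bot_le
  obtain ⟨K', hK', -, hsep', hval⟩ := Eliminable.trans bot_le
    (hsep.trans bot_le (hsep1.trans (le_liftRestrict M) (.refl _)))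
    (N := N.restrictScalars K) (by
      rw [sup_eq_left.2 hT'.le]
      refine hT'.eliminable hinv hp hpA hϖ' fun h => ?_
      obtain ⟨-, l, hl, hlp⟩ := hroots h
      exact ⟨l, le_liftRestrict M hl, hlp⟩)
  refine ⟨K', hK', bot_le, hsep', fun x hx => hval x ?_⟩
  exact (sup_le_sup_right (show L ≤ N.restrictScalars K from fun y hy => subset_adjoin K₁ _ hy) K') hx

end Main

end

/-! ### From norms back to valuations, ramification indices and residue fields. -/

section ValuationOfNorm

open Polynomial IntermediateField

theorem isRankOneDiscrete_of_exists {E : Type*} [Field E] (v : Valuation E ℤᵐ⁰) {x : E}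
    (hx : x ≠ 0) (h1 : v x ≠ 1) : v.IsRankOneDiscrete := by
  have hx' : v x ≠ 0 := (Valuation.ne_zero_iff v).2 hx
  have hmem : Units.mk0 (v x) hx' ∈ MonoidWithZeroHom.valueGroup (.ofClass v) :=
    Subgroup.subset_closure ((MonoidWithZeroHom.mem_valueMonoid_iff _).2 ⟨x, rfl⟩)
  have : Nontrivial (MonoidWithZeroHom.valueGroup (.ofClass v)) :=
    ⟨⟨⟨_, hmem⟩, 1, fun h => h1 (congrArg Units.val (congrArg Subtype.val h))⟩⟩
  infer_instance

/-- A discrete multiplicative ultrametric norm is given by an integral valuation. -/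
theorem exists_valuation {E A : Type*} [Field E] [NormedField A] [IsUltrametricDist A]
    (f : E →+* A) {ϖ : A} (h0 : 0 < ‖ϖ‖) (h1 : ‖ϖ‖ < 1)
    (h : ∀ x, x ≠ 0 → ∃ k : ℤ, ‖f x‖ = ‖ϖ‖ ^ k) {e : E} (he : f e = ϖ) :
    ∃ v : Valuation E ℤᵐ⁰, v.IsRankOneDiscrete ∧ ∀ x y, v x ≤ v y ↔ ‖f x‖ ≤ ‖f y‖ := by
  have hb : 1 < ‖ϖ‖₊⁻¹ := (one_lt_inv₀ (by exact_mod_cast h0)).2 (by exact_mod_cast h1)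
  -- This order embedding sends `exp (-k)` to ‖ϖ‖^k, so the valuation axioms are pulled back from
  -- the norm.
  set T := WithZeroMulInt.toNNReal hb.ne_zero with hT
  have hmono : StrictMono T := WithZeroMulInt.toNNReal_strictMono hb
  have hex : ∀ x, ∃ c : ℤᵐ⁰, T c = ‖f x‖₊ := by
    intro x
    by_cases hx : x = 0
    · exact ⟨0, by simp [hx]⟩
    · obtain ⟨k, hk⟩ := h x hx
      refine ⟨WithZero.exp (-k), ?_⟩
      rw [hT, WithZeroMulInt.toNNReal_neg_apply _ WithZero.exp_ne_zero]
      have : ‖f x‖₊ = ‖ϖ‖₊ ^ k := NNReal.eq (by simpa using hk)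
      change ‖ϖ‖₊⁻¹ ^ (-k) = _
      rw [this, inv_zpow', neg_neg]
  choose c hc using hex
  let v : Valuation E ℤᵐ⁰ :=
    { toFun := c
      map_zero' := hmono.injective (by rw [hc, map_zero, nnnorm_zero, map_zero])
      map_one' := hmono.injective (by rw [hc, map_one, nnnorm_one, map_one])
      map_mul' := fun x y => hmono.injective (by rw [map_mul, hc, hc, hc, map_mul, nnnorm_mul])
      map_add_le_max' := fun x y => by
        rw [← hmono.le_iff_le, hmono.monotone.map_max, hc, hc, hc, map_add]
        exact IsUltrametricDist.norm_add_le_max (f x) (f y) }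
  have hv : ∀ x y, v x ≤ v y ↔ ‖f x‖ ≤ ‖f y‖ := fun x y => by
    change c x ≤ c y ↔ _
    rw [← hmono.le_iff_le, hc, hc]
    exact Iff.rfl
  refine ⟨v, isRankOneDiscrete_of_exists v (x := e) ?_ ?_, hv⟩
  · rintro rfl
    rw [map_zero] at he
    rw [← he, norm_zero] at h0
    exact h0.false
  · intro h2
    have := (hv 1 e).1 (by rw [h2, map_one])
    rw [map_one, norm_one, he] at this
    linarith

theorem exists_ringHom_lift {E A B : Type*} [Field E] [Field A] [Field B] (ι : A →+* B)
    (j : E →+* B) (h : ∀ x, ∃ a, ι a = j x) : ∃ ρ : E →+* A, ∀ x, ι (ρ x) = j x := by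
  choose g hg using h
  exact ⟨{ toFun := g
           map_one' := ι.injective (by rw [hg, map_one, map_one])
           map_mul' := fun x y => ι.injective (by rw [map_mul, hg, hg, hg, map_mul])
           map_zero' := ι.injective (by rw [hg, map_zero, map_zero])
           map_add' := fun x y => ι.injective (by rw [map_add, hg, hg, hg, map_add]) }, hg⟩

/-- The homomorphism of residue fields induced by an embedding compatible with valuations. -/
theorem exists_residueField_hom {E A Γ : Type*} [Field E] [NormedField A] [IsUltrametricDist A]
    [LinearOrderedCommGroupWithZero Γ] (v : Valuation E Γ) (f : E →+* A)
    (h : ∀ x y, v x ≤ v y ↔ ‖f x‖ ≤ ‖f y‖) :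
    ∃ φ : ResidueField v.valuationSubring →+* Resid A,
      ∀ x : v.valuationSubring, φ (residue _ x) = res (f x) := by
  have h1 : ∀ x, v x ≤ 1 ↔ ‖f x‖ ≤ 1 := fun x => by simpa using h x 1
  let j : v.valuationSubring →+* unitBall A :=
    (f.comp v.valuationSubring.subtype).codRestrict (unitBall A).toSubring
      fun x => mem_unitBall.2 ((h1 x).1 x.2)
  have hj : ∀ x, (j x : A) = f x := fun x => rfl
  have : IsLocalHom j := by
    refine ⟨fun x hx => ?_⟩
    by_contra hx'
    have h2 : v x < 1 := (Valuation.mem_maximalIdeal_iff E v).1 ((mem_maximalIdeal _).2 hx')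
    have h3 : ‖f x‖ < 1 := by
      have := (not_congr (h 1 x)).1 (not_le.2 (by rwa [map_one]))
      simpa using this
    obtain ⟨y, hy⟩ := hx.exists_right_inv
    have h4 : ‖(j x : A) * y‖ = 1 := by
      have := congrArg (fun z : unitBall A => ‖(z : A)‖) hy
      simpa using this
    rw [norm_mul, hj] at h4
    have h5 : ‖f x‖ * ‖(y : A)‖ ≤ ‖f x‖ :=
      mul_le_of_le_one_right (norm_nonneg _) (mem_unitBall.1 y.2)
    linarith
  exact ⟨ResidueField.map j, fun x => (res_coe (j x)).symm⟩

/-- The index is the length of the localization of S modulo the extended ideal, here a residue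
field, hence of length 1. -/
theorem ramificationIdx_eq_one_of_map_maximalIdeal {R S : Type*} [CommRing R] [IsLocalRing R]
    [CommRing S] [IsLocalRing S] [Algebra R S] [(maximalIdeal S).LiesOver (maximalIdeal R)]
    (h : (maximalIdeal R).map (algebraMap R S) = maximalIdeal S) :
    (maximalIdeal S).ramificationIdx R = 1 := by
  rw [Ideal.ramificationIdx_eq (maximalIdeal R) (maximalIdeal S), ENat.toNat_eq_iff_eq_natCast,
    Nat.cast_one, Module.length_eq_one_iff, isSimpleModule_iff_isCoatom, ← Ideal.isMaximal_def,
    IsLocalRing.isMaximal_iff,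
    IsScalarTower.algebraMap_eq R S (Localization.AtPrime (maximalIdeal S)), ← Ideal.map_map, h,
    Localization.AtPrime.map_eq_maximalIdeal]

theorem ramificationIdx_eq_one_of_exists {E E' Γ Γ' : Type*} [Field E] [Field E'] [Algebra E E']
    [LinearOrderedCommGroupWithZero Γ] [LinearOrderedCommGroupWithZero Γ']
    (v : Valuation E Γ) (w : Valuation E' Γ') [v.HasExtension w]
    (h : ∀ x : E', ∃ y : E, w x = w (algebraMap E E' y)) :
    (maximalIdeal w.valuationSubring).ramificationIdx v.valuationSubring = 1 := by
  refine ramificationIdx_eq_one_of_map_maximalIdeal (le_antisymm ?_ fun x hx => ?_)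
  · exact Ideal.map_le_iff_le_comap.2
      (Valuation.HasExtension.maximalIdeal_comap_algebraMap_eq_maximalIdeal v w).ge
  · by_cases hx0 : (x : E') = 0
    · have : x = 0 := Subtype.ext hx0
      rw [this]; exact zero_mem _
    obtain ⟨y, hy⟩ := h x
    have hwx : w x < 1 := (Valuation.mem_maximalIdeal_iff E' w).1 hx
    have hy1 : v y < 1 := (Valuation.HasExtension.val_map_lt_one_iff v w y).1 (hy ▸ hwx)
    have hwy0 : w (algebraMap E E' y) ≠ 0 := by rw [← hy]; exact (Valuation.ne_zero_iff w).2 hx0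
    have hy0 : algebraMap E E' y ≠ 0 := (Valuation.ne_zero_iff w).1 hwy0
    have hu : w (x / algebraMap E E' y) ≤ 1 := by rw [map_div₀, hy, div_self hwy0]
    have e : x = algebraMap v.valuationSubring w.valuationSubring ⟨y, hy1.le⟩ *
        ⟨x / algebraMap E E' y, hu⟩ := by
      refine Subtype.ext ?_
      change (x : E') = algebraMap E E' y * (x / algebraMap E E' y)
      rw [mul_div_cancel₀ _ hy0]
    rw [e]
    refine Ideal.mul_mem_right _ _ (Ideal.mem_map_of_mem _ ?_)
    exact (Valuation.mem_maximalIdeal_iff E v).2 hy1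

/-- The minimal polynomial of the image is pulled back along φ; it kills x, and its derivative does
not. -/
theorem isSeparable_of_ringHom {F E F' E' : Type*} [Field F] [Field E] [Algebra F E] [Field F']
    [Field E'] [Algebra F' E'] (φ : F ≃+* F') (ψ : E →+* E')
    (h : ∀ x, ψ (algebraMap F E x) = algebraMap F' E' (φ x)) {x : E}
    (hx : IsSeparable F' (ψ x)) : IsSeparable F x := by
  have hcomp : ψ.comp (algebraMap F E) = (algebraMap F' E').comp (φ : F →+* F') := RingHom.ext h
  have hmap : ∀ f : F'[X], ψ (aeval x (f.map (φ.symm : F' →+* F))) = aeval (ψ x) f := by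
    intro f
    rw [aeval_def, hom_eval₂, hcomp, eval₂_map, aeval_def]
    congr 1
    ext y
    simp
  refine isSeparable_of_aeval_derivative_ne_zero
    (f := (minpoly F' (ψ x)).map (φ.symm : F' →+* F)) (ψ.injective ?_) fun h0 => ?_
  · rw [hmap, minpoly.aeval, map_zero]
  · rw [derivative_map] at h0
    have := hmap (derivative (minpoly F' (ψ x)))
    rw [h0, map_zero] at this
    exact hx.aeval_derivative_ne_zero (minpoly.aeval _ _) this.symm

end ValuationOfNorm

/-! ### The theorem over `Ω`, deduced from the normed field `A`. -/

section Transfer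

open IntermediateField

theorem exists_extension_of_norm {K A Γ Ω : Type*} [Field K] [NormedField A] [IsUltrametricDist A]
    [Algebra K A] [Algebra.IsAlgebraic K A] [IsAlgClosed A] [LinearOrderedCommGroupWithZero Γ]
    (v : Valuation K Γ) [v.IsRankOneDiscrete] {p : ℕ} (hp : p.Prime)
    [CharP (ResidueField v.valuationSubring) p]
    (hinv : ∀ (σ : A ≃ₐ[K] A) (x : A), ‖σ x‖ = ‖x‖)
    (hv : ∀ x y, v x ≤ v y ↔ ‖algebraMap K A x‖ ≤ ‖algebraMap K A y‖)
    [Field Ω] [Algebra K Ω] (ι : A →ₐ[K] Ω) (L : IntermediateField K Ω) [FiniteDimensional K L]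
    [IsGalois K L] (hL : L ≤ ι.fieldRange) :
    ∃ K' : IntermediateField K Ω, FiniteDimensional K K' ∧
      ∃ (v' : Valuation K' ℤᵐ⁰)
        (w : Valuation (IntermediateField.extendScalars (le_sup_right : K' ≤ L ⊔ K')) ℤᵐ⁰)
        (_ : v.HasExtension v') (_ : v'.HasExtension w),
        v'.IsRankOneDiscrete ∧ w.IsRankOneDiscrete ∧
        (maximalIdeal w.valuationSubring).ramificationIdx v'.valuationSubring = 1 ∧
        Algebra.IsSeparable (ResidueField v.valuationSubring)
          (ResidueField v'.valuationSubring) := by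
  have hι : Function.Injective ι := ι.toRingHom.injective
  have hlt : ∀ x y, v x < v y ↔ ‖algebraMap K A x‖ < ‖algebraMap K A y‖ := fun x y => by
    simpa using not_congr (hv y x)
  have hpA : ‖(p : A)‖ < 1 := by
    have h1 : residue v.valuationSubring (p : v.valuationSubring) = 0 := by
      rw [map_natCast, CharP.cast_eq_zero]
    have h2 := (Valuation.mem_maximalIdeal_iff K v).1 ((residue_eq_zero_iff _).1 h1)
    have h3 := (hlt p 1).1 (by simpa using h2)
    simpa using h3
  have hϖ : ∃ ϖ, IsUnif (⊥ : IntermediateField K A) ϖ := by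
    obtain ⟨π, hπ⟩ := Valuation.IsRankOneDiscrete.generator_mem_range K v
    have hπ0 : v π ≠ 0 := by rw [hπ]; exact Units.ne_zero _
    have hπ1 : v π < 1 := by
      rw [hπ]; exact_mod_cast Valuation.IsRankOneDiscrete.generator_lt_one v
    refine ⟨algebraMap K A π, _root_.algebraMap_mem _ _, ?_, ?_, fun x hx hx0 => ?_⟩
    · exact norm_pos_iff.2 ((map_ne_zero _).2 ((Valuation.ne_zero_iff v).1 hπ0))
    · simpa using (hlt π 1).1 (by simpa using hπ1)
    · obtain ⟨y, rfl⟩ := mem_bot.1 hx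
      have hy0 : v y ≠ 0 := (Valuation.ne_zero_iff v).2 ((map_ne_zero _).1 hx0)
      have h1 : v y ∈ Set.range v \ {0} := ⟨⟨y, rfl⟩, hy0⟩
      rw [← Valuation.IsRankOneDiscrete.generator_zpowers_eq_range] at h1
      obtain ⟨_, ⟨k, rfl⟩, hk⟩ := h1
      have h2 : v y = v (π ^ k) := by
        rw [map_zpow₀, hπ, ← hk]; simp
      refine ⟨k, ?_⟩
      rw [← norm_zpow, ← map_zpow₀]
      exact le_antisymm ((hv _ _).1 h2.le) ((hv _ _).1 h2.ge)
  obtain ⟨ϖ, hϖ⟩ := hϖ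
  -- The elimination takes place in `A`, and the resulting field is pushed forward along ι. Its
  -- valuation and that of the composite are read off from the norm through the lifts ρ and τ.
  set LA := L.comap ι with hLA
  have hmap : LA.map ι = L := by
    ext x
    refine ⟨fun ⟨y, hy, hyx⟩ => hyx ▸ hy, fun hx => ?_⟩
    obtain ⟨y, rfl⟩ := hL hx
    exact ⟨y, hx, rfl⟩
  have eL : LA ≃ₐ[K] L := (equivMap LA ι).trans (equivOfEq hmap)
  have hfinL : FiniteDimensional K LA := LinearEquiv.finiteDimensional eL.symm.toLinearEquiv
  have hgalL : IsGalois K LA := IsGalois.of_algEquiv eL.symm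
  obtain ⟨KA, hfin, -, hsep, hval⟩ := eliminable_of_isGalois hinv hp hpA hϖ LA
  set K' := KA.map ι with hK'
  have hfin' : FiniteDimensional K K' :=
    LinearEquiv.finiteDimensional (equivMap KA ι).toLinearEquiv
  have hsup : L ⊔ K' = (LA ⊔ KA).map ι := by rw [IntermediateField.map_sup, hmap]
  have hmemK : ∀ x : K', ∃ a, ι a = x := fun x => by
    obtain ⟨a, -, ha⟩ := x.2
    exact ⟨a, ha⟩
  have hmemE : ∀ x : extendScalars (le_sup_right : K' ≤ L ⊔ K'), ∃ a ∈ LA ⊔ KA, ι a = x :=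
    fun x => by
      have h1 : (x : Ω) ∈ (LA ⊔ KA).map ι := hsup ▸ x.2
      obtain ⟨a, ha, hax⟩ := h1
      exact ⟨a, ha, hax⟩
  obtain ⟨ρ, hρ⟩ := exists_ringHom_lift (ι : A →+* Ω) (algebraMap K' Ω) hmemK
  obtain ⟨τ, hτ⟩ := exists_ringHom_lift (ι : A →+* Ω)
    (algebraMap (extendScalars (le_sup_right : K' ≤ L ⊔ K')) Ω)
    fun x => (hmemE x).imp fun a ha => ha.2
  replace hρ : ∀ x : K', ι (ρ x) = x := hρ
  replace hτ : ∀ x : extendScalars (le_sup_right : K' ≤ L ⊔ K'), ι (τ x) = x := hτ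
  have hρK : ∀ x, ρ x ∈ KA := fun x => by
    obtain ⟨a, ha, hax⟩ := x.2
    have : ρ x = a := hι ((hρ x).trans hax.symm)
    rwa [this]
  have hτE : ∀ x, τ x ∈ LA ⊔ KA := fun x => by
    obtain ⟨a, ha, hax⟩ := hmemE x
    have : τ x = a := hι ((hτ x).trans hax.symm)
    rwa [this]
  have hρsurj : ∀ a ∈ KA, ∃ x, ρ x = a := fun a ha =>
    ⟨⟨ι a, a, ha, rfl⟩, hι (hρ _)⟩
  have hρalg : ∀ x, ρ (algebraMap K K' x) = algebraMap K A x := fun x =>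
    hι (by rw [hρ, ι.commutes]; rfl)
  have hτalg : ∀ x, τ (algebraMap K' _ x) = ρ x := fun x =>
    hι (by rw [hτ, hρ]; rfl)
  obtain ⟨ϖ', hϖ'⟩ := exists_isUnif hinv hϖ KA bot_le
  have hϖE := hϖ'.of_sameValues (le_sup_right : KA ≤ LA ⊔ KA) hval
  obtain ⟨e, he⟩ := hρsurj ϖ' hϖ'.mem
  obtain ⟨v', hv'd, hv'⟩ := exists_valuation ρ hϖ'.pos hϖ'.lt_one
    (fun x hx => hϖ'.exists_zpow _ (hρK x) ((map_ne_zero _).2 hx)) he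
  obtain ⟨w, hwd, hw⟩ := exists_valuation τ hϖE.pos hϖE.lt_one
    (fun x hx => hϖE.exists_zpow _ (hτE x) ((map_ne_zero _).2 hx)) ((hτalg e).trans he)
  have hext : v.HasExtension v' := ⟨fun x y => by
    rw [Valuation.comap_apply, Valuation.comap_apply, hv', hρalg, hρalg, hv]⟩
  have hext' : v'.HasExtension w := ⟨fun x y => by
    rw [Valuation.comap_apply, Valuation.comap_apply, hw, hτalg, hτalg, hv']⟩
  refine ⟨K', hfin', v', w, hext, hext', hv'd, hwd,
    ramificationIdx_eq_one_of_exists v' w fun x => ?_, ⟨fun x => ?_⟩⟩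
  · obtain ⟨y, hy, hxy⟩ := hval _ (hτE x)
    obtain ⟨y, rfl⟩ := hρsurj y hy
    refine ⟨y, ?_⟩
    rw [← hτalg] at hxy
    exact le_antisymm ((hw _ _).2 hxy.le) ((hw _ _).2 hxy.ge)
  · obtain ⟨φ, hφ⟩ := exists_residueField_hom v (algebraMap K A) hv
    obtain ⟨ψ, hψ⟩ := exists_residueField_hom v' ρ hv'
    have hv1 : ∀ x, v x ≤ 1 ↔ ‖algebraMap K A x‖ ≤ 1 := fun x => by simpa using hv x 1
    have hφr : ∀ y, φ y ∈ resid (⊥ : IntermediateField K A) := fun y => by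
      obtain ⟨y, rfl⟩ := residue_surjective y
      rw [hφ]
      exact res_mem_resid (_root_.algebraMap_mem _ _) ((hv1 _).1 y.2)
    have hφs : Function.Bijective (φ.codRestrict (resid (⊥ : IntermediateField K A)) hφr) := by
      refine ⟨RingHom.injective _, fun ⟨y, hy⟩ => ?_⟩
      obtain ⟨a, ha, ha1, rfl⟩ := mem_resid.1 hy
      obtain ⟨b, rfl⟩ := mem_bot.1 ha
      exact ⟨residue _ ⟨b, (hv1 b).2 ha1⟩, Subtype.ext (hφ _)⟩
    refine isSeparable_of_ringHom (RingEquiv.ofBijective _ hφs) ψ (fun y => ?_) ?_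
    · obtain ⟨y, rfl⟩ := residue_surjective y
      rw [Valuation.HasExtension.algebraMap_residue_eq_residue_algebraMap, hψ]
      refine Eq.trans ?_ (hφ y).symm
      rw [Valuation.HasExtension.coe_algebraMap_valuationSubring_eq, hρalg]
    · obtain ⟨y, rfl⟩ := residue_surjective x
      rw [hψ]
      have h1 : ‖ρ y‖ ≤ 1 := by simpa using (hv' y 1).1 (by rw [map_one]; exact y.2)
      exact hsep _ (res_mem_resid (hρK _) h1)

end Transfer

/-- `K` is complete with respect to the discrete valuation `Valued.v`, and all extensions of `K`
live in an algebraically closed field `Ω`.  The valuation of `K` has, up to equivalence, exactly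
one extension to each finite extension of `K`; `v'` and `w` are these extensions to `K'` and to
the composite field `L K'`, here viewed as an extension of `K'`. -/
theorem mainTheorem4 {K Γ Ω : Type*} [Field K] [LinearOrderedCommGroupWithZero Γ]
    [Valued K Γ] [(Valued.v : Valuation K Γ).IsRankOneDiscrete] [CompleteSpace K]
    (p : ℕ) (hp : p.Prime)
    [CharP (ResidueField (Valued.v : Valuation K Γ).valuationSubring) p]
    [Field Ω] [Algebra K Ω] [IsAlgClosed Ω]
    (L : IntermediateField K Ω) [FiniteDimensional K L] [IsGalois K L] :
    ∃ K' : IntermediateField K Ω, FiniteDimensional K K' ∧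
      ∃ (v' : Valuation K' ℤᵐ⁰)
        (w : Valuation (IntermediateField.extendScalars (le_sup_right : K' ≤ L ⊔ K')) ℤᵐ⁰)
        (_ : (Valued.v : Valuation K Γ).HasExtension v') (_ : v'.HasExtension w),
        v'.IsRankOneDiscrete ∧ w.IsRankOneDiscrete ∧
        (maximalIdeal w.valuationSubring).ramificationIdx v'.valuationSubring = 1 ∧
        Algebra.IsSeparable (ResidueField (Valued.v : Valuation K Γ).valuationSubring)
          (ResidueField v'.valuationSubring) := by
  -- The base 2 is arbitrary; any real number above 1 turns the discrete valuation into a norm.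
  let : (Valued.v : Valuation K Γ).RankOne :=
    Valuation.IsRankOneDiscrete.rankOne _ (one_lt_two : (1 : NNReal) < 2)
  let : NontriviallyNormedField K := Valued.toNontriviallyNormedField K Γ
  have : IsUltrametricDist K := inferInstanceAs (@IsUltrametricDist K
    (Valued.toNormedField K Γ).toDist)
  -- `Ω` may be transcendental over `K`, so the norm is put on the algebraic closure of `K` in `Ω`.
  -- Completeness makes the spectral norm multiplicative, and it is invariant because conjugates
  -- share a minimal polynomial.
  let : NormedField (algebraicClosure K Ω) := spectralNorm.normedField K (algebraicClosure K Ω)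
  have : IsUltrametricDist (algebraicClosure K Ω) :=
    IsUltrametricDist.isUltrametricDist_of_isNonarchimedean_norm isNonarchimedean_spectralNorm
  have : IsAlgClosed (algebraicClosure K Ω) :=
    (inferInstance : IsAlgClosure K (algebraicClosure K Ω)).isAlgClosed
  refine exists_extension_of_norm (A := algebraicClosure K Ω) (Valued.v : Valuation K Γ) hp
    (fun σ x => (spectralNorm_eq_of_equiv σ x).symm) (fun x y => ?_) (algebraicClosure K Ω).val L ?_
  · refine Iff.trans Valued.toNormedField.norm_le_iff.symm ?_
    exact Iff.of_eq (congrArg₂ (· ≤ ·) (spectralNorm_extends x).symm (spectralNorm_extends y).symm)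
  · rw [IntermediateField.fieldRange_val]
    exact le_algebraicClosure K Ω L
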